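/- Let $\nu\ge 2$ be an integer, $G$ an (additive) abelian group and $\sigma:G\to\mathbb C^\times$ a group homomorphism. *The Lie algebra.* Let $\mathcal R_\sigma$ be the skew Laurent polynomial ring with $\mathbb C$-basis $t^me^\alpha$ ($m\in\mathbb Z$, $\alpha\in G$) and product $t^me^\alpha\cdot t^ne^\beta=\sigma(\alpha)^n\,t^{m+n}e^{\alpha+\beta}$. Let $\bar{\ }$ be its $\mathbb C$-linear anti-involution with $\bar t=-t$, $\overline{e^\alpha}=e^{-\alpha}$, so $\overline{t^me^\alpha}=(-\sigma(\alpha))^{-m}t^me^{-\alpha}$. Let $\mathfrak u_\nu(\mathcal R_\sigma,\bar{\ })=\{X\in M_\nu(\mathcal R_\sigma): \overline X^{\,t}=-X\}$ with the commutator bracket, and let $e_{ij}(m,\alpha)=E_{ij}t^me^\alpha-E_{ji}\overline{t^me^\alpha}$. Let $\widehat{\mathfrak u}_\nu(\mathcal R_\sigma,\bar{\ })=\mathfrak u_\nu(\mathcal R_\sigma,\bar{\ })\oplus\mathbb Cc$ be the central extension obtained by restricting to $\mathfrak u_\nu(\mathcal R_\sigma,\bar{\ })\oplus\mathbb Cc$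 the bracket of $gl_\nu(\mathcal R_\sigma)\oplus\mathbb Cc$ in which $c$ is central and $$[E_{ij}t^me^\alpha,E_{kl}t^ne^\beta]=\delta_{jk}\sigma(\alpha)^nE_{il}t^{m+n}e^{\alpha+\beta}-\delta_{il}\sigma(\beta)^mE_{kj}t^{m+n}e^{\alpha+\beta}+m\,\delta_{il}\delta_{jk}\delta_{m+n,0}\delta_{\sigma(\alpha)\sigma(\beta),1}\sigma(\alpha)^n c .$$ *The Fock space.* Let $\Gamma=\bigoplus_{i=1}^\nu\mathbb Z\epsilon_i$, and let $\varepsilon:\Gamma\times\Gamma\to\{\pm1\}$ be the bimultiplicative map with $\varepsilon(\epsilon_i,\epsilon_j)=1$ if $i\le j$ and $-1$ if $i>j$. Let $\mathbb C[\bar\Gamma]$ be the algebra with basis $e^{\bar\alpha}$, $\bar\alpha\in\bar\Gamma=\Gamma/2\Gamma$, and product $e^{\bar\alpha}e^{\bar\beta}=\varepsilon(\alpha,\beta)e^{\overline{\alpha+\beta}}$. Let $\mathcal S(\mathcal H^-)$ be the polynomial algebra in the variables $\epsilon_i(-n)$, $1\le i\le\nu$, $n\ge1$ odd, and put $M=\mathbb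 C[\bar\Gamma]\otimes\mathcal S(\mathcal H^-)$. On $\mathcal S(\mathcal H^-)$, for $n\geq 1$ odd, $\epsilon_i(-n)$ acts by multiplication and $\epsilon_i(n)$ by $\frac n2\,\partial/\partial\epsilon_i(-n)$; for $\alpha=\sum_i m_i\epsilon_i\in\Gamma$ put $\alpha(n)=\sum_i m_i\epsilon_i(n)$, and $$E_\pm(\alpha,z)=\exp\Big(-2\sum_{n\in\pm(2\mathbb N+1)}\frac{\alpha(n)}n z^{-n}\Big),\qquad \mathbb N=\{0,1,2,\dots\}.$$ For $a\in\mathbb C^\times$ define operators $x_{ij}(a,n)$ on $M$ by $\sum_{n\in\mathbb Z}x_{ij}(a,n)z^{-n}=X_{ij}(a,z)$, where $$X_{ij}(a,z)=\begin{cases}\varepsilon(\epsilon_i,\epsilon_j)e^{\overline{\epsilon_i-\epsilon_j}}E_-(\epsilon_i,z)E_-(-\epsilon_j,az)E_+(\epsilon_i,z)E_+(-\epsilon_j,az), & i\ne j,\\ 4\sum_{n\in2\mathbb Z+1}\epsilon_i(n)z^{-n}, & i=j,\ a=1,\\ \frac{1+a}{1-a}\big(E_-(\epsilon_i,z)E_-(-\epsilon_i,az)E_+(\epsilon_i,z)E_+(-\epsilon_i,az)-1\big),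 & i=j,\ a\ne1,\end{cases}$$ and $e^{\overline{\epsilon_i-\epsilon_j}}$ acts on $\mathbb C[\bar\Gamma]$ by left multiplication. **Theorem.** There is a unique representation of the Lie algebra $\widehat{\mathfrak u}_\nu(\mathcal R_\sigma,\bar{\ })$ on $M$ such that, for all $1\le i,j\le\nu$, $m\in\mathbb Z$, $\alpha\in G$, $$2e_{ij}(m,\alpha)\mapsto x_{ij}(\sigma(\alpha),m)+\delta_{ij}\,\delta_{m,0}\,(1-\delta_{\sigma(\alpha),1})\frac{1+\sigma(\alpha)}{1-\sigma(\alpha)}\,\mathrm{id}_M,\qquad c\mapsto\tfrac12\,\mathrm{id}_M ,$$ where the last summand of the first formula is read as $0$ when $\sigma(\alpha)=1$. -/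

import Mathlib

open scoped TensorProduct Nat

attribute [local instance 100] LieRing.ofAssociativeRing

noncomputable section

namespace UnitaryVertex

/-! ### The skew Laurent polynomial ring and its anti-involution -/

section SkewLaurent

variable {G : Type*} [AddCommGroup G]

/-- The skew Laurent polynomial ring `ℂ[G][t^{±1}, σ]`: the complex vector space with basis
`t^m e^α`, indexed by the pairs `(m, α)`, with the ring structure given below. -/
def SkewLaurent (_σ : AddChar G ℂˣ) : Type _ := (ℤ × G) →₀ ℂ

namespace SkewLaurent

variable (σ : AddChar G ℂˣ)

instance : AddCommGroup (SkewLaurent σ) := inferInstanceAs (AddCommGroup ((ℤ × G) →₀ ℂ))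

instance : Module ℂ (SkewLaurent σ) := inferInstanceAs (Module ℂ ((ℤ × G) →₀ ℂ))

/-- The basis element `t^m e^α`. -/
def mono (m : ℤ) (α : G) : SkewLaurent σ := Finsupp.single (m, α) (1 : ℂ)

/-- The linear map determined by its values on the basis elements `t^m e^α`. -/
def lift {N : Type*} [AddCommMonoid N] [Module ℂ N] (f : ℤ → G → N) : SkewLaurent σ →ₗ[ℂ] N :=
  Finsupp.linearCombination ℂ fun x : ℤ × G => f x.1 x.2

variable {σ}

@[simp] theorem lift_mono {N : Type*} [AddCommMonoid N] [Module ℂ N] (f : ℤ → G → N)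
    (m : ℤ) (α : G) : lift σ f (mono σ m α) = f m α := by
  unfold lift mono
  exact (Finsupp.linearCombination_single ℂ (1 : ℂ) ((m, α) : ℤ × G)).trans (one_smul ℂ _)

theorem mono_induction {P : SkewLaurent σ → Prop} (x : SkewLaurent σ) (h0 : P 0)
    (hm : ∀ m α, P (mono σ m α)) (hadd : ∀ x y, P x → P y → P (x + y))
    (hsmul : ∀ (c : ℂ) x, P x → P (c • x)) : P x := by
  refine Finsupp.induction_linear (motive := P) x h0 hadd fun b c => ?_
  have h : (Finsupp.single b c : (ℤ × G) →₀ ℂ) = c • Finsupp.single b (1 : ℂ) := by simp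
  rw [h]
  exact hsmul c _ (hm b.1 b.2)

variable (σ)

/-- The multiplication, determined by `t^m e^α * t^n e^β = σ(α)^n t^{m+n} e^{α+β}`. -/
def mulₗ : SkewLaurent σ →ₗ[ℂ] SkewLaurent σ →ₗ[ℂ] SkewLaurent σ :=
  lift σ fun m α => lift σ fun n β => ((σ α ^ n : ℂˣ) : ℂ) • mono σ (m + n) (α + β)

instance : Mul (SkewLaurent σ) := ⟨fun x y => mulₗ σ x y⟩

instance : One (SkewLaurent σ) := ⟨mono σ 0 0⟩

variable {σ}

theorem mul_def (x y : SkewLaurent σ) : x * y = mulₗ σ x y := rfl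

theorem one_def : (1 : SkewLaurent σ) = mono σ 0 0 := rfl

theorem mono_mul_mono (m n : ℤ) (α β : G) :
    mono σ m α * mono σ n β = ((σ α ^ n : ℂˣ) : ℂ) • mono σ (m + n) (α + β) := by
  simp [mul_def, mulₗ]

theorem add_mul' (x y z : SkewLaurent σ) : (x + y) * z = x * z + y * z := by simp [mul_def]

theorem mul_add' (x y z : SkewLaurent σ) : x * (y + z) = x * y + x * z := by simp [mul_def]

theorem smul_mul' (c : ℂ) (x y : SkewLaurent σ) : (c • x) * y = c • (x * y) := by simp [mul_def]

theorem mul_smul' (c : ℂ) (x y : SkewLaurent σ) : x * (c • y) = c • (x * y) := by simp [mul_def]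

theorem zero_mul' (x : SkewLaurent σ) : 0 * x = 0 := by simp [mul_def]

theorem mul_zero' (x : SkewLaurent σ) : x * 0 = 0 := by simp [mul_def]

theorem mul_assoc' (x y z : SkewLaurent σ) : x * y * z = x * (y * z) := by
  induction x using mono_induction with
  | h0 => simp only [zero_mul']
  | hadd x x' h h' => simp only [add_mul', h, h']
  | hsmul c x h => simp only [smul_mul', h]
  | hm m α =>
  induction y using mono_induction with
  | h0 => simp only [zero_mul', mul_zero']
  | hadd x x' h h' => simp only [add_mul', mul_add', h, h']
  | hsmul c x h => simp only [smul_mul', mul_smul', h]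
  | hm n β =>
  induction z using mono_induction with
  | h0 => simp only [mul_zero']
  | hadd x x' h h' => simp only [mul_add', h, h']
  | hsmul c x h => simp only [mul_smul', h]
  | hm p γ =>
  simp only [mono_mul_mono, smul_mul', mul_smul', smul_smul, add_assoc]
  congr 1
  rw [← Units.val_mul, ← Units.val_mul, Units.val_inj, AddChar.map_add_eq_mul, mul_zpow, zpow_add]
  rw [← mul_assoc, mul_comm]

theorem one_mul' (x : SkewLaurent σ) : 1 * x = x := by
  induction x using mono_induction with
  | h0 => simp only [mul_zero']
  | hadd x x' h h' => simp only [mul_add', h, h']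
  | hsmul c x h => simp only [mul_smul', h]
  | hm m α => simp [one_def, mono_mul_mono]

theorem mul_one' (x : SkewLaurent σ) : x * 1 = x := by
  induction x using mono_induction with
  | h0 => simp only [zero_mul']
  | hadd x x' h h' => simp only [add_mul', h, h']
  | hsmul c x h => simp only [smul_mul', h]
  | hm m α => simp [one_def, mono_mul_mono]

instance : Ring (SkewLaurent σ) :=
  { (inferInstance : AddCommGroup (SkewLaurent σ)),
    (inferInstance : Mul (SkewLaurent σ)), (inferInstance : One (SkewLaurent σ)) with
    left_distrib := mul_add'
    right_distrib := add_mul'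
    zero_mul := zero_mul'
    mul_zero := mul_zero'
    mul_assoc := mul_assoc'
    one_mul := one_mul'
    mul_one := mul_one' }

instance : Algebra ℂ (SkewLaurent σ) := Algebra.ofModule smul_mul' mul_smul'

variable (σ)

/-- The anti-involution `x ↦ x̄` with `t̄ = -t` and `\overline{e^α} = e^{-α}`; on the basis it is
`t^m e^α ↦ (-σ(α))^{-m} t^m e^{-α}`. -/
def bar : SkewLaurent σ →ₗ[ℂ] SkewLaurent σ :=
  lift σ fun m α => (((-σ α) ^ (-m) : ℂˣ) : ℂ) • mono σ m (-α)

variable {σ}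

theorem bar_mono (m : ℤ) (α : G) :
    bar σ (mono σ m α) = (((-σ α) ^ (-m) : ℂˣ) : ℂ) • mono σ m (-α) := by
  simp [bar]

theorem bar_mul (x y : SkewLaurent σ) : bar σ (x * y) = bar σ y * bar σ x := by
  induction x using mono_induction with
  | h0 => simp
  | hadd x x' h h' => simp only [add_mul, mul_add, map_add, h, h']
  | hsmul c x h => simp only [smul_mul_assoc, mul_smul_comm, map_smul, h]
  | hm m α =>
  induction y using mono_induction with
  | h0 => simp
  | hadd x x' h h' => simp only [add_mul, mul_add, map_add, h, h']
  | hsmul c x h => simp only [smul_mul_assoc, mul_smul_comm, map_smul, h]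
  | hm n β =>
  simp only [mono_mul_mono, bar_mono, smul_mul_assoc, mul_smul_comm, map_smul, smul_smul]
  rw [neg_add_rev α β, add_comm m n]
  congr 1
  simp only [← Units.val_mul, Units.val_inj, AddChar.map_add_eq_mul, AddChar.map_neg_eq_inv,
    neg_eq_neg_one_mul (σ α), neg_eq_neg_one_mul (σ β), neg_eq_neg_one_mul (σ α * σ β),
    mul_zpow, zpow_add, inv_zpow, zpow_neg, neg_add, mul_inv]
  generalize ((-1 : ℂˣ) ^ n)⁻¹ = a
  generalize ((-1 : ℂˣ) ^ m)⁻¹ = b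
  generalize (σ α ^ m)⁻¹ = c
  generalize (σ β ^ n)⁻¹ = d
  generalize (σ β ^ m)⁻¹ = e
  generalize σ α ^ n = f
  calc f * (a * (f⁻¹ * d) * (b * (c * e))) = f * f⁻¹ * (a * d * (b * (c * e))) := by
        simp only [mul_left_comm, mul_assoc]
    _ = b * c * (a * d * e) := by
        rw [mul_inv_cancel, one_mul]
        simp only [mul_left_comm, mul_assoc]

theorem bar_bar (x : SkewLaurent σ) : bar σ (bar σ x) = x := by
  induction x using mono_induction with
  | h0 => simp
  | hadd x x' h h' => simp only [map_add, h, h']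
  | hsmul c x h => simp only [map_smul, h]
  | hm m α =>
  simp only [bar_mono, map_smul, smul_smul, neg_neg, ← Units.val_mul, AddChar.map_neg_eq_inv,
    neg_eq_neg_one_mul (σ α), neg_eq_neg_one_mul (σ α)⁻¹, mul_zpow, inv_zpow]
  rw [mul_mul_mul_comm, ← mul_zpow, mul_inv_cancel]
  simp

theorem bar_t : bar σ (mono σ 1 0) = -mono σ 1 0 := by
  simp [bar_mono, Units.val_neg]

theorem bar_e (α : G) : bar σ (mono σ 0 α) = mono σ 0 (-α) := by
  simp [bar_mono]

open Classical in
/-- The bilinear form on the skew Laurent polynomial ring given by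
`(t^m e^α, t^n e^β) ↦ m δ_{m+n,0} δ_{σ(α)σ(β),1} σ(α)^n`. -/
def form (σ : AddChar G ℂˣ) : SkewLaurent σ →ₗ[ℂ] SkewLaurent σ →ₗ[ℂ] ℂ :=
  lift σ fun m α => lift σ fun n β =>
    if m + n = 0 ∧ σ α * σ β = 1 then (m : ℂ) * ((σ α ^ n : ℂˣ) : ℂ) else 0

open Classical in
theorem form_mono (m n : ℤ) (α β : G) : form σ (mono σ m α) (mono σ n β) =
    if m + n = 0 ∧ σ α * σ β = 1 then (m : ℂ) * ((σ α ^ n : ℂˣ) : ℂ) else 0 := by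
  simp [form]

theorem form_skew (x y : SkewLaurent σ) : form σ x y = -form σ y x := by
  induction x using mono_induction with
  | h0 => simp
  | hadd x x' h h' => simp only [map_add, LinearMap.add_apply, h, h']; ring
  | hsmul c x h => simp only [map_smul, LinearMap.smul_apply, h, smul_neg]
  | hm m α =>
  induction y using mono_induction with
  | h0 => simp
  | hadd x x' h h' => simp only [map_add, LinearMap.add_apply, h, h']; ring
  | hsmul c x h => simp only [map_smul, LinearMap.smul_apply, h, smul_neg]
  | hm n β =>
  rw [form_mono, form_mono]
  by_cases h : m + n = 0 ∧ σ α * σ β = 1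
  · have h' : n + m = 0 ∧ σ β * σ α = 1 := by rwa [add_comm, mul_comm]
    rw [if_pos h, if_pos h', eq_neg_of_add_eq_zero_right h.1, eq_inv_of_mul_eq_one_right h.2]
    simp
  · have h' : ¬ (n + m = 0 ∧ σ β * σ α = 1) := by rwa [add_comm, mul_comm]
    rw [if_neg h, if_neg h', neg_zero]

theorem form_cyclic (x y z : SkewLaurent σ) :
    form σ (x * y) z + form σ (y * z) x + form σ (z * x) y = 0 := by
  induction x using mono_induction with
  | h0 => simp
  | hadd x x' h h' =>
    simp only [add_mul, mul_add, map_add, LinearMap.add_apply]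
    linear_combination h + h'
  | hsmul c x h =>
    simp only [smul_mul_assoc, mul_smul_comm, map_smul, LinearMap.smul_apply, smul_eq_mul]
    linear_combination c * h
  | hm m α =>
  induction y using mono_induction with
  | h0 => simp
  | hadd x x' h h' =>
    simp only [add_mul, mul_add, map_add, LinearMap.add_apply]
    linear_combination h + h'
  | hsmul c x h =>
    simp only [smul_mul_assoc, mul_smul_comm, map_smul, LinearMap.smul_apply, smul_eq_mul]
    linear_combination c * h
  | hm n β =>
  induction z using mono_induction with
  | h0 => simp
  | hadd x x' h h' =>
    simp only [add_mul, mul_add, map_add, LinearMap.add_apply]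
    linear_combination h + h'
  | hsmul c x h =>
    simp only [smul_mul_assoc, mul_smul_comm, map_smul, LinearMap.smul_apply, smul_eq_mul]
    linear_combination c * h
  | hm p γ =>
  simp only [mono_mul_mono, map_smul, LinearMap.smul_apply, form_mono, AddChar.map_add_eq_mul,
    smul_eq_mul]
  by_cases h : m + n + p = 0 ∧ σ α * σ β * σ γ = 1
  · have h1 : n + p + m = 0 ∧ σ β * σ γ * σ α = 1 :=
      ⟨by linarith [h.1], by rw [← h.2]; ac_rfl⟩
    have h2 : p + m + n = 0 ∧ σ γ * σ α * σ β = 1 :=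
      ⟨by linarith [h.1], by rw [← h.2]; ac_rfl⟩
    rw [if_pos h, if_pos h1, if_pos h2]
    have hp : p = -m - n := by linarith [h.1]
    have hγ : σ γ = (σ α)⁻¹ * (σ β)⁻¹ := by
      rw [← mul_inv]; exact eq_inv_of_mul_eq_one_right h.2
    subst hp
    rw [hγ]
    have ha : (σ α : ℂ) ≠ 0 := (σ α).ne_zero
    have hb : (σ β : ℂ) ≠ 0 := (σ β).ne_zero
    push_cast
    simp only [mul_zpow, zpow_sub₀ ha, zpow_sub₀ hb, zpow_neg, inv_zpow]
    field_simp
    ring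
  · have h1 : ¬ (n + p + m = 0 ∧ σ β * σ γ * σ α = 1) := fun h1 =>
      h ⟨by linarith [h1.1], by rw [← h1.2]; ac_rfl⟩
    have h2 : ¬ (p + m + n = 0 ∧ σ γ * σ α * σ β = 1) := fun h2 =>
      h ⟨by linarith [h2.1], by rw [← h2.2]; ac_rfl⟩
    rw [if_neg h, if_neg h1, if_neg h2]
    simp

end SkewLaurent

/-! ### The unitary Lie algebra and its one-dimensional central extension -/

open SkewLaurent

variable (ν : ℕ) (σ : AddChar G ℂˣ)

/-- The associative algebra `M_ν(R_σ)`; as a Lie algebra under the commutator it is `gl_ν(R_σ)`. -/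
abbrev MatAlg : Type _ := Matrix (Fin ν) (Fin ν) (SkewLaurent σ)

variable {ν σ}

/-- `X ↦ X^* = \bar{X}^t`. -/
def conj (X : MatAlg ν σ) : MatAlg ν σ := (X.map (bar σ)).transpose

theorem conj_apply (X : MatAlg ν σ) (i j : Fin ν) : conj X i j = bar σ (X j i) := rfl

theorem conj_mul (X Y : MatAlg ν σ) : conj (X * Y) = conj Y * conj X := by
  ext1 i j
  simp [conj_apply, Matrix.mul_apply, bar_mul]

theorem conj_add (X Y : MatAlg ν σ) : conj (X + Y) = conj X + conj Y := by
  ext1 i j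
  simp [conj_apply]

theorem conj_sub (X Y : MatAlg ν σ) : conj (X - Y) = conj X - conj Y := by
  ext1 i j
  simp [conj_apply]

theorem conj_smul (c : ℂ) (X : MatAlg ν σ) : conj (c • X) = c • conj X := by
  ext1 i j
  simp [conj_apply]

variable (ν σ)

/-- The unitary Lie algebra `u_ν(R_σ, ¯) = {X | X^* = -X}`, inside `gl_ν(R_σ)`. -/
def unitary : LieSubalgebra ℂ (MatAlg ν σ) where
  carrier := {X | conj X = -X}
  add_mem' {X Y} hX hY := by
    simp only [Set.mem_ofPred_eq] at *
    rw [conj_add, hX, hY, neg_add]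
  zero_mem' := by
    ext1 i j
    simp [conj_apply]
  smul_mem' c X hX := by
    simp only [Set.mem_ofPred_eq] at *
    rw [conj_smul, hX, smul_neg]
  lie_mem' {X Y} hX hY := by
    change conj X = -X at hX
    change conj Y = -Y at hY
    change conj ⁅X, Y⁆ = -⁅X, Y⁆
    rw [Ring.lie_def, conj_sub, conj_mul, conj_mul, hX, hY]
    noncomm_ring

/-- The 2-cocycle on `gl_ν(R_σ)`: it is the bilinear form with
`(E_{ij} x, E_{kl} y) ↦ δ_{il} δ_{jk} form(x, y)`. -/
def cocycle : MatAlg ν σ →ₗ[ℂ] MatAlg ν σ →ₗ[ℂ] ℂ :=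
  ∑ i, ∑ j, (form σ).compl₁₂ (Matrix.entryLinearMap ℂ (SkewLaurent σ) i j)
    (Matrix.entryLinearMap ℂ (SkewLaurent σ) j i)

variable {ν σ}

theorem cocycle_apply (X Y : MatAlg ν σ) : cocycle ν σ X Y = ∑ i, ∑ j, form σ (X i j) (Y j i) := by
  simp [cocycle, LinearMap.sum_apply]

theorem cocycle_skew (X Y : MatAlg ν σ) : cocycle ν σ X Y = -cocycle ν σ Y X := by
  rw [cocycle_apply, cocycle_apply, Finset.sum_comm, ← Finset.sum_neg_distrib]
  refine Finset.sum_congr rfl fun i _ => ?_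
  rw [← Finset.sum_neg_distrib]
  exact Finset.sum_congr rfl fun j _ => form_skew _ _

theorem cocycle_cyclic (X Y Z : MatAlg ν σ) :
    cocycle ν σ (X * Y) Z + cocycle ν σ (Y * Z) X + cocycle ν σ (Z * X) Y = 0 := by
  have e1 : cocycle ν σ (X * Y) Z = ∑ i, ∑ j, ∑ k, form σ (X i j * Y j k) (Z k i) := by
    simp only [cocycle_apply, Matrix.mul_apply, map_sum, LinearMap.sum_apply]
    exact Finset.sum_congr rfl fun i _ => Finset.sum_comm
  have e2 : cocycle ν σ (Y * Z) X = ∑ i, ∑ j, ∑ k, form σ (Y j k * Z k i) (X i j) := by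
    simp only [cocycle_apply, Matrix.mul_apply, map_sum, LinearMap.sum_apply]
    exact Finset.sum_comm
  have e3 : cocycle ν σ (Z * X) Y = ∑ i, ∑ j, ∑ k, form σ (Z k i * X i j) (Y j k) := by
    simp only [cocycle_apply, Matrix.mul_apply, map_sum, LinearMap.sum_apply]
    rw [Finset.sum_comm_cycle]
    exact Finset.sum_congr rfl fun i _ => Finset.sum_comm
  rw [e1, e2, e3]
  simp only [← Finset.sum_add_distrib, form_cyclic, Finset.sum_const_zero]

theorem cocycle_lie (X Y Z : MatAlg ν σ) :
    cocycle ν σ X ⁅Y, Z⁆ = cocycle ν σ ⁅X, Y⁆ Z + cocycle ν σ Y ⁅X, Z⁆ := by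
  simp only [Ring.lie_def, map_sub, LinearMap.sub_apply]
  have h1 := cocycle_cyclic X Y Z
  have h2 := cocycle_cyclic Y X Z
  have a1 := cocycle_skew X (Y * Z)
  have a2 := cocycle_skew X (Z * Y)
  have a3 := cocycle_skew Y (X * Z)
  have a4 := cocycle_skew Y (Z * X)
  linear_combination h2 - h1 + a1 - a2 - a3 + a4

variable (ν σ)

/-- The central extension `gl_ν(R_σ) ⊕ ℂ c`; the pair `(X, s)` stands for `X + s c`. -/
@[ext] structure GLHat where
  /-- The component in `gl_ν(R_σ)`. -/
  mat : MatAlg ν σ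
  /-- The coefficient of the central element `c`. -/
  cent : ℂ

namespace GLHat

/-- The underlying vector space. -/
def equivProd : GLHat ν σ ≃ MatAlg ν σ × ℂ where
  toFun x := (x.mat, x.cent)
  invFun x := ⟨x.1, x.2⟩
  left_inv _ := rfl
  right_inv _ := rfl

instance : AddCommGroup (GLHat ν σ) := (equivProd ν σ).addCommGroup

instance : Module ℂ (GLHat ν σ) := (equivProd ν σ).module ℂ

variable {ν σ}

@[simp] theorem mat_add (x y : GLHat ν σ) : (x + y).mat = x.mat + y.mat := rfl
@[simp] theorem cent_add (x y : GLHat ν σ) : (x + y).cent = x.cent + y.cent := rfl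
@[simp] theorem mat_zero : (0 : GLHat ν σ).mat = 0 := rfl
@[simp] theorem cent_zero : (0 : GLHat ν σ).cent = 0 := rfl
@[simp] theorem mat_smul (c : ℂ) (x : GLHat ν σ) : (c • x).mat = c • x.mat := rfl
@[simp] theorem cent_smul (c : ℂ) (x : GLHat ν σ) : (c • x).cent = c * x.cent := rfl

instance : Bracket (GLHat ν σ) (GLHat ν σ) :=
  ⟨fun x y => ⟨⁅x.mat, y.mat⁆, cocycle ν σ x.mat y.mat⟩⟩

@[simp] theorem mat_lie (x y : GLHat ν σ) : ⁅x, y⁆.mat = ⁅x.mat, y.mat⁆ := rfl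
@[simp] theorem cent_lie (x y : GLHat ν σ) : ⁅x, y⁆.cent = cocycle ν σ x.mat y.mat := rfl

instance : LieRing (GLHat ν σ) where
  add_lie x y z := by ext1 <;> simp
  lie_add x y z := by ext1 <;> simp
  lie_self x := by
    ext1
    · simp
    · have := cocycle_skew x.mat x.mat
      simp only [cent_lie, cent_zero]
      linear_combination this / 2
  leibniz_lie x y z := by
    ext1
    · simp
    · exact cocycle_lie x.mat y.mat z.mat

instance : LieAlgebra ℂ (GLHat ν σ) where
  lie_smul c x y := by ext1 <;> simp

open Classical in
/-- The bracket of the elements `E_{ij} t^m e^α` and `E_{kl} t^n e^β`. -/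
theorem lie_single (i j k l : Fin ν) (m n : ℤ) (α β : G) :
    ⁅(⟨Matrix.single i j (mono σ m α), 0⟩ : GLHat ν σ),
      (⟨Matrix.single k l (mono σ n β), 0⟩ : GLHat ν σ)⁆ =
      ⟨(if j = k then ((σ α ^ n : ℂˣ) : ℂ) • Matrix.single i l (mono σ (m + n) (α + β)) else 0) -
        (if i = l then ((σ β ^ m : ℂˣ) : ℂ) • Matrix.single k j (mono σ (m + n) (α + β)) else 0),
      if i = l ∧ j = k ∧ m + n = 0 ∧ σ α * σ β = 1 then (m : ℂ) * ((σ α ^ n : ℂˣ) : ℂ) else 0⟩ := by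
  ext1
  · rw [mat_lie, Ring.lie_def]
    congr 1
    · split_ifs with h
      · subst h
        rw [Matrix.single_mul_single_same, mono_mul_mono, Matrix.smul_single]
      · exact Matrix.single_mul_single_of_ne (h := h) ..
    · split_ifs with h
      · subst h
        rw [Matrix.single_mul_single_same, mono_mul_mono, Matrix.smul_single, add_comm n, add_comm β]
      · exact Matrix.single_mul_single_of_ne (h := Ne.symm h) ..
  · rw [cent_lie, cocycle_apply]
    simp only [Matrix.single_apply]
    rw [Finset.sum_eq_single i, Finset.sum_eq_single j]
    · by_cases h1 : i = l <;> by_cases h2 : j = k <;> simp [h1, h2, form_mono, eq_comm]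
    · intro b _ hb
      simp [hb.symm]
    · simp
    · intro b _ hb
      simp [hb.symm]
    · simp

variable (ν σ)

/-- The projection of the central extension onto `gl_ν(R_σ)`. -/
def proj : GLHat ν σ →ₗ⁅ℂ⁆ MatAlg ν σ where
  toFun := mat
  map_add' _ _ := rfl
  map_smul' _ _ := rfl
  map_lie' := rfl

end GLHat

/-- The central extension `û_ν(R_σ, ¯) = u_ν(R_σ, ¯) ⊕ ℂ c` of the unitary Lie algebra, with the
bracket of `gl_ν(R_σ) ⊕ ℂ c`. -/
def unitaryHat : LieSubalgebra ℂ (GLHat ν σ) := (unitary ν σ).comap (GLHat.proj ν σ)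

variable {ν σ}

/-- The matrix `e_{ij}(m, α) = E_{ij} t^m e^α - E_{ji} \overline{t^m e^α}`. -/
def eMat (σ : AddChar G ℂˣ) (i j : Fin ν) (m : ℤ) (α : G) : MatAlg ν σ :=
  Matrix.single i j (mono σ m α) - Matrix.single j i (bar σ (mono σ m α))

theorem eMat_mem (i j : Fin ν) (m : ℤ) (α : G) : eMat σ i j m α ∈ unitary ν σ := by
  have h (i j : Fin ν) (x : SkewLaurent σ) :
      conj (Matrix.single i j x) = Matrix.single j i (bar σ x) := by
    rw [conj, Matrix.map_single, Matrix.transpose_single]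
  change conj _ = -_
  rw [eMat, conj_sub, h, h, bar_bar, neg_sub]

/-- `e_{ij}(m, α)` as an element of `û_ν(R_σ, ¯)`. -/
def eHat (σ : AddChar G ℂˣ) (i j : Fin ν) (m : ℤ) (α : G) : unitaryHat ν σ :=
  ⟨⟨eMat σ i j m α, 0⟩, eMat_mem i j m α⟩

variable (ν σ)

/-- The central element `c` of `û_ν(R_σ, ¯)`. -/
def cHat : unitaryHat ν σ := ⟨⟨0, 1⟩, (unitary ν σ).zero_mem⟩

end SkewLaurent

/-! ### The Fock space and the vertex operators -/

section Fock

variable (ν : ℕ)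

/-- The sign `ε(ε_i, ε_j)`. -/
def sign₀ {ν : ℕ} (i j : Fin ν) : ℤˣ := if i ≤ j then 1 else -1

/-- The two-cocycle `ε` on the lattice `Γ = ⊕ ℤ ε_i`. -/
def latticeCocycle {ν : ℕ} (α β : Fin ν → ℤ) : ℤˣ := ∏ i, ∏ j, sign₀ i j ^ (α i * β j)

/-- The reduction map from `Γ` to `Γ / 2Γ`. -/
def reduce {ν : ℕ} (α : Fin ν → ℤ) : Fin ν → ZMod 2 := fun i => (α i : ZMod 2)

/-- The two-cocycle on `Γ / 2Γ` induced by `ε`. -/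
def signCocycle {ν : ℕ} (a b : Fin ν → ZMod 2) : ℤˣ := ∏ i, ∏ j, sign₀ i j ^ (a i * b j)

theorem signCocycle_reduce {ν : ℕ} (α β : Fin ν → ℤ) :
    signCocycle (reduce α) (reduce β) = latticeCocycle α β := by
  unfold signCocycle latticeCocycle reduce
  refine Finset.prod_congr rfl fun i _ => Finset.prod_congr rfl fun j _ => ?_
  rw [← Int.cast_mul, uzpow_intCast]

/-- The vector space `ℂ[Γ / 2Γ]`, with basis `e^a` for `a` in `Γ / 2Γ`. -/
def TwistedAlg (ν : ℕ) : Type := (Fin ν → ZMod 2) →₀ ℂ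

namespace TwistedAlg

instance : AddCommGroup (TwistedAlg ν) := inferInstanceAs (AddCommGroup ((Fin ν → ZMod 2) →₀ ℂ))

instance : Module ℂ (TwistedAlg ν) := inferInstanceAs (Module ℂ ((Fin ν → ZMod 2) →₀ ℂ))

variable {ν}

/-- The basis element `e^a`. -/
def exp (a : Fin ν → ZMod 2) : TwistedAlg ν := Finsupp.single a (1 : ℂ)

/-- The linear map determined by its values on the basis elements `e^a`. -/
def lift {N : Type*} [AddCommMonoid N] [Module ℂ N] (f : (Fin ν → ZMod 2) → N) :
    TwistedAlg ν →ₗ[ℂ] N :=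
  Finsupp.linearCombination ℂ f

@[simp] theorem lift_exp {N : Type*} [AddCommMonoid N] [Module ℂ N]
    (f : (Fin ν → ZMod 2) → N) (a : Fin ν → ZMod 2) : lift f (exp a) = f a := by
  unfold lift exp
  exact (Finsupp.linearCombination_single ℂ (1 : ℂ) a).trans (one_smul ℂ _)

/-- The twisted multiplication on `ℂ[Γ / 2Γ]`: `e^a * e^b = ε(a, b) e^{a+b}`. -/
def twistedMul : TwistedAlg ν →ₗ[ℂ] TwistedAlg ν →ₗ[ℂ] TwistedAlg ν :=
  lift fun a => lift fun b => ((signCocycle a b : ℤ) : ℂ) • exp (a + b)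

theorem twistedMul_exp (a b : Fin ν → ZMod 2) :
    twistedMul (exp a) (exp b) = ((signCocycle a b : ℤ) : ℂ) • exp (a + b) := by
  simp [twistedMul]

end TwistedAlg

/-- The operator of left multiplication by `e^{\bar α}` on `ℂ[Γ / 2Γ]`, for `α` in `Γ`. -/
def expOp {ν : ℕ} (α : Fin ν → ℤ) : Module.End ℂ (TwistedAlg ν) :=
  TwistedAlg.twistedMul (TwistedAlg.exp (reduce α))

/-- The symmetric algebra `S(H^-)`: the polynomial algebra in the variables `ε_i(-(2k+1))`,
indexed by the pairs `(i, k)` with `k` a natural number. -/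
abbrev SymPoly : Type := MvPolynomial (Fin ν × ℕ) ℂ

/-- The operator `ε_i(n)` on `S(H^-)` for odd `n`: multiplication by the variable `ε_i(n)` if
`n < 0`, and `n / 2` times the partial derivative with respect to `ε_i(-n)` if `n > 0`.
By convention it is `0` for even `n`. -/
def heis {ν : ℕ} (i : Fin ν) (n : ℤ) : Module.End ℂ (SymPoly ν) :=
  if Odd n then
    if n < 0 then LinearMap.mulLeft ℂ (MvPolynomial.X (i, n.natAbs / 2))
    else ((n : ℂ) / 2) • (MvPolynomial.pderiv (i, n.natAbs / 2)).toLinearMap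
  else 0

/-- The operator `α(n)` for `α` in `Γ`. -/
def heisLat {ν : ℕ} (α : Fin ν → ℤ) (n : ℤ) : Module.End ℂ (SymPoly ν) :=
  ∑ i, (α i : ℂ) • heis i n

/-- The exponential `∑ f^l / l!` of a formal power series `f` without constant term over a
`ℂ`-algebra (only `l ≤ n` contributes to the coefficient of degree `n`). -/
def formalExp {A : Type*} [Ring A] [Algebra ℂ A] (f : PowerSeries A) : PowerSeries A :=
  PowerSeries.mk fun n => ∑ l ∈ Finset.range (n + 1), ((l ! : ℂ)⁻¹) • PowerSeries.coeff n (f ^ l)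

/-- `E_-(α, bz) = exp(-2 ∑_{n ∈ -(2ℕ+1)} (α(n)/n) (bz)^{-n})`, a power series in `z`;
here `n = -k`. -/
def Eminus {ν : ℕ} (α : Fin ν → ℤ) (b : ℂˣ) : PowerSeries (Module.End ℂ (SymPoly ν)) :=
  formalExp (PowerSeries.mk fun k => (-2 / (-(k : ℂ)) * (b : ℂ) ^ k) • heisLat α (-(k : ℤ)))

/-- `E_+(α, bz) = exp(-2 ∑_{n ∈ 2ℕ+1} (α(n)/n) (bz)^{-n})`, a power series in `z^{-1}`. -/
def Eplus {ν : ℕ} (α : Fin ν → ℤ) (b : ℂˣ) : PowerSeries (Module.End ℂ (SymPoly ν)) :=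
  formalExp (PowerSeries.mk fun k => (-2 / (k : ℂ) * ((b⁻¹ : ℂˣ) : ℂ) ^ k) • heisLat α (k : ℤ))

variable {ν}

/-- The polynomials all of whose monomials have weight at most `d`, where `ε_i(-n)` has
weight `n`. -/
def weightLE (ν : ℕ) (d : ℤ) : Submodule ℂ (SymPoly ν) where
  carrier := {p | ∀ s, MvPolynomial.coeff s p ≠ 0 →
    ((Finsupp.weight (fun x : Fin ν × ℕ => 2 * x.2 + 1) s : ℕ) : ℤ) ≤ d}
  zero_mem' := by
    intro s hs
    simp at hs
  add_mem' {p q} hp hq := by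
    intro s hs
    by_cases h : MvPolynomial.coeff s p = 0
    · exact hq s (by simpa [h] using hs)
    · exact hp s h
  smul_mem' c p hp := by
    intro s hs
    exact hp s (by
      rw [MvPolynomial.coeff_smul] at hs
      exact right_ne_zero_of_smul hs)

theorem exists_mem_weightLE (p : SymPoly ν) : ∃ d : ℕ, p ∈ weightLE ν d := by
  refine ⟨p.support.sup fun s => Finsupp.weight (fun x : Fin ν × ℕ => 2 * x.2 + 1) s, ?_⟩
  intro s hs
  exact_mod_cast Finset.le_sup (f := fun s => Finsupp.weight (fun x : Fin ν × ℕ => 2 * x.2 + 1) s)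
    (MvPolynomial.mem_support_iff.2 hs)

theorem eq_zero_of_mem_weightLE {d : ℤ} (hd : d < 0) {p : SymPoly ν} (hp : p ∈ weightLE ν d) :
    p = 0 := by
  ext s
  by_contra h
  have := hp s (by simpa using h)
  omega

/-- The `k`-th coefficient lowers the weight by `k`. -/
def Lowers (Q : PowerSeries (Module.End ℂ (SymPoly ν))) : Prop :=
  ∀ (k : ℕ) (d : ℤ), ∀ p ∈ weightLE ν d, PowerSeries.coeff k Q p ∈ weightLE ν (d - k)

theorem Lowers.one : Lowers (1 : PowerSeries (Module.End ℂ (SymPoly ν))) := by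
  intro k d p hp
  rw [PowerSeries.coeff_one]
  split_ifs with h
  · simpa [h] using hp
  · simp

theorem Lowers.mul {P Q : PowerSeries (Module.End ℂ (SymPoly ν))} (hP : Lowers P) (hQ : Lowers Q) :
    Lowers (P * Q) := by
  intro k d p hp
  rw [PowerSeries.coeff_mul, LinearMap.sum_apply]
  refine Submodule.sum_mem _ fun x hx => ?_
  have h := hP x.1 _ _ (hQ x.2 d p hp)
  rw [Finset.HasAntidiagonal.mem_antidiagonal] at hx
  have e : d - (x.2 : ℤ) - (x.1 : ℤ) = d - (k : ℤ) := by omega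
  rwa [e] at h

theorem Lowers.pow {P : PowerSeries (Module.End ℂ (SymPoly ν))} (hP : Lowers P) (l : ℕ) :
    Lowers (P ^ l) := by
  induction l with
  | zero => simpa using Lowers.one
  | succ l ih => simpa [pow_succ] using ih.mul hP

theorem Lowers.formalExp {P : PowerSeries (Module.End ℂ (SymPoly ν))} (hP : Lowers P) :
    Lowers (formalExp P) := by
  intro k d p hp
  simp only [UnitaryVertex.formalExp, PowerSeries.coeff_mk, LinearMap.sum_apply,
    LinearMap.smul_apply]
  exact Submodule.sum_mem _ fun l _ => Submodule.smul_mem _ _ (hP.pow l k d p hp)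

theorem heis_mem_weightLE (i : Fin ν) (k : ℕ) (d : ℤ) (p : SymPoly ν) (hp : p ∈ weightLE ν d) :
    heis i (k : ℤ) p ∈ weightLE ν (d - k) := by
  unfold heis
  split_ifs with h h'
  · omega
  · refine Submodule.smul_mem _ _ fun s hs => ?_
    have hs' : MvPolynomial.coeff (s + Finsupp.single (i, k / 2) 1) p ≠ 0 := by
      intro h0
      apply hs
      simp [MvPolynomial.coeff_pderiv, h0]
    have := hp _ hs'
    rw [map_add, Finsupp.weight_single] at this
    have hk : 2 * (k / 2) + 1 = k := by
      obtain ⟨r, hr⟩ := h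
      omega
    simp only [one_smul] at this
    push_cast at this
    omega
  · simp

theorem Lowers.Eplus (α : Fin ν → ℤ) (b : ℂˣ) : Lowers (Eplus α b) := by
  refine Lowers.formalExp fun k d p hp => ?_
  rw [PowerSeries.coeff_mk, LinearMap.smul_apply, heisLat, LinearMap.sum_apply]
  exact Submodule.smul_mem _ _ (Submodule.sum_mem _ fun i _ =>
    Submodule.smul_mem _ _ (heis_mem_weightLE i k d p hp))

theorem Lowers.finite {Q : PowerSeries (Module.End ℂ (SymPoly ν))} (hQ : Lowers Q) (p : SymPoly ν) :
    {q : ℕ | PowerSeries.coeff q Q p ≠ 0}.Finite := by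
  obtain ⟨d, hd⟩ := exists_mem_weightLE p
  refine (Set.finite_le_nat d).subset fun q hq => ?_
  by_contra h
  refine hq (eq_zero_of_mem_weightLE ?_ (hQ q d p hd))
  have : d < q := not_le.1 h
  omega

/-- For a power series `P` in `z` and a power series `Q` in `z^{-1}` whose coefficients are
operators, and such that `Q` applied to any vector is a polynomial in `z^{-1}`, the coefficient of
`z^{-n}` in the product `P Q`. -/
def productMode (P Q : PowerSeries (Module.End ℂ (SymPoly ν))) (hQ : Lowers Q) (n : ℤ) :
    Module.End ℂ (SymPoly ν) where
  toFun v := ∑ᶠ q : ℕ,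
    if n ≤ q then PowerSeries.coeff ((q : ℤ) - n).toNat P (PowerSeries.coeff q Q v) else 0
  map_add' v w := by
    rw [← finsum_add_distrib]
    · refine finsum_congr fun q => ?_
      split_ifs <;> simp
    · refine (hQ.finite v).subset fun q hq h0 => hq ?_
      simp [h0]
    · refine (hQ.finite w).subset fun q hq h0 => hq ?_
      simp [h0]
  map_smul' c v := by
    rw [RingHom.id_apply, smul_finsum]
    refine finsum_congr fun q => ?_
    split_ifs <;> simp

/-- The basis vector `ε_i` of `Γ`. -/
def basisVec (i : Fin ν) : Fin ν → ℤ := Pi.single i 1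

/-- The coefficient of `z^{-n}` in
`E_-(ε_i, z) E_-(-ε_j, az) E_+(ε_i, z) E_+(-ε_j, az)`. -/
def symMode (i j : Fin ν) (a : ℂˣ) (n : ℤ) : Module.End ℂ (SymPoly ν) :=
  productMode (Eminus (basisVec i) 1 * Eminus (-basisVec j) a)
    (Eplus (basisVec i) 1 * Eplus (-basisVec j) a)
    ((Lowers.Eplus (basisVec i) 1).mul (Lowers.Eplus (-basisVec j) a)) n

/-- The Fock space `M = ℂ[Γ / 2Γ] ⊗ S(H^-)`. -/
abbrev Fock (ν : ℕ) : Type := TwistedAlg ν ⊗[ℂ] SymPoly ν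

open Classical in
/-- The operator `x_{ij}(a, n)` on the Fock space: the coefficient of `z^{-n}` in the vertex
operator `X_{ij}(a, z)`. -/
def vertexMode (i j : Fin ν) (a : ℂˣ) (n : ℤ) : Module.End ℂ (Fock ν) :=
  if i = j then
    if a = 1 then (4 : ℂ) • LinearMap.lTensor (TwistedAlg ν) (heis i n)
    else ((1 + (a : ℂ)) / (1 - (a : ℂ))) •
      (LinearMap.lTensor (TwistedAlg ν) (symMode i i a n) -
        if n = 0 then (1 : Module.End ℂ (Fock ν)) else 0)
  else ((latticeCocycle (basisVec i) (basisVec j) : ℤ) : ℂ) •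
    TensorProduct.map (expOp (basisVec i - basisVec j)) (symMode i j a n)

end Fock

end UnitaryVertex

end

set_option linter.unusedSectionVars false

noncomputable section

namespace UnitaryVertex

/-! ### Sums of finitely supported families -/

section LocSum

variable {ι κ V W : Type*} [AddCommGroup V] [Module ℂ V] [AddCommGroup W] [Module ℂ W]

/-! The representation is a fermionic quadratic construction in bosonic form. Put φ_i(z) =
E_-(ε_i,z)E_+(ε_i,z). Only odd Heisenberg modes occur, so E_±(-ε_j,az) = E_±(ε_j,-az). Hence, apart
from the group algebra factor, the exponential part of X_ij(a,z) is the bosonic normally ordered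
product :φ_i(z)φ_j(w): restricted to the line w = -az (`locSum_symMode`).

Moving E_+(ε_i,z) to the right of E_-(ε_j,w) produces the factor (1 - w/z)/(1 + w/z) if i = j and 1
otherwise (`annih_mul_creat`). For i = j the expansions of this factor in the two directions add up
to the delta series 2∑(-w/z)^k, supported at w = -z, where :φ_i(z)φ_i(w): equals 1. Thus the modes
satisfy {φ_i(p),φ_i(q)} = 2(-1)^q δ_{p+q,0} (`fermi_anticomm`), and modes with different indices
commute. Tensoring with the anticommuting operators e^{ε_i} gives fermions ψ_i
(`fockFermi_anticomm`).

All cases in the definition of X_ij then become one formula: x_ij(a,n) is the sum over q of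
(-a)^{-q} times ψ_i(n-q)ψ_j(q) with its vacuum expectation removed (`locSum_vertexMode`). On the
diagonal the subtracted product is (1-x)/(1+x) times (:φ_i(z)φ_i(w): - 1), with x = w/z. At x = -a
the prefactor is (1+a)/(1-a). For a = 1 the pole meets a zero, and the derivative that survives is
the Heisenberg field.

The commutator of two such quadratic expressions is quadratic again, plus a scalar from restoring
normal order (`quad_comm`). Adding the constants (1+a)/(1-a) to the zero modes turns that scalar
into the cocycle of the central extension at level 1/2 (`fullMode_comm`). The antisymmetry of
quadratic expressions (`vertexMode_symm`) matches the relation between e_ij and e_ji under the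
anti-involution. So one linear map on the full matrix algebra, odd under X ↦ X^*, restricts to the
representation (`fockRep`). Uniqueness holds because the e_ij(m,α) and c span
(`unitaryHat_hom_ext`).

Infinite sums of operators are handled vector by vector, where they are finite; `LocSum` records
this. Identities between exponentials are proved by uniqueness for the equation z y' = g y
(`eq_of_euler`). -/

/-- The family `f` has finite support and sum `a`. -/
def LocSum (f : ι → V) (a : V) : Prop := (Function.support f).Finite ∧ ∑ᶠ x, f x = a

namespace LocSum

variable {f g : ι → V} {a b : V}

theorem unique (h : LocSum f a) (h' : LocSum f b) : a = b := h.2.symm.trans h'.2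

theorem of_finite (h : (Function.support f).Finite) : LocSum f (∑ᶠ x, f x) := ⟨h, rfl⟩

theorem congr (h : LocSum f a) (hfg : ∀ x, f x = g x) (hab : a = b) : LocSum g b := by
  obtain rfl : f = g := funext hfg
  exact hab ▸ h

theorem zero : LocSum (fun _ : ι => (0 : V)) 0 := by
  refine ⟨?_, finsum_zero⟩
  simp

theorem single (x : ι) (h : ∀ y, y ≠ x → f y = 0) : LocSum f (f x) := by
  refine ⟨(Set.finite_singleton x).subset fun y hy => ?_, finsum_eq_single f x h⟩
  by_contra hne
  exact hy (h y hne)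

theorem map (F : V →ₗ[ℂ] W) (h : LocSum f a) : LocSum (fun x => F (f x)) (F a) := by
  refine ⟨h.1.subset fun x hx h0 => hx (by simp [h0]), ?_⟩
  rw [← h.2, map_finsum F h.1]

theorem add (h : LocSum f a) (h' : LocSum g b) : LocSum (fun x => f x + g x) (a + b) := by
  refine ⟨(h.1.union h'.1).subset (Function.support_add f g), ?_⟩
  rw [finsum_add_distrib h.1 h'.1, h.2, h'.2]

theorem smul (c : ℂ) (h : LocSum f a) : LocSum (fun x => c • f x) (c • a) :=
  h.map (LinearMap.lsmul ℂ V c)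

theorem sub (h : LocSum f a) (h' : LocSum g b) : LocSum (fun x => f x - g x) (a - b) := by
  refine (h.add (h'.smul (-1))).congr (fun x => ?_) ?_ <;> simp [sub_eq_add_neg]

theorem reindex (e : κ ≃ ι) (h : LocSum f a) : LocSum (fun x => f (e x)) a := by
  refine ⟨?_, (finsum_comp_equiv e).trans h.2⟩
  exact (h.1.preimage e.injective.injOn)

/-- Fubini. Joint finiteness of the double family is the essential input: reorderings below come
from reindexing one jointly finite family and summing its fibres in two ways. -/
theorem fiberwise {F : ι × κ → V} (h : LocSum F a) (hF : ∀ x, LocSum (fun y => F (x, y)) (f x)) :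
    LocSum f a := by
  refine ⟨(h.1.image Prod.fst).subset fun x hx => ?_, ?_⟩
  · by_contra hn
    apply hx
    rw [← (hF x).2]
    refine finsum_eq_zero_of_forall_eq_zero fun y => ?_
    by_contra hy
    exact hn ⟨(x, y), hy, rfl⟩
  · rw [← h.2, finsum_curry F h.1]
    exact finsum_congr fun x => (hF x).2.symm

theorem of_finset (s : Finset ι) (h : ∀ x ∉ s, f x = 0) : LocSum f (∑ x ∈ s, f x) := by
  have hs : Function.support f ⊆ ↑s := fun x hx => by
    by_contra hn
    exact hx (h x hn)
  exact ⟨s.finite_toSet.subset hs, finsum_eq_sum_of_support_subset f hs⟩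

theorem eq_zero (h : LocSum f a) (hf : ∀ x, f x = 0) : a = 0 :=
  h.unique (zero.congr (fun x => (hf x).symm) rfl)

end LocSum

end LocSum

/-! ### Exponentials of formal power series -/

section FormalExp

variable {A : Type*} [Ring A] [Algebra ℂ A]

/-- The Euler operator `z d/dz`. -/
def euler (f : PowerSeries A) : PowerSeries A := PowerSeries.mk fun n => (n : ℂ) • PowerSeries.coeff n f

@[simp] theorem coeff_euler (n : ℕ) (f : PowerSeries A) :
    PowerSeries.coeff n (euler f) = (n : ℂ) • PowerSeries.coeff n f := PowerSeries.coeff_mk _ _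

theorem euler_mul (f g : PowerSeries A) : euler (f * g) = euler f * g + f * euler g := by
  ext n
  simp only [coeff_euler, map_add, PowerSeries.coeff_mul, Finset.smul_sum, smul_mul_assoc,
    mul_smul_comm, ← Finset.sum_add_distrib, ← add_smul]
  refine Finset.sum_congr rfl fun x hx => ?_
  rw [← Finset.HasAntidiagonal.mem_antidiagonal.1 hx]
  push_cast
  rfl

/-- The substitution `z ↦ c z`. -/
def resc (c : ℂ) (f : PowerSeries A) : PowerSeries A :=
  PowerSeries.mk fun n => c ^ n • PowerSeries.coeff n f

@[simp] theorem coeff_resc (c : ℂ) (n : ℕ) (f : PowerSeries A) :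
    PowerSeries.coeff n (resc c f) = c ^ n • PowerSeries.coeff n f := PowerSeries.coeff_mk _ _

theorem resc_mul (c : ℂ) (f g : PowerSeries A) : resc c (f * g) = resc c f * resc c g := by
  ext n
  simp only [coeff_resc, PowerSeries.coeff_mul, Finset.smul_sum, smul_mul_smul_comm, ← pow_add]
  refine Finset.sum_congr rfl fun x hx => ?_
  rw [← Finset.HasAntidiagonal.mem_antidiagonal.1 hx]

theorem resc_one (c : ℂ) : resc c (1 : PowerSeries A) = 1 := by
  ext n
  rw [coeff_resc, PowerSeries.coeff_one]
  split_ifs with h <;> simp [h]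

theorem commute_of_coeff {f g : PowerSeries A}
    (h : ∀ m n, Commute (PowerSeries.coeff m f) (PowerSeries.coeff n g)) : Commute f g := by
  ext n
  rw [PowerSeries.coeff_mul, PowerSeries.coeff_mul, ← Finset.Nat.sum_antidiagonal_swap]
  exact Finset.sum_congr rfl fun x _ => h _ _

theorem coeff_pow_eq_zero {f : PowerSeries A} (h0 : PowerSeries.coeff 0 f = 0) {n l : ℕ}
    (h : n < l) : PowerSeries.coeff n (f ^ l) = 0 := by
  induction l generalizing n with
  | zero => omega
  | succ l ih =>
    rw [pow_succ, PowerSeries.coeff_mul]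
    refine Finset.sum_eq_zero fun x hx => ?_
    have hx := Finset.HasAntidiagonal.mem_antidiagonal.1 hx
    by_cases h1 : x.1 < l
    · rw [ih h1, zero_mul]
    · rw [show x.2 = 0 by omega, h0, mul_zero]

/-- As f^l begins in degree l, any cut-off beyond n gives the same value. This freedom lets sums of
different lengths be compared after differentiation. -/
theorem coeff_formalExp {f : PowerSeries A} (h0 : PowerSeries.coeff 0 f = 0) {n N : ℕ}
    (h : n < N) : PowerSeries.coeff n (formalExp f) =
      ∑ l ∈ Finset.range N, ((l ! : ℂ)⁻¹) • PowerSeries.coeff n (f ^ l) := by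
  rw [formalExp, PowerSeries.coeff_mk]
  refine Finset.sum_subset (Finset.range_mono h) fun l _ hl => ?_
  rw [coeff_pow_eq_zero h0, smul_zero]
  simpa using hl

theorem coeff_zero_formalExp (f : PowerSeries A) : PowerSeries.coeff 0 (formalExp f) = 1 := by
  simp [formalExp]

theorem euler_pow {f : PowerSeries A} (h : Commute f (euler f)) (l : ℕ) :
    euler (f ^ (l + 1)) = ((l : ℂ) + 1) • (euler f * f ^ l) := by
  induction l with
  | zero => simp
  | succ l ih =>
    rw [pow_succ' f (l + 1), euler_mul, ih, mul_smul_comm, ← mul_assoc, h.eq, mul_assoc,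
      ← pow_succ' f l]
    push_cast
    module

/-- The chain rule for exp; in a noncommutative ring it needs f to commute with its own derivative.
-/
theorem euler_formalExp {f : PowerSeries A} (h0 : PowerSeries.coeff 0 f = 0)
    (h : Commute f (euler f)) : euler (formalExp f) = euler f * formalExp f := by
  ext n
  rw [coeff_euler, coeff_formalExp h0 (N := n + 1 + 1) (by omega), Finset.sum_range_succ',
    smul_add, Finset.smul_sum, PowerSeries.coeff_mul]
  have h1 : ∀ x ∈ Finset.HasAntidiagonal.antidiagonal n, PowerSeries.coeff x.1 (euler f) *
      PowerSeries.coeff x.2 (formalExp f) = ∑ l ∈ Finset.range (n + 1), ((l ! : ℂ)⁻¹) •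
        (PowerSeries.coeff x.1 (euler f) * PowerSeries.coeff x.2 (f ^ l)) := by
    intro x hx
    rw [coeff_formalExp h0 (N := n + 1), Finset.mul_sum]
    · simp only [mul_smul_comm]
    · have := Finset.HasAntidiagonal.mem_antidiagonal.1 hx
      omega
  rw [Finset.sum_congr rfl h1, Finset.sum_comm]
  -- The term l = 0 is the constant 1, which the Euler operator kills; the remaining terms are
  -- shifted by one.
  have h2 : (n : ℂ) • (((0 ! : ℕ) : ℂ)⁻¹) • PowerSeries.coeff n (f ^ 0) = 0 := by
    rw [pow_zero, PowerSeries.coeff_one]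
    split_ifs with hn <;> simp [hn]
  rw [h2, add_zero]
  refine Finset.sum_congr rfl fun l _ => ?_
  rw [← Finset.smul_sum, ← PowerSeries.coeff_mul, smul_comm, ← coeff_euler, euler_pow h,
    PowerSeries.coeff_smul, smul_smul, Nat.factorial_succ]
  congr 1
  have : (l ! : ℂ) ≠ 0 := by exact_mod_cast l.factorial_ne_zero
  have : (l : ℂ) + 1 ≠ 0 := by exact_mod_cast l.succ_ne_zero
  push_cast
  field_simp

/-- In degree n > 0 the right side involves only lower coefficients of y, because g has no constant
term, and n is invertible. So the constant term determines y. -/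
theorem eq_zero_of_euler {g y : PowerSeries A} (hg : PowerSeries.coeff 0 g = 0)
    (h : euler y = g * y) (h0 : PowerSeries.coeff 0 y = 0) : y = 0 := by
  ext n
  induction n using Nat.strong_induction_on with
  | _ n ih =>
  rcases Nat.eq_zero_or_pos n with rfl | hn
  · simpa using h0
  have h1 := congrArg (PowerSeries.coeff n) h
  rw [coeff_euler, PowerSeries.coeff_mul, Finset.sum_eq_zero] at h1
  · have : (n : ℂ) ≠ 0 := by exact_mod_cast hn.ne'
    simpa [this] using h1
  · intro x hx
    have hx := Finset.HasAntidiagonal.mem_antidiagonal.1 hx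
    by_cases h2 : x.1 = 0
    · rw [h2, hg, zero_mul]
    · rw [ih x.2 (by omega)]
      simp

theorem euler_sub (f g : PowerSeries A) : euler (f - g) = euler f - euler g := by
  ext n
  simp [smul_sub]

theorem eq_of_euler {g y z : PowerSeries A} (hg : PowerSeries.coeff 0 g = 0)
    (hy : euler y = g * y) (hz : euler z = g * z)
    (h0 : PowerSeries.coeff 0 y = PowerSeries.coeff 0 z) : y = z := by
  refine sub_eq_zero.1 (eq_zero_of_euler hg ?_ ?_)
  · rw [euler_sub, hy, hz, mul_sub]
  · rw [map_sub, h0, sub_self]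

theorem coeff_zero_euler (f : PowerSeries A) : PowerSeries.coeff 0 (euler f) = 0 := by simp

theorem commute_coeff_mul {a : A} {f g : PowerSeries A}
    (hf : ∀ n, Commute a (PowerSeries.coeff n f)) (hg : ∀ n, Commute a (PowerSeries.coeff n g))
    (n : ℕ) : Commute a (PowerSeries.coeff n (f * g)) := by
  rw [PowerSeries.coeff_mul]
  exact Commute.sum_right _ _ _ fun x _ => (hf _).mul_right (hg _)

theorem commute_coeff_formalExp {a : A} {f : PowerSeries A}
    (h : ∀ n, Commute a (PowerSeries.coeff n f)) (n : ℕ) :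
    Commute a (PowerSeries.coeff n (formalExp f)) := by
  have h1 (l : ℕ) : ∀ n, Commute a (PowerSeries.coeff n (f ^ l)) := by
    induction l with
    | zero =>
      intro n
      rw [pow_zero, PowerSeries.coeff_one]
      split_ifs
      · exact Commute.one_right a
      · exact Commute.zero_right a
    | succ l ih =>
      rw [pow_succ]
      exact commute_coeff_mul ih h
  rw [formalExp, PowerSeries.coeff_mk]
  exact Commute.sum_right _ _ _ fun l _ => (h1 l n).smul_right _

theorem resc_formalExp (c : ℂ) (f : PowerSeries A) :
    resc c (formalExp f) = formalExp (resc c f) := by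
  have h (l : ℕ) : resc c (f ^ l) = resc c f ^ l := by
    induction l with
    | zero => simp [resc_one]
    | succ l ih => rw [pow_succ, resc_mul, ih, pow_succ]
  ext n
  simp only [coeff_resc, formalExp, PowerSeries.coeff_mk, Finset.smul_sum, ← h]
  exact Finset.sum_congr rfl fun l _ => smul_comm _ _ _

/-- The product has zero Euler derivative, hence equals its constant term. -/
theorem formalExp_mul_formalExp_neg {f : PowerSeries A} (h0 : PowerSeries.coeff 0 f = 0)
    (h : ∀ m n, Commute (PowerSeries.coeff m f) (PowerSeries.coeff n f)) :
    formalExp f * formalExp (-f) = 1 := by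
  have hn : ∀ m n, Commute (PowerSeries.coeff m (-f)) (PowerSeries.coeff n (-f)) := fun m n => by
    simpa using h m n
  have hc : Commute (formalExp f) (euler (-f)) := by
    refine commute_of_coeff fun m n => ?_
    refine (commute_coeff_formalExp (fun k => ?_) m).symm
    simpa using ((h n k).smul_left (n : ℂ)).neg_left
  have he : ∀ g : PowerSeries A, (∀ m n, Commute (PowerSeries.coeff m g) (PowerSeries.coeff n g)) →
      Commute g (euler g) := fun g hg => commute_of_coeff fun m n => by
    simpa using (hg m n).smul_right (n : ℂ)
  have h1 : euler (-f) = - euler f := by ext n; simp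
  refine eq_of_euler (g := 0) (by simp) ?_ ?_ ?_
  · rw [euler_mul, euler_formalExp h0 (he f h), euler_formalExp (by rw [map_neg, h0, neg_zero]) (he _ hn),
      ← mul_assoc (formalExp f), hc.eq, h1]
    noncomm_ring
  · ext n
    rw [coeff_euler, PowerSeries.coeff_one]
    split_ifs with hk <;> simp [hk]
  · simp [PowerSeries.coeff_mul, coeff_zero_formalExp]

end FormalExp

/-! ### The Heisenberg operators -/

section Heisenberg

variable {ν : ℕ}

theorem heis_neg (i : Fin ν) (n : ℕ) : heis i (-(n : ℤ)) =
    if Odd n then LinearMap.mulLeft ℂ (MvPolynomial.X (i, n / 2)) else 0 := by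
  unfold heis
  by_cases h : Odd n
  · have : 0 < n := h.pos
    rw [if_pos (by simpa using h), if_pos (by omega), if_pos h]
    simp
  · rw [if_neg (by simpa using h), if_neg h]

theorem heis_natCast (i : Fin ν) (n : ℕ) : heis i (n : ℤ) =
    if Odd n then ((n : ℂ) / 2) • (MvPolynomial.pderiv (i, n / 2)).toLinearMap else 0 := by
  unfold heis
  by_cases h : Odd n
  · rw [if_pos (by simpa using h), if_neg (by omega), if_pos h]
    simp
  · rw [if_neg (by simpa using h), if_neg h]

theorem heis_even (i : Fin ν) {n : ℤ} (h : ¬ Odd n) : heis i n = 0 := by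
  rw [heis, if_neg h]

theorem pderiv_comm {τ : Type*} (a b : τ) (p : MvPolynomial τ ℂ) :
    MvPolynomial.pderiv a (MvPolynomial.pderiv b p) =
      MvPolynomial.pderiv b (MvPolynomial.pderiv a p) := by
  classical
  have h : ⁅MvPolynomial.pderiv (R := ℂ) a, MvPolynomial.pderiv (R := ℂ) b⁆ = 0 := by
    refine MvPolynomial.derivation_ext fun c => ?_
    simp [Derivation.commutator_apply, MvPolynomial.pderiv_X, Pi.single_apply, apply_ite]
  have := congrArg (fun D => D p) h
  simpa [Derivation.commutator_apply, sub_eq_zero] using this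

theorem commute_heis_neg (i j : Fin ν) (m n : ℕ) :
    Commute (heis i (-(m : ℤ))) (heis j (-(n : ℤ))) := by
  rw [heis_neg, heis_neg]
  split_ifs
  · exact LinearMap.ext fun p => by simp [mul_left_comm]
  all_goals simp

theorem commute_heis_natCast (i j : Fin ν) (m n : ℕ) :
    Commute (heis i (m : ℤ)) (heis j (n : ℤ)) := by
  rw [heis_natCast, heis_natCast]
  split_ifs
  · refine Commute.smul_left (Commute.smul_right ?_ _) _
    exact LinearMap.ext fun p => pderiv_comm _ _ p
  all_goals simp

theorem heis_mul_heis_neg (i j : Fin ν) (m n : ℕ) :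
    heis i (m : ℤ) * heis j (-(n : ℤ)) = heis j (-(n : ℤ)) * heis i (m : ℤ) +
      (if i = j ∧ m = n ∧ Odd m then (m : ℂ) / 2 else 0) • (1 : Module.End ℂ (SymPoly ν)) := by
  rw [heis_natCast, heis_neg]
  by_cases hm : Odd m
  · by_cases hn : Odd n
    · have h1 : (i = j ∧ m = n ∧ Odd m) ↔ (j, n / 2) = (i, m / 2) := by
        rw [Prod.mk.injEq]
        obtain ⟨k, rfl⟩ := hm
        obtain ⟨l, rfl⟩ := hn
        constructor
        · rintro ⟨rfl, h, _⟩
          exact ⟨rfl, by omega⟩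
        · rintro ⟨rfl, h⟩
          exact ⟨rfl, by omega, by simp⟩
      simp only [h1, if_pos hm, if_pos hn]
      refine LinearMap.ext fun p => ?_
      simp only [Module.End.mul_apply, LinearMap.smul_apply, LinearMap.mulLeft_apply,
        Derivation.coeFn_coe, Derivation.leibniz, LinearMap.add_apply, Module.End.one_apply,
        MvPolynomial.pderiv_X, Pi.single_apply, smul_eq_mul, mul_smul_comm]
      split_ifs
      · simp
      · simp
    · simp only [if_neg hn]
      rw [if_neg (c := i = j ∧ m = n ∧ Odd m)]
      · rw [mul_zero, zero_mul, zero_smul, add_zero]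
      · rintro ⟨_, h, _⟩
        exact hn (h ▸ hm)
  · simp [hm]

theorem heisLat_basisVec (i : Fin ν) (n : ℤ) : heisLat (basisVec i) n = heis i n := by
  rw [heisLat, Finset.sum_eq_single i]
  · simp [basisVec]
  · intro j _ hj
    simp [basisVec, hj]
  · simp

theorem heisLat_neg (α : Fin ν → ℤ) (n : ℤ) : heisLat (-α) n = -heisLat α n := by
  rw [heisLat, heisLat, ← Finset.sum_neg_distrib]
  refine Finset.sum_congr rfl fun i _ => ?_
  rw [Pi.neg_apply, Int.cast_neg]
  exact neg_smul (α i : ℂ) (heis i n)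

/-- The exponent of `E_-(ε_i, z)`. -/
def expoMinus (i : Fin ν) : PowerSeries (Module.End ℂ (SymPoly ν)) :=
  PowerSeries.mk fun k => (2 / (k : ℂ)) • heis i (-(k : ℤ))

/-- The exponent of `E_+(ε_i, z)`. -/
def expoPlus (i : Fin ν) : PowerSeries (Module.End ℂ (SymPoly ν)) :=
  PowerSeries.mk fun k => (-2 / (k : ℂ)) • heis i (k : ℤ)

/-- The series `E_-(ε_i, z)` in `z`. -/
def creat (i : Fin ν) : PowerSeries (Module.End ℂ (SymPoly ν)) := formalExp (expoMinus i)

/-- The series `E_+(ε_i, z)` in `z⁻¹`. -/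
def annih (i : Fin ν) : PowerSeries (Module.End ℂ (SymPoly ν)) := formalExp (expoPlus i)

theorem coeff_expoMinus (i : Fin ν) (k : ℕ) :
    PowerSeries.coeff k (expoMinus i) = (2 / (k : ℂ)) • heis i (-(k : ℤ)) :=
  PowerSeries.coeff_mk _ _

theorem coeff_expoPlus (i : Fin ν) (k : ℕ) :
    PowerSeries.coeff k (expoPlus i) = (-2 / (k : ℂ)) • heis i (k : ℤ) :=
  PowerSeries.coeff_mk _ _

/-- Even modes vanish, so the substitution z ↦ -z has the same effect as α ↦ -α. This is what turns
E_±(-ε_j,az) into a rescaling of E_±(ε_j,z). -/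
theorem neg_pow_smul_heis (i : Fin ν) (c : ℂ) (k : ℕ) {n : ℤ} (hn : n.natAbs = k) :
    (-c) ^ k • heis i n = -(c ^ k • heis i n) := by
  by_cases h : Odd n
  · have hk : Odd k := hn ▸ Int.natAbs_odd.2 h
    rw [hk.neg_pow]
    exact neg_smul (c ^ k) (heis i n)
  · simp [heis_even i h]

theorem Eminus_basisVec (i : Fin ν) : Eminus (basisVec i) 1 = creat i := by
  unfold Eminus creat
  congr 1
  ext1 k
  rw [coeff_expoMinus, PowerSeries.coeff_mk, heisLat_basisVec, Units.val_one, one_pow, mul_one,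
    neg_div_neg_eq]

theorem Eplus_basisVec (i : Fin ν) : Eplus (basisVec i) 1 = annih i := by
  unfold Eplus annih
  congr 1
  ext1 k
  rw [coeff_expoPlus, PowerSeries.coeff_mk, heisLat_basisVec, inv_one, Units.val_one, one_pow,
    mul_one]

theorem Eminus_neg_basisVec (i : Fin ν) (a : ℂˣ) :
    Eminus (-basisVec i) a = resc (-(a : ℂ)) (creat i) := by
  rw [creat, resc_formalExp]
  unfold Eminus
  congr 1
  ext1 k
  rw [coeff_resc, coeff_expoMinus, PowerSeries.coeff_mk, heisLat_neg, heisLat_basisVec, smul_comm,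
    neg_pow_smul_heis i _ k (by simp), neg_div_neg_eq, mul_smul, smul_neg, smul_neg]

theorem Eplus_neg_basisVec (i : Fin ν) (a : ℂˣ) :
    Eplus (-basisVec i) a = resc (-(a : ℂ)⁻¹) (annih i) := by
  rw [annih, resc_formalExp]
  unfold Eplus
  congr 1
  ext1 k
  rw [coeff_resc, coeff_expoPlus, PowerSeries.coeff_mk, heisLat_neg, heisLat_basisVec, smul_comm,
    neg_pow_smul_heis i _ k (by simp), mul_smul, smul_neg, smul_neg, smul_neg,
    Units.val_inv_eq_inv_val]

theorem coeff_zero_expoMinus (i : Fin ν) : PowerSeries.coeff 0 (expoMinus i) = 0 := by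
  simp [coeff_expoMinus, -PowerSeries.coeff_zero_eq_constantCoeff]

theorem coeff_zero_expoPlus (i : Fin ν) : PowerSeries.coeff 0 (expoPlus i) = 0 := by
  simp [coeff_expoPlus, -PowerSeries.coeff_zero_eq_constantCoeff]

theorem commute_expoMinus (i j : Fin ν) (m n : ℕ) :
    Commute (PowerSeries.coeff m (expoMinus i)) (PowerSeries.coeff n (expoMinus j)) := by
  rw [coeff_expoMinus, coeff_expoMinus]
  exact ((commute_heis_neg i j m n).smul_left _).smul_right _

theorem commute_expoPlus (i j : Fin ν) (m n : ℕ) :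
    Commute (PowerSeries.coeff m (expoPlus i)) (PowerSeries.coeff n (expoPlus j)) := by
  rw [coeff_expoPlus, coeff_expoPlus]
  exact ((commute_heis_natCast i j m n).smul_left _).smul_right _

theorem commute_creat (i j : Fin ν) (m n : ℕ) :
    Commute (PowerSeries.coeff m (creat i)) (PowerSeries.coeff n (creat j)) :=
  commute_coeff_formalExp (fun l =>
    (commute_coeff_formalExp (fun k => commute_expoMinus j i l k) m).symm) n

theorem commute_annih (i j : Fin ν) (m n : ℕ) :
    Commute (PowerSeries.coeff m (annih i)) (PowerSeries.coeff n (annih j)) :=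
  commute_coeff_formalExp (fun l =>
    (commute_coeff_formalExp (fun k => commute_expoPlus j i l k) m).symm) n

theorem euler_creat (i : Fin ν) : euler (creat i) = euler (expoMinus i) * creat i :=
  euler_formalExp (coeff_zero_expoMinus i) <| commute_of_coeff fun m n => by
    rw [coeff_euler]
    exact (commute_expoMinus i i m n).smul_right _

theorem euler_annih (i : Fin ν) : euler (annih i) = euler (expoPlus i) * annih i :=
  euler_formalExp (coeff_zero_expoPlus i) <| commute_of_coeff fun m n => by
    rw [coeff_euler]
    exact (commute_expoPlus i i m n).smul_right _

theorem resc_neg_one_eq_neg {A : Type*} [Ring A] [Algebra ℂ A] {f : PowerSeries A}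
    (h : ∀ n, Even n → PowerSeries.coeff n f = 0) : resc (-1) f = -f := by
  ext n
  rw [coeff_resc, map_neg]
  rcases Nat.even_or_odd n with hn | hn
  · simp [h n hn]
  · simp [hn.neg_one_pow]

theorem coeff_expoMinus_even (i : Fin ν) (n : ℕ) (hn : Even n) :
    PowerSeries.coeff n (expoMinus i) = 0 := by
  rw [coeff_expoMinus, heis_even, smul_zero]
  simpa using hn

theorem coeff_expoPlus_even (i : Fin ν) (n : ℕ) (hn : Even n) :
    PowerSeries.coeff n (expoPlus i) = 0 := by
  rw [coeff_expoPlus, heis_even, smul_zero]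
  simpa using hn

/-- The exponent is odd in z, so E_-(ε_i,-z) inverts E_-(ε_i,z). Together with `annih_mul_resc` it
gives :φ_i(z)φ_i(-z): = 1. -/
theorem creat_mul_resc (i : Fin ν) : creat i * resc (-1) (creat i) = 1 := by
  rw [creat, resc_formalExp, resc_neg_one_eq_neg (coeff_expoMinus_even i)]
  exact formalExp_mul_formalExp_neg (coeff_zero_expoMinus i) (commute_expoMinus i i)

theorem annih_mul_resc (i : Fin ν) : annih i * resc (-1) (annih i) = 1 := by
  rw [annih, resc_formalExp, resc_neg_one_eq_neg (coeff_expoPlus_even i)]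
  exact formalExp_mul_formalExp_neg (coeff_zero_expoPlus i) (commute_expoPlus i i)

end Heisenberg

/-! ### The exchange relation between the two halves of the vertex operators -/

section Exchange

/-- If [h,f] = g commutes with f, then [h,exp f] = g exp f. The defect of this identity solves y' =
f'y with zero constant term. -/
theorem C_mul_formalExp {A : Type*} [Ring A] [Algebra ℂ A] {h : A} {f g : PowerSeries A}
    (h0 : PowerSeries.coeff 0 f = 0)
    (hf : ∀ m n, Commute (PowerSeries.coeff m f) (PowerSeries.coeff n f))
    (hg : ∀ m n, Commute (PowerSeries.coeff m g) (PowerSeries.coeff n f))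
    (hfg : PowerSeries.C h * f = f * PowerSeries.C h + g) :
    PowerSeries.C h * formalExp f = formalExp f * PowerSeries.C h + g * formalExp f := by
  have hC : euler (PowerSeries.C h) = 0 := by
    ext n
    rw [coeff_euler, PowerSeries.coeff_C]
    split_ifs with hn <;> simp [hn]
  have hcg : g * euler f = euler f * g := commute_of_coeff fun m n => by
    rw [coeff_euler]
    exact (hg m n).smul_right _
  have hE : euler (formalExp f) = euler f * formalExp f :=
    euler_formalExp h0 <| commute_of_coeff fun m n => by
      rw [coeff_euler]
      exact (hf m n).smul_right _
  have h1 : PowerSeries.C h * euler f = euler f * PowerSeries.C h + euler g := by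
    have e : euler (f * PowerSeries.C h + g) = euler (f * PowerSeries.C h) + euler g := by
      ext n
      simp
    have := congrArg euler hfg
    rwa [e, euler_mul, euler_mul, hC, zero_mul, mul_zero, zero_add, add_zero] at this
  have hg0 : PowerSeries.coeff 0 g = 0 := by
    have := congrArg (PowerSeries.coeff 0) hfg
    rw [map_add] at this
    simpa [PowerSeries.coeff_mul, -PowerSeries.coeff_zero_eq_constantCoeff, h0] using this.symm
  have key : PowerSeries.C h * formalExp f - formalExp f * PowerSeries.C h - g * formalExp f =
      0 := by
    refine eq_zero_of_euler (coeff_zero_euler f) ?_ ?_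
    · rw [euler_sub, euler_sub, euler_mul, euler_mul, euler_mul, hC, hE, ← mul_assoc, ← mul_assoc g,
        h1, hcg]
      noncomm_ring
    · simp only [map_sub, PowerSeries.coeff_mul]
      simp [-PowerSeries.coeff_zero_eq_constantCoeff, coeff_zero_formalExp, hg0,
        PowerSeries.coeff_C]
  rw [sub_sub, sub_eq_zero] at key
  exact key

variable {ν : ℕ}

theorem C_heis_mul_creat (i j : Fin ν) (m : ℕ) :
    PowerSeries.C (heis i (m : ℤ)) * creat j = creat j * PowerSeries.C (heis i (m : ℤ)) +
      (if i = j ∧ Odd m then PowerSeries.X ^ m else 0) * creat j := by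
  refine C_mul_formalExp (coeff_zero_expoMinus j) (commute_expoMinus j j) (fun k n => ?_) ?_
  · split_ifs
    · rw [PowerSeries.coeff_X_pow]
      split_ifs
      · exact Commute.one_left _
      · exact Commute.zero_left _
    · exact Commute.zero_left _
  · ext1 n
    rw [map_add, PowerSeries.coeff_C_mul, PowerSeries.coeff_mul_C, coeff_expoMinus, mul_smul_comm,
      heis_mul_heis_neg, smul_add, smul_mul_assoc, smul_smul]
    congr 1
    by_cases h : i = j ∧ Odd m
    · rw [if_pos h, PowerSeries.coeff_X_pow]
      by_cases hm : m = n
      · subst hm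
        have : (m : ℂ) ≠ 0 := by exact_mod_cast h.2.pos.ne'
        rw [if_pos ⟨h.1, rfl, h.2⟩, if_pos rfl]
        field_simp
        simp
      · rw [if_neg (fun h' => hm h'.2.1), if_neg (fun h' => hm h'.symm)]
        simp
    · rw [if_neg h, if_neg (fun h' => h ⟨h'.1, h'.2.2⟩)]
      simp

/-- The coefficients of `((1 - x) / (1 + x))^{(ε_i, ε_j)}`. -/
def contr (i j : Fin ν) (k : ℤ) : ℂ :=
  if k = 0 then 1 else if i = j ∧ 0 < k then 2 * (-1) ^ k else 0

theorem contr_zero (i j : Fin ν) : contr i j 0 = 1 := if_pos rfl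

theorem contr_neg (i j : Fin ν) {k : ℤ} (hk : k < 0) : contr i j k = 0 := by
  rw [contr, if_neg hk.ne, if_neg (fun h => absurd h.2 (by omega))]

theorem contr_pos (i : Fin ν) {k : ℤ} (hk : 0 < k) : contr i i k = 2 * (-1) ^ k := by
  rw [contr, if_neg hk.ne', if_pos ⟨rfl, hk⟩]

theorem contr_ne {i j : Fin ν} (h : i ≠ j) (k : ℤ) : contr i j k = if k = 0 then 1 else 0 := by
  simp [contr, h]

/-- For i = j this is the logarithmic derivative of (1-x)/(1+x), namely -2(x + x³ + x⁵ + ⋯). The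
induction goes in steps of two because the series is invariant under a shift by two. -/
theorem natCast_mul_contr (i j : Fin ν) (n : ℕ) : (n : ℂ) * contr i j n =
    ∑ x ∈ Finset.HasAntidiagonal.antidiagonal n,
      (if i = j ∧ Odd x.1 then (-2 : ℂ) else 0) * contr i j x.2 := by
  by_cases hij : i = j
  · subst hij
    simp only [true_and]
    rw [Finset.Nat.sum_antidiagonal_eq_sum_range_succ
      (fun k l => (if Odd k then (-2 : ℂ) else 0) * contr i i (l : ℤ))]
    induction n using Nat.strong_induction_on with
    | _ n ih =>
    match n with
    | 0 => simp
    | 1 => simp [Finset.sum_range_succ, contr_zero, contr_pos]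
    | n + 2 =>
      rw [Finset.sum_range_succ', Finset.sum_range_succ']
      have h1 : ∀ k ∈ Finset.range (n + 1),
          (if Odd (k + 1 + 1) then (-2 : ℂ) else 0) * contr i i ((n + 2 - (k + 1 + 1) : ℕ) : ℤ) =
          (if Odd k then (-2 : ℂ) else 0) * contr i i ((n - k : ℕ) : ℤ) := by
        intro k _
        rw [show n + 2 - (k + 1 + 1) = n - k by omega]
        congr 2
        rw [eq_iff_iff]
        simp [Nat.odd_add]
      rw [Finset.sum_congr rfl h1, ← ih n (by omega)]
      rw [contr_pos i (by omega : (0 : ℤ) < ((n + 2 : ℕ) : ℤ)),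
        show n + 2 - (0 + 1) = n + 1 by omega,
        contr_pos i (by omega : (0 : ℤ) < ((n + 1 : ℕ) : ℤ)), zpow_natCast, zpow_natCast]
      simp only [zero_add, Nat.not_odd_zero, if_false, zero_mul, add_zero, if_pos odd_one]
      -- The coefficient at 0 is 1 and does not follow the pattern 2(-1)^k.
      rcases Nat.eq_zero_or_pos n with rfl | hn
      · simp
      · rw [contr_pos i (by omega), zpow_natCast]
        push_cast
        ring
  · simp only [hij, false_and, if_false, zero_mul, Finset.sum_const_zero]
    rw [contr_ne hij]
    rcases Nat.eq_zero_or_pos n with rfl | hn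
    · simp
    · simp [hn.ne']

/-- The exchange relation E_+(ε_i,z)E_-(ε_j,w) = F(w/z) E_-(ε_j,w)E_+(ε_i,z), where F has
coefficients `contr i j`. Both sides, as series in z⁻¹, solve the same first-order equation and
agree at z⁻¹ = 0. -/
theorem annih_mul_creat (i j : Fin ν) (r n : ℕ) :
    PowerSeries.coeff r (annih i) * PowerSeries.coeff n (creat j) =
      ∑ x ∈ Finset.HasAntidiagonal.antidiagonal r, contr i j x.1 •
        ((if x.1 ≤ n then PowerSeries.coeff (n - x.1) (creat j) else 0) *
          PowerSeries.coeff x.2 (annih i)) := by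
  -- Nested series hold the two variables: the outer one is z⁻¹, the inner one is w. Thus `Q` is
  -- constant in the outer variable, and `F`, `w` are series in the product w/z.
  let ι : Module.End ℂ (SymPoly ν) →+* PowerSeries (Module.End ℂ (SymPoly ν)) := PowerSeries.C
  have hι (c : ℂ) (x : Module.End ℂ (SymPoly ν)) : ι (c • x) = c • ι x := by
    ext1 n
    simp only [ι, PowerSeries.coeff_C, PowerSeries.coeff_smul]
    split_ifs <;> simp
  let D := PowerSeries.map ι (annih i)
  let Q : PowerSeries (PowerSeries (Module.End ℂ (SymPoly ν))) := PowerSeries.C (creat j)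
  let g := PowerSeries.map ι (euler (expoPlus i))
  let w : PowerSeries (PowerSeries (Module.End ℂ (SymPoly ν))) :=
    PowerSeries.mk fun k => (if i = j ∧ Odd k then (-2 : ℂ) else 0) • PowerSeries.X ^ k
  let F : PowerSeries (PowerSeries (Module.End ℂ (SymPoly ν))) :=
    PowerSeries.mk fun k => contr i j k • PowerSeries.X ^ k
  have hcen (c : ℂ) (k : ℕ) (y : PowerSeries (Module.End ℂ (SymPoly ν))) :
      Commute (c • PowerSeries.X ^ k) y := (PowerSeries.commute_X_pow y k).symm.smul_left c
  have hD : euler D = g * D := by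
    rw [← map_mul, ← euler_annih]
    ext1 k
    rw [coeff_euler, PowerSeries.coeff_map, PowerSeries.coeff_map, coeff_euler, hι]
  have hQ : euler Q = 0 := by
    ext1 k
    rw [coeff_euler, PowerSeries.coeff_C]
    split_ifs with hk <;> simp [hk]
  have hF : euler F = w * F := by
    ext1 k
    rw [coeff_euler, PowerSeries.coeff_mul, PowerSeries.coeff_mk, smul_smul, natCast_mul_contr,
      Finset.sum_smul]
    refine Finset.sum_congr rfl fun x hx => ?_
    rw [PowerSeries.coeff_mk, PowerSeries.coeff_mk, smul_mul_smul_comm, ← pow_add,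
      Finset.HasAntidiagonal.mem_antidiagonal.1 hx]
  -- Commuting the logarithmic derivative of E_+ past E_- gives the logarithmic derivative of F, by
  -- `C_heis_mul_creat`.
  have hgQ : g * Q = Q * g + w * Q := by
    ext1 k
    rw [map_add, PowerSeries.coeff_mul_C, PowerSeries.coeff_C_mul, PowerSeries.coeff_mul_C,
      PowerSeries.coeff_map, coeff_euler, coeff_expoPlus, PowerSeries.coeff_mk, smul_smul, hι,
      smul_mul_assoc, C_heis_mul_creat, smul_add, mul_smul_comm, ← smul_mul_assoc]
    congr 1
    by_cases h : i = j ∧ Odd k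
    · have : (k : ℂ) ≠ 0 := by exact_mod_cast h.2.pos.ne'
      rw [if_pos h, if_pos h, smul_mul_assoc, mul_div_cancel₀ _ this]
    · rw [if_neg h, if_neg h, zero_mul, _root_.zero_smul, zero_mul, _root_.smul_zero]
  have hcF : Commute g F := (commute_of_coeff fun m n => by
    rw [PowerSeries.coeff_mk]
    exact hcen _ _ _).symm
  have key : D * Q = F * Q * D := by
    refine eq_of_euler (g := g) ?_ ?_ ?_ ?_
    · rw [PowerSeries.coeff_map, coeff_zero_euler, map_zero]
    · rw [euler_mul, hD, hQ, mul_zero, add_zero, mul_assoc]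
    · rw [euler_mul, euler_mul, hD, hF, hQ, mul_zero, add_zero]
      have hwF : Commute w F := commute_of_coeff fun m n => by
        rw [PowerSeries.coeff_mk]
        exact hcen _ _ _
      calc w * F * Q * D + F * Q * (g * D) = F * (Q * g + w * Q) * D := by
            rw [hwF.eq]
            noncomm_ring
        _ = g * (F * Q * D) := by
            rw [← hgQ, ← mul_assoc, ← hcF.eq]
            noncomm_ring
    · simp only [PowerSeries.coeff_mul]
      simp [-PowerSeries.coeff_zero_eq_constantCoeff, D, Q, F, annih, coeff_zero_formalExp,
        PowerSeries.coeff_C, contr_zero, PowerSeries.coeff_map]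
  have h1 := congrArg (fun y => PowerSeries.coeff n (PowerSeries.coeff r y)) key
  simp only [D, Q, F, PowerSeries.coeff_mul_C, PowerSeries.coeff_map] at h1
  rw [PowerSeries.coeff_C_mul, PowerSeries.coeff_mul, map_sum] at h1
  rw [h1]
  refine Finset.sum_congr rfl fun x _ => ?_
  rw [PowerSeries.coeff_mul_C, PowerSeries.coeff_mk, PowerSeries.coeff_map, PowerSeries.coeff_mul_C,
    smul_mul_assoc, PowerSeries.coeff_smul, smul_mul_assoc, PowerSeries.coeff_X_pow_mul']

end Exchange

/-! ### Series indexed by the integers -/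

section Modes

variable {V : Type*} [AddCommGroup V] [Module ℂ V]

/-- Three nested summations; the finiteness of each slice is inherited from the triple family. -/
theorem LocSum.fiberwise_nested {ι κ τ : Type*} {F : ι × κ × τ → V} {a : V} {f : ι → κ → V}
    {g : ι → V} (h : LocSum F a) (hF : ∀ x y, LocSum (fun z => F (x, y, z)) (f x y))
    (hf : ∀ x, LocSum (f x) (g x)) : LocSum g a := by
  refine h.fiberwise fun x => ?_
  have hx : LocSum (fun y => F (x, y)) (∑ᶠ y, F (x, y)) :=
    LocSum.of_finite (h.1.preimage (f := fun y => (x, y)) fun a _ b _ hab => (Prod.mk.inj hab).2)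
  rwa [← (hx.fiberwise (hF x)).unique (hf x)]

theorem LocSum.of_natCast {f : ℤ → V} {a : V} (h : LocSum (fun n : ℕ => f n) a)
    (hf : ∀ n < 0, f n = 0) : LocSum f a := by
  have h1 : ∑ n ∈ h.1.toFinset.map Nat.castEmbedding, f n = a := by
    rw [Finset.sum_map]
    exact (finsum_eq_sum_of_support_subset _ (by simp)).symm.trans h.2
  rw [← h1]
  refine LocSum.of_finset _ fun x hx => ?_
  rcases lt_or_ge x 0 with hx0 | hx0
  · exact hf x hx0
  · lift x to ℕ using hx0
    by_contra hne
    exact hx (by simpa using hne)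

theorem LocSum.of_antidiagonal {f : ℤ → V} (m : ℕ) (h0 : ∀ k < 0, f k = 0)
    (h1 : ∀ k, (m : ℤ) < k → f k = 0) :
    LocSum f (∑ x ∈ Finset.HasAntidiagonal.antidiagonal m, f x.1) := by
  refine LocSum.of_natCast ?_ h0
  rw [Finset.Nat.sum_antidiagonal_eq_sum_range_succ (fun k _ => f (k : ℤ))]
  refine LocSum.of_finset (f := fun n : ℕ => f n) _ fun x hx => h1 _ ?_
  simp only [Finset.mem_range, not_lt] at hx
  omega

/-- The coefficients of a power series, extended by zero to the negative integers. -/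
def modeZ {A : Type*} [Ring A] (P : PowerSeries A) (n : ℤ) : A :=
  if 0 ≤ n then PowerSeries.coeff n.toNat P else 0

theorem modeZ_natCast {A : Type*} [Ring A] (P : PowerSeries A) (n : ℕ) :
    modeZ P (n : ℤ) = PowerSeries.coeff n P := by
  simp [modeZ]

theorem modeZ_neg {A : Type*} [Ring A] (P : PowerSeries A) {n : ℤ} (h : n < 0) :
    modeZ P n = 0 := if_neg (by omega)

theorem modeZ_one {A : Type*} [Ring A] (n : ℤ) :
    modeZ (1 : PowerSeries A) n = if n = 0 then 1 else 0 := by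
  rcases lt_or_ge n 0 with h | h
  · rw [modeZ_neg _ h, if_neg (by omega)]
  · lift n to ℕ using h
    rw [modeZ_natCast, PowerSeries.coeff_one]
    simp

theorem modeZ_resc {c : ℂ} (P : PowerSeries (Module.End ℂ V)) (n : ℤ) :
    modeZ (resc c P) n = c ^ n • modeZ P n := by
  rcases lt_or_ge n 0 with h | h
  · rw [modeZ_neg _ h, modeZ_neg _ h, smul_zero]
  · lift n to ℕ using h
    rw [modeZ_natCast, modeZ_natCast, coeff_resc, zpow_natCast]

theorem modeZ_euler (P : PowerSeries (Module.End ℂ V)) (n : ℤ) :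
    modeZ (euler P) n = (n : ℂ) • modeZ P n := by
  rcases lt_or_ge n 0 with h | h
  · rw [modeZ_neg _ h, modeZ_neg _ h, smul_zero]
  · lift n to ℕ using h
    rw [modeZ_natCast, modeZ_natCast, coeff_euler, Int.cast_natCast]

theorem commute_modeZ {A : Type*} [Ring A] {P Q : PowerSeries A}
    (h : ∀ m n, Commute (PowerSeries.coeff m P) (PowerSeries.coeff n Q)) (m n : ℤ) :
    Commute (modeZ P m) (modeZ Q n) := by
  unfold modeZ
  split_ifs
  · exact h _ _
  all_goals simp

theorem locSum_modeZ_mul (P Q : PowerSeries (Module.End ℂ V)) (m : ℤ) (v : V) :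
    LocSum (fun k => modeZ P (m - k) (modeZ Q k v)) (modeZ (P * Q) m v) := by
  rcases lt_or_ge m 0 with h | h
  · refine LocSum.zero.congr (fun k => ?_) (by rw [modeZ_neg _ h]; rfl)
    rcases lt_or_ge k 0 with hk | hk
    · rw [modeZ_neg _ hk, LinearMap.zero_apply, map_zero]
    · rw [modeZ_neg P (by omega), LinearMap.zero_apply]
  · lift m to ℕ using h
    refine (LocSum.of_antidiagonal m (fun k hk => ?_) (fun k hk => ?_)).congr (fun k => rfl) ?_
    · rw [modeZ_neg _ hk, LinearMap.zero_apply, map_zero]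
    · rw [modeZ_neg P (by omega), LinearMap.zero_apply]
    · rw [modeZ_natCast, PowerSeries.coeff_mul, LinearMap.sum_apply,
        ← Finset.Nat.sum_antidiagonal_swap]
      refine Finset.sum_congr rfl fun x hx => ?_
      have hx := Finset.HasAntidiagonal.mem_antidiagonal.1 hx
      simp only [Prod.fst_swap]
      rw [show (m : ℤ) - (x.2 : ℤ) = (x.1 : ℤ) by omega, modeZ_natCast, modeZ_natCast]
      rfl

theorem mem_Icc_of_modeZ {P1 P2 : PowerSeries (Module.End ℂ V)} {m n : ℤ} {v : V}
    (h : modeZ P1 m (modeZ P2 n v) ≠ 0) : 0 ≤ m ∧ 0 ≤ n := by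
  constructor <;> by_contra h0 <;> apply h
  · rw [modeZ_neg P1 (by omega), LinearMap.zero_apply]
  · rw [modeZ_neg P2 (by omega), LinearMap.zero_apply, map_zero]

/-- The normally ordered product of two vertex operators, as a function of two variables: the
coefficient of `z^{-p} w^{-q}` in `P₁(z) P₂(w) R₁(z⁻¹) R₂(w⁻¹)`. -/
def normalMode (P₁ P₂ R₁ R₂ : PowerSeries (Module.End ℂ V)) (p q : ℤ) (v : V) : V :=
  ∑ᶠ x : ℤ × ℤ, modeZ P₁ (x.1 - p) (modeZ P₂ (x.2 - q) (modeZ R₁ x.1 (modeZ R₂ x.2 v)))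

end Modes

/-! ### Bosonic normally ordered products and their restriction to a line w = cz. -/

section Normal

variable {ν : ℕ}

/-- The modes lower the weight by r + s in total, v has bounded weight, and nothing nonzero has
negative weight. -/
theorem Lowers.exists_bound {R₁ R₂ : PowerSeries (Module.End ℂ (SymPoly ν))} (h₁ : Lowers R₁)
    (h₂ : Lowers R₂) (v : SymPoly ν) :
    ∃ N : ℤ, ∀ r s : ℤ, modeZ R₁ r (modeZ R₂ s v) ≠ 0 → 0 ≤ r ∧ r ≤ N ∧ 0 ≤ s ∧ s ≤ N := by
  obtain ⟨d, hd⟩ := exists_mem_weightLE v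
  refine ⟨d, fun r s h => ?_⟩
  obtain ⟨hr, hs⟩ := mem_Icc_of_modeZ h
  lift r to ℕ using hr
  lift s to ℕ using hs
  rw [modeZ_natCast, modeZ_natCast] at h
  have : ¬ ((d : ℤ) - s - r < 0) := fun hlt =>
    h (eq_zero_of_mem_weightLE hlt (h₁ r _ _ (h₂ s d v hd)))
  omega

theorem locSum_productMode (P Q : PowerSeries (Module.End ℂ (SymPoly ν))) (hQ : Lowers Q) (n : ℤ)
    (v : SymPoly ν) :
    LocSum (fun r => modeZ P (r - n) (modeZ Q r v)) (productMode P Q hQ n v) := by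
  refine LocSum.of_natCast ?_ fun r hr => ?_
  · have h (q : ℕ) : modeZ P ((q : ℤ) - n) (modeZ Q q v) =
        if n ≤ q then PowerSeries.coeff ((q : ℤ) - n).toNat P (PowerSeries.coeff q Q v) else 0 := by
      rw [modeZ_natCast, modeZ]
      by_cases hq : n ≤ q
      · rw [if_pos hq, if_pos (by omega)]
      · rw [if_neg hq, if_neg (by omega), LinearMap.zero_apply]
    refine ⟨(hQ.finite v).subset fun q hq h0 => hq ?_, ?_⟩
    · simp only []
      rw [modeZ_natCast Q, h0, map_zero]
    · exact finsum_congr h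
  · rw [modeZ_neg Q hr, LinearMap.zero_apply, map_zero]

theorem locSum_normalMode (P₁ P₂ : PowerSeries (Module.End ℂ (SymPoly ν)))
    {R₁ R₂ : PowerSeries (Module.End ℂ (SymPoly ν))} (h₁ : Lowers R₁) (h₂ : Lowers R₂) (p q : ℤ)
    (v : SymPoly ν) :
    LocSum (fun x : ℤ × ℤ => modeZ P₁ (x.1 - p) (modeZ P₂ (x.2 - q)
      (modeZ R₁ x.1 (modeZ R₂ x.2 v)))) (normalMode P₁ P₂ R₁ R₂ p q v) := by
  refine LocSum.of_finite ?_
  obtain ⟨N, hN⟩ := h₁.exists_bound h₂ v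
  refine ((Set.finite_Icc 0 N).prod (Set.finite_Icc 0 N)).subset fun x hx => ?_
  have := hN x.1 x.2 fun h0 => hx (by simp only [h0, map_zero])
  exact ⟨⟨this.1, this.2.1⟩, this.2.2⟩

/-- The bound is one-sided because creation modes may raise the weight without limit. On a line p +
q = n it still leaves finitely many terms. -/
theorem normalMode_bound (P₁ P₂ : PowerSeries (Module.End ℂ (SymPoly ν)))
    {R₁ R₂ : PowerSeries (Module.End ℂ (SymPoly ν))} (h₁ : Lowers R₁) (h₂ : Lowers R₂)
    (v : SymPoly ν) :
    ∃ N : ℤ, ∀ p q : ℤ, normalMode P₁ P₂ R₁ R₂ p q v ≠ 0 → p ≤ N ∧ q ≤ N := by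
  obtain ⟨N, hN⟩ := h₁.exists_bound h₂ v
  refine ⟨N, fun p q h => ?_⟩
  by_contra hpq
  refine h (LocSum.eq_zero (locSum_normalMode P₁ P₂ h₁ h₂ p q v) fun x => ?_)
  by_contra hx
  have := hN x.1 x.2 fun h0 => hx (by simp only [h0, map_zero])
  have := mem_Icc_of_modeZ hx
  omega

theorem normalMode_swap {P₁ P₂ R₁ R₂ : PowerSeries (Module.End ℂ (SymPoly ν))}
    (hP : ∀ m n, Commute (PowerSeries.coeff m P₁) (PowerSeries.coeff n P₂))
    (hR : ∀ m n, Commute (PowerSeries.coeff m R₁) (PowerSeries.coeff n R₂))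
    (h₁ : Lowers R₁) (h₂ : Lowers R₂) (p q : ℤ) (v : SymPoly ν) :
    normalMode P₁ P₂ R₁ R₂ p q v = normalMode P₂ P₁ R₂ R₁ q p v := by
  refine (locSum_normalMode P₁ P₂ h₁ h₂ p q v).unique
    (((locSum_normalMode P₂ P₁ h₂ h₁ q p v).reindex (Equiv.prodComm ℤ ℤ)).congr (fun x => ?_) rfl)
  simp only [Equiv.prodComm_apply, Prod.fst_swap, Prod.snd_swap]
  have e1 := LinearMap.congr_fun (commute_modeZ hR x.1 x.2).eq v
  simp only [Module.End.mul_apply] at e1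
  rw [← e1]
  exact LinearMap.congr_fun (commute_modeZ hP (x.1 - p) (x.2 - q)).eq.symm _

/-- The substitution w = cz in a normally ordered product: the creation parts multiply to P and the
annihilation parts to R. R₂ is a series in w⁻¹, hence the inverse scale. -/
theorem locSum_normalMode_specialize {P₁ P₂ R₁ R₂ R : PowerSeries (Module.End ℂ (SymPoly ν))}
    (h₁ : Lowers R₁) (h₂ : Lowers R₂) {c : ℂ} (hc : c ≠ 0) {P : PowerSeries (Module.End ℂ (SymPoly ν))}
    (hP : P₁ * resc c P₂ = P) (hR : R₁ * resc c⁻¹ R₂ = R) (h : Lowers R) (n : ℤ) (v : SymPoly ν) :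
    LocSum (fun q => c ^ (-q) • normalMode P₁ P₂ R₁ R₂ (n - q) q v) (productMode P R h n v) := by
  subst hP hR
  let T : ℤ × ℤ × ℤ → SymPoly ν := fun x => c ^ (-x.1) • modeZ P₁ (x.2.1 - (n - x.1))
    (modeZ P₂ (x.2.2 - x.1) (modeZ R₁ x.2.1 (modeZ R₂ x.2.2 v)))
  have hT : LocSum T (∑ᶠ x, T x) := by
    refine LocSum.of_finite ?_
    obtain ⟨N, hN⟩ := h₁.exists_bound h₂ v
    refine ((Set.finite_Icc (n - N) N).prod
      ((Set.finite_Icc 0 N).prod (Set.finite_Icc 0 N))).subset fun x hx => ?_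
    have h3 := hN x.2.1 x.2.2 fun h0 => hx (by simp only [T, h0, map_zero, smul_zero])
    have h4 := mem_Icc_of_modeZ fun h0 => hx (by simp only [T]; rw [h0, smul_zero])
    simp only [Set.mem_prod, Set.mem_Icc]
    omega
  have e1 : LocSum (fun q => c ^ (-q) • normalMode P₁ P₂ R₁ R₂ (n - q) q v) (∑ᶠ x, T x) :=
    hT.fiberwise fun q => (locSum_normalMode P₁ P₂ h₁ h₂ (n - q) q v).smul (c ^ (-q))
  -- New coordinates (t,s,k): total annihilation degree, annihilation degree of the second factor,
  -- creation degree of the second factor. Then q = s - k, and c^{-q} splits as c^k c^{-s}.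
  let e : ℤ × ℤ × ℤ ≃ ℤ × ℤ × ℤ :=
    { toFun := fun x => (x.2.1 - x.2.2, x.1 - x.2.1, x.2.1)
      invFun := fun x => (x.2.1 + x.2.2, x.2.2, x.2.2 - x.1)
      left_inv := fun x => by ext <;> simp
      right_inv := fun x => by ext <;> simp }
  have e2 : LocSum (fun t => modeZ (P₁ * resc c P₂) (t - n) (modeZ (R₁ * resc c⁻¹ R₂) t v))
      (∑ᶠ x, T x) := by
    refine (hT.reindex e).fiberwise_nested
      (f := fun t s => modeZ (P₁ * resc c P₂) (t - n) (modeZ R₁ (t - s) (modeZ (resc c⁻¹ R₂) s v)))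
      (fun t s => ?_) fun t => (locSum_modeZ_mul _ _ t v).map (modeZ (P₁ * resc c P₂) (t - n))
    refine (locSum_modeZ_mul P₁ (resc c P₂) (t - n) _).congr (fun k => ?_) rfl
    simp only [T, e, Equiv.coe_fn_mk, modeZ_resc, LinearMap.smul_apply, map_smul, smul_smul]
    rw [show t - s - (n - (s - k)) = t - n - k by ring, show s - (s - k) = k by ring, inv_zpow',
      ← zpow_add₀ hc, neg_sub, neg_add_eq_sub]
  rw [(locSum_productMode _ _ h n v).unique e2]
  exact e1

end Normal

/-! ### Fermions -/

/-! ### Summation of two-sided recursions. -/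

section Abel

variable {V : Type*} [AddCommGroup V] [Module ℂ V]

theorem LocSum.weight {ι : Type*} {f : ι → V} {a : V} (h : LocSum f a) (w : ι → ℂ) :
    LocSum (fun x => w x • f x) (∑ᶠ x, w x • f x) :=
  LocSum.of_finite (h.1.subset fun x hx h0 => hx (by simp only [h0, smul_zero]))

theorem LocSum.shift {f : ℤ → V} {a : V} (h : LocSum f a) (n : ℤ) :
    LocSum (fun k => f (k + n)) a := h.reindex (Equiv.addRight n)

/-- Summing over q gives (1 - a)s = (1 + a)b, as shifts do not change sums. -/
theorem LocSum.of_recursion {x y : ℤ → V} {a : ℂ} (ha : a ≠ 1) {s b : V} (hx : LocSum x s)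
    (hy : LocSum y b) (h : ∀ q, x q - a • x (q + 1) = y q + a • y (q + 1)) :
    LocSum x (((1 + a) / (1 - a)) • b) := by
  have h1 := (hx.sub ((hx.shift 1).smul a)).unique
    ((hy.add ((hy.shift 1).smul a)).congr (fun q => (h q).symm) rfl)
  have h2 : (1 - a) • s = (1 + a) • b := by linear_combination (norm := module) h1
  have h3 : 1 - a ≠ 0 := sub_ne_zero.2 ha.symm
  have h4 : s = ((1 + a) / (1 - a)) • b := by
    rw [div_eq_inv_mul, mul_smul, ← h2, smul_smul, inv_mul_cancel₀ h3, one_smul]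
  exact h4 ▸ hx

/-- The degenerate case a = 1 of `LocSum.of_recursion`, where plain summation says nothing about s.
Weighting the recursion by q before summing recovers s: l'Hospital's rule in discrete form. -/
theorem LocSum.of_recursion_one {x y : ℤ → V} {s g : V} (hx : LocSum x s) (hy : LocSum y 0)
    (hg : LocSum (fun q : ℤ => (q : ℂ) • y q) g) (h : ∀ q, x q - x (q + 1) = y q + y (q + 1)) :
    LocSum x ((2 : ℂ) • g) := by
  have hw := hx.weight fun q => (q : ℂ)
  have h1 := (hw.sub ((hw.shift 1).sub (hx.shift 1))).unique
    ((hg.add ((hg.shift 1).sub (hy.shift 1))).congr (fun q => ?_) rfl)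
  · have h2 : s = (2 : ℂ) • g := by linear_combination (norm := module) h1
    exact h2 ▸ hx
  · have h3 := congrArg (fun v => (q : ℂ) • v) (h q)
    simp only [smul_sub, smul_add] at h3
    push_cast
    linear_combination (norm := module) -h3

end Abel

/-! ### Bosonic exponentials as fermionic fields. -/

section Fermi

variable {ν : ℕ}

theorem lowers_annih (i : Fin ν) : Lowers (annih i) := by
  rw [← Eplus_basisVec]
  exact Lowers.Eplus _ _

/-- The coefficient of `z^{-p}` in `E_-(ε_i, z) E_+(ε_i, z)`. -/
def fermi (i : Fin ν) (p : ℤ) : Module.End ℂ (SymPoly ν) :=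
  productMode (creat i) (annih i) (lowers_annih i) p

/-- The coefficient of `z^{-p} w^{-q}` in `E_-(ε_i, z) E_-(ε_j, w) E_+(ε_i, z) E_+(ε_j, w)`. -/
def fermiNormal (i j : Fin ν) (p q : ℤ) (v : SymPoly ν) : SymPoly ν :=
  normalMode (creat i) (creat j) (annih i) (annih j) p q v

theorem fermiNormal_swap (i j : Fin ν) (p q : ℤ) (v : SymPoly ν) :
    fermiNormal i j p q v = fermiNormal j i q p v :=
  normalMode_swap (commute_creat i j) (commute_annih i j) (lowers_annih i) (lowers_annih j) p q v

theorem locSum_exchange (i j : Fin ν) (r n : ℤ) (v : SymPoly ν) :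
    LocSum (fun k => contr i j k • modeZ (creat j) (n - k) (modeZ (annih i) (r - k) v))
      (modeZ (annih i) r (modeZ (creat j) n v)) := by
  have hz (h : r < 0 ∨ n < 0) (k : ℤ) :
      contr i j k • modeZ (creat j) (n - k) (modeZ (annih i) (r - k) v) = 0 := by
    rcases lt_or_ge k 0 with hk | hk
    · rw [contr_neg i j hk, zero_smul]
    · rcases h with h | h
      · rw [modeZ_neg (annih i) (by omega), LinearMap.zero_apply, map_zero, smul_zero]
      · rw [modeZ_neg (creat j) (by omega), LinearMap.zero_apply, smul_zero]
  rcases lt_or_ge r 0 with hr | hr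
  · refine LocSum.zero.congr (fun k => (hz (Or.inl hr) k).symm) ?_
    rw [modeZ_neg (annih i) hr, LinearMap.zero_apply]
  rcases lt_or_ge n 0 with hn | hn
  · refine LocSum.zero.congr (fun k => (hz (Or.inr hn) k).symm) ?_
    rw [modeZ_neg (creat j) hn, LinearMap.zero_apply, map_zero]
  lift r to ℕ using hr
  lift n to ℕ using hn
  refine (LocSum.of_antidiagonal r (fun k hk => ?_) (fun k hk => ?_)).congr (fun k => rfl) ?_
  · rw [contr_neg i j hk, zero_smul]
  · rw [modeZ_neg (annih i) (by omega), LinearMap.zero_apply, map_zero, smul_zero]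
  · rw [modeZ_natCast, modeZ_natCast, ← Module.End.mul_apply, annih_mul_creat,
      LinearMap.sum_apply]
    refine Finset.sum_congr rfl fun x hx => ?_
    have hx := Finset.HasAntidiagonal.mem_antidiagonal.1 hx
    rw [LinearMap.smul_apply, Module.End.mul_apply,
      show (r : ℤ) - (x.1 : ℤ) = (x.2 : ℤ) by omega, modeZ_natCast]
    congr 2
    split_ifs with hle
    · rw [show (n : ℤ) - (x.1 : ℤ) = ((n - x.1 : ℕ) : ℤ) by omega, modeZ_natCast]
    · rw [modeZ_neg (creat j) (by omega)]

/-- Passing from an exchange relation between R₁ and P₂ to the expansion of an operator product in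
normally ordered products. One-sidedness of c, with the bounds on annihilation degrees, makes the
triple sum finite. -/
theorem locSum_productMode_mul {P₁ P₂ R₁ R₂ : PowerSeries (Module.End ℂ (SymPoly ν))}
    (h₁ : Lowers R₁) (h₂ : Lowers R₂) {c : ℤ → ℂ} (hc : ∀ k < 0, c k = 0)
    (hex : ∀ (r n : ℤ) (v : SymPoly ν),
      LocSum (fun k => c k • modeZ P₂ (n - k) (modeZ R₁ (r - k) v)) (modeZ R₁ r (modeZ P₂ n v)))
    (p q : ℤ) (v : SymPoly ν) :
    LocSum (fun k => c k • normalMode P₁ P₂ R₁ R₂ (p - k) (q + k) v)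
      (productMode P₁ R₁ h₁ p (productMode P₂ R₂ h₂ q v)) := by
  let T : ℤ × ℤ × ℤ → SymPoly ν := fun x => c x.1 • modeZ P₁ (x.2.1 - (p - x.1))
    (modeZ P₂ (x.2.2 - (q + x.1)) (modeZ R₁ x.2.1 (modeZ R₂ x.2.2 v)))
  have hT : LocSum T (∑ᶠ x, T x) := by
    refine LocSum.of_finite ?_
    obtain ⟨N, hN⟩ := h₁.exists_bound h₂ v
    refine ((Set.finite_Icc 0 (N - q)).prod
      ((Set.finite_Icc 0 N).prod (Set.finite_Icc 0 N))).subset fun x hx => ?_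
    have h3 := hN x.2.1 x.2.2 fun h0 => hx (by simp only [T, h0, map_zero, smul_zero])
    have h4 := mem_Icc_of_modeZ fun h0 => hx (by simp only [T]; rw [h0, smul_zero])
    have h5 : ¬ x.1 < 0 := fun h0 => hx (by simp only [T]; rw [hc _ h0, zero_smul])
    simp only [Set.mem_prod, Set.mem_Icc]
    omega
  have e1 : LocSum (fun k => c k • normalMode P₁ P₂ R₁ R₂ (p - k) (q + k) v) (∑ᶠ x, T x) :=
    hT.fiberwise fun k => (locSum_normalMode P₁ P₂ h₁ h₂ (p - k) (q + k) v).smul (c k)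
  -- New coordinates (s,r,k), with r the annihilation degree of the first factor before the
  -- exchange; the exchange lowers it to r - k.
  let e : ℤ × ℤ × ℤ ≃ ℤ × ℤ × ℤ :=
    { toFun := fun x => (x.2.2, x.2.1 - x.2.2, x.1)
      invFun := fun x => (x.2.2, x.2.1 + x.1, x.1)
      left_inv := fun x => by ext <;> simp
      right_inv := fun x => by ext <;> simp }
  have e2 : LocSum (fun s => productMode P₁ R₁ h₁ p (modeZ P₂ (s - q) (modeZ R₂ s v)))
      (∑ᶠ x, T x) := by
    refine (hT.reindex e).fiberwise_nested (f := fun s r => modeZ P₁ (r - p)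
      (modeZ R₁ r (modeZ P₂ (s - q) (modeZ R₂ s v)))) (fun s r => ?_)
      fun s => locSum_productMode P₁ R₁ h₁ p _
    refine ((hex r (s - q) (modeZ R₂ s v)).map (modeZ P₁ (r - p))).congr (fun k => ?_) rfl
    simp only [T, e, Equiv.coe_fn_mk, map_smul]
    rw [show r - k - (p - k) = r - p by ring, show s - (q + k) = s - q - k by ring]
  rw [((locSum_productMode P₂ R₂ h₂ q v).map (productMode P₁ R₁ h₁ p)).unique e2]
  exact e1

theorem locSum_fermi_fermi (i j : Fin ν) (p q : ℤ) (v : SymPoly ν) :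
    LocSum (fun k => contr i j k • fermiNormal i j (p - k) (q + k) v)
      (fermi i p (fermi j q v)) :=
  locSum_productMode_mul (lowers_annih i) (lowers_annih j) (fun _ => contr_neg i j)
    (locSum_exchange i j) p q v

theorem fermi_fermi_of_ne {i j : Fin ν} (h : i ≠ j) (p q : ℤ) (v : SymPoly ν) :
    fermi i p (fermi j q v) = fermiNormal i j p q v := by
  refine (locSum_fermi_fermi i j p q v).unique
    ((LocSum.single (0 : ℤ) fun k hk => ?_).congr (fun k => rfl) ?_)
  · rw [contr_ne h, if_neg hk, zero_smul]
  · rw [contr_zero, one_smul, sub_zero, add_zero]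

theorem fermi_comm_of_ne {i j : Fin ν} (h : i ≠ j) (p q : ℤ) (v : SymPoly ν) :
    fermi i p (fermi j q v) = fermi j q (fermi i p v) := by
  rw [fermi_fermi_of_ne h, fermi_fermi_of_ne h.symm, fermiNormal_swap]

theorem locSum_symMode (i j : Fin ν) (a : ℂˣ) (n : ℤ) (v : SymPoly ν) :
    LocSum (fun q => (-(a : ℂ)) ^ (-q) • fermiNormal i j (n - q) q v) (symMode i j a n v) := by
  refine locSum_normalMode_specialize (lowers_annih i) (lowers_annih j)
    (neg_ne_zero.2 a.ne_zero) ?_ ?_ _ n v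
  · rw [Eminus_basisVec, Eminus_neg_basisVec]
  · rw [Eplus_basisVec, Eplus_neg_basisVec, inv_neg]

/-- On the line w = -z the two halves cancel by `creat_mul_resc` and `annih_mul_resc`, leaving the
identity series. -/
theorem locSum_fermiNormal_one (i : Fin ν) (n : ℤ) (v : SymPoly ν) :
    LocSum (fun q => (-1 : ℂ) ^ (-q) • fermiNormal i i (n - q) q v) (if n = 0 then v else 0) := by
  have h := locSum_normalMode_specialize (lowers_annih i) (lowers_annih i)
    (neg_ne_zero.2 one_ne_zero) (creat_mul_resc i) (by rw [inv_neg, inv_one, annih_mul_resc])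
    Lowers.one n v
  refine h.congr (fun q => rfl) ((locSum_productMode 1 1 Lowers.one n v).unique
    ((LocSum.single 0 fun r hr => ?_).congr (fun r => rfl) ?_))
  · rw [modeZ_one r, if_neg hr, LinearMap.zero_apply, map_zero]
  · rw [modeZ_one, modeZ_one, if_pos rfl]
    simp only [zero_sub, neg_eq_zero]
    split_ifs <;> rfl

/-- The expansions of (1-x)/(1+x) at 0 and of (1-x⁻¹)/(1+x⁻¹) at infinity add up to a delta series
at x = -1. The value 1 at k = 0, counted twice, fits the pattern. -/
theorem contr_add_contr_neg (i : Fin ν) (k : ℤ) : contr i i k + contr i i (-k) = 2 * (-1) ^ k := by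
  rcases lt_trichotomy k 0 with h | rfl | h
  · rw [contr_neg i i h, contr_pos i (by omega), zero_add, zpow_neg, ← inv_zpow]
    norm_num
  · simp [contr_zero]
    norm_num
  · rw [contr_neg i i (by omega : -k < 0), contr_pos i h, add_zero]

/-- The identity (1 + x) · (1-x)/(1+x) = 1 - x. -/
theorem contr_add_contr_sub_one (i : Fin ν) (k : ℤ) : contr i i k + contr i i (k - 1) =
    (if k = 0 then 1 else 0) - if k = 1 then 1 else 0 := by
  rcases lt_trichotomy k 0 with h | rfl | h
  · rw [contr_neg i i h, contr_neg i i (by omega), if_neg (by omega), if_neg (by omega)]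
    ring
  · rw [contr_zero, contr_neg i i (by omega)]
    norm_num
  · rw [contr_pos i h, if_neg h.ne']
    by_cases h1 : k = 1
    · subst h1
      rw [sub_self, contr_zero]
      norm_num
    · rw [contr_pos i (by omega), if_neg h1, zpow_sub_one₀ (by norm_num)]
      norm_num

theorem neg_one_zpow_neg (k : ℤ) : (-1 : ℂ) ^ (-k) = (-1) ^ k := by
  rw [zpow_neg, ← inv_zpow]
  norm_num

/-- The bosonic normal product is symmetric, so the anticommutator is that product times the delta
series at w = -z, where the product is 1. -/
theorem fermi_anticomm (i : Fin ν) (p q : ℤ) (v : SymPoly ν) :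
    fermi i p (fermi i q v) + fermi i q (fermi i p v) =
      (if p + q = 0 then 2 * (-1 : ℂ) ^ q else 0) • v := by
  have h1 := locSum_fermi_fermi i i p q v
  -- Negating k aligns the swapped product with the terms :φ(p-k)φ(q+k): of the first.
  have h2 := (locSum_fermi_fermi i i q p v).reindex (Equiv.neg ℤ)
  have h3 := ((locSum_fermiNormal_one i (p + q) v).shift q).smul (2 * (-1 : ℂ) ^ q)
  refine (h1.add h2).unique (h3.congr (fun k => ?_) ?_)
  · simp only [Equiv.neg_apply]
    rw [fermiNormal_swap i i (q - -k), show q - -k = q + k by ring, show p + -k = p - k by ring,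
      ← add_smul, contr_add_contr_neg, smul_smul, add_comm k q,
      show p + q - (q + k) = p - k by ring, neg_one_zpow_neg, zpow_add₀ (by norm_num)]
    congr 1
    have : (-1 : ℂ) ^ q * (-1) ^ q = 1 := by rw [← mul_zpow]; norm_num
    linear_combination (2 * (-1 : ℂ) ^ k) * this
  · split_ifs
    · rfl
    · rw [smul_zero, zero_smul]

/-! ### Fermionic normal ordering and the diagonal operators with a ≠ 1. -/

/-- The fermionic normally ordered product of two modes of the same field. -/
def fermiQuad (i : Fin ν) (p q : ℤ) (v : SymPoly ν) : SymPoly ν :=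
  fermi i p (fermi i q v) - (if p + q = 0 then contr i i p else 0) • v

/-- The bosonic normally ordered product with its vacuum expectation removed. -/
def fermiNormal₀ (i : Fin ν) (p q : ℤ) (v : SymPoly ν) : SymPoly ν :=
  fermiNormal i i p q v - (if p = 0 ∧ q = 0 then (1 : ℂ) else 0) • v

theorem fermiQuad_swap (i : Fin ν) (p q : ℤ) (v : SymPoly ν) :
    fermiQuad i p q v = -fermiQuad i q p v := by
  have h := fermi_anticomm i p q v
  rw [fermiQuad, fermiQuad, neg_sub, sub_eq_sub_iff_add_eq_add, h, ← add_smul, add_comm q p]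
  congr 1
  split_ifs with hpq
  · obtain rfl : p = -q := by omega
    rw [contr_add_contr_neg]
  · simp

/-- For large q the right-hand mode annihilates; removing the vacuum expectation makes the
expression antisymmetric, which transfers the bound to p. -/
theorem fermiQuad_bound (i : Fin ν) (v : SymPoly ν) :
    ∃ N : ℤ, ∀ p q : ℤ, fermiQuad i p q v ≠ 0 → p ≤ N ∧ q ≤ N := by
  obtain ⟨N, hN⟩ := normalMode_bound (creat i) (creat i) (lowers_annih i) (lowers_annih i) v
  -- Requiring q > 0 as well forces p < 0 when p + q = 0, so the subtracted scalar vanishes too.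
  have key (p q : ℤ) (hq : max N 0 < q) : fermiQuad i p q v = 0 := by
    have h1 : fermi i p (fermi i q v) = 0 := by
      refine LocSum.eq_zero (locSum_fermi_fermi i i p q v) fun k => ?_
      rcases lt_or_ge k 0 with hk | hk
      · rw [contr_neg i i hk, zero_smul]
      · have : fermiNormal i i (p - k) (q + k) v = 0 := by
          by_contra h0
          have := hN _ _ h0
          omega
        rw [this, smul_zero]
    rw [fermiQuad, h1]
    split_ifs with h2
    · rw [contr_neg i i (by omega), zero_smul, sub_zero]
    · rw [zero_smul, sub_zero]
  refine ⟨max N 0, fun p q h => ⟨?_, ?_⟩⟩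
  · by_contra hp
    exact h (by rw [fermiQuad_swap, key q p (by omega), neg_zero])
  · by_contra hq
    exact h (key p q (by omega))

/-- Clearing the denominator in the relation between the two normal orderings: (1 + w/z) times the
fermionic one is (1 - w/z) times the bosonic one less 1. Multiplication by w/z moves (p,q) to
(p-1,q+1). -/
theorem fermiQuad_recursion (i : Fin ν) (p q : ℤ) (v : SymPoly ν) :
    fermiQuad i p q v + fermiQuad i (p - 1) (q + 1) v =
      fermiNormal₀ i p q v - fermiNormal₀ i (p - 1) (q + 1) v := by
  have h1 := locSum_fermi_fermi i i p q v
  have h2 := (locSum_fermi_fermi i i (p - 1) (q + 1) v).shift (-1)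
  have h3 : LocSum (fun k : ℤ => (if k = 0 then (1 : ℂ) else 0) • fermiNormal i i (p - k) (q + k) v)
      (fermiNormal i i p q v) := by
    refine (LocSum.single (0 : ℤ) fun k hk => ?_).congr (fun k => rfl) ?_
    · rw [if_neg hk, zero_smul]
    · rw [if_pos rfl, one_smul, sub_zero, add_zero]
  have h4 : LocSum (fun k : ℤ => (if k = 1 then (1 : ℂ) else 0) • fermiNormal i i (p - k) (q + k) v)
      (fermiNormal i i (p - 1) (q + 1) v) := by
    refine (LocSum.single (1 : ℤ) fun k hk => ?_).congr (fun k => rfl) ?_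
    · rw [if_neg hk, zero_smul]
    · rw [if_pos rfl, one_smul]
  have h5 : fermi i p (fermi i q v) + fermi i (p - 1) (fermi i (q + 1) v) =
      fermiNormal i i p q v - fermiNormal i i (p - 1) (q + 1) v := by
    refine (h1.add h2).unique ((h3.sub h4).congr (fun k => ?_) rfl)
    rw [← sub_smul, ← contr_add_contr_sub_one i, show p - 1 - (k + -1) = p - k by ring,
      show q + 1 + (k + -1) = q + k by ring, ← add_smul, sub_eq_add_neg k 1]
  have h6 : (if p + q = 0 then contr i i p else 0) +
      (if p - 1 + (q + 1) = 0 then contr i i (p - 1) else 0) =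
      (if p = 0 ∧ q = 0 then (1 : ℂ) else 0) - if p - 1 = 0 ∧ q + 1 = 0 then (1 : ℂ) else 0 := by
    rw [show p - 1 + (q + 1) = p + q by ring]
    by_cases h : p + q = 0
    · obtain rfl : q = -p := by omega
      rw [if_pos h, if_pos h, contr_add_contr_sub_one]
      congr 1
      · simp
      · simp [sub_eq_zero, neg_add_eq_zero]
    · rw [if_neg h, if_neg h, if_neg (by omega), if_neg (by omega)]
      ring
  unfold fermiQuad fermiNormal₀
  linear_combination (norm := module) h5 - h6 • v

theorem locSum_fermiNormal₀ (i : Fin ν) (c : ℂ) (n : ℤ) (v b : SymPoly ν)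
    (h : LocSum (fun q => c ^ (-q) • fermiNormal i i (n - q) q v) b) :
    LocSum (fun q => c ^ (-q) • fermiNormal₀ i (n - q) q v)
      (b - (if n = 0 then (1 : ℂ) else 0) • v) := by
  refine (h.sub (LocSum.single
    (f := fun q : ℤ => (if n - q = 0 ∧ q = 0 then (1 : ℂ) else 0) • v) 0 fun q hq => ?_)).congr
    (fun q => ?_) ?_
  · rw [if_neg (fun h => hq h.2), zero_smul]
  · rw [fermiNormal₀, smul_sub]
    by_cases hq : q = 0
    · subst hq
      simp
    · simp [hq]
  · simp

theorem locSum_fermiQuad (i : Fin ν) (c : ℂ) (n : ℤ) (v : SymPoly ν) :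
    LocSum (fun q => c ^ (-q) • fermiQuad i (n - q) q v)
      (∑ᶠ q, c ^ (-q) • fermiQuad i (n - q) q v) := by
  obtain ⟨N, hN⟩ := fermiQuad_bound i v
  refine LocSum.of_finite ((Set.finite_Icc (n - N) N).subset fun q hq => ?_)
  have := hN (n - q) q fun h0 => hq (by simp only [h0, smul_zero])
  rw [Set.mem_Icc]
  omega

theorem fermiQuad_weighted_recursion (i : Fin ν) {a : ℂ} (ha : a ≠ 0) (n q : ℤ) (v : SymPoly ν) :
    (-a) ^ (-q) • fermiQuad i (n - q) q v -
        a • (-a) ^ (-(q + 1)) • fermiQuad i (n - (q + 1)) (q + 1) v =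
      (-a) ^ (-q) • fermiNormal₀ i (n - q) q v +
        a • (-a) ^ (-(q + 1)) • fermiNormal₀ i (n - (q + 1)) (q + 1) v := by
  have h1 : a * (-a) ^ (-(q + 1)) = -(-a) ^ (-q) := by
    rw [show -(q + 1) = -q - 1 by ring, zpow_sub_one₀ (neg_ne_zero.2 ha)]
    field_simp
  have h2 := congrArg (fun x => (-a) ^ (-q) • x) (fermiQuad_recursion i (n - q) q v)
  rw [← sub_sub n q 1, smul_smul, smul_smul, h1]
  simp only [smul_add, smul_sub] at h2
  rw [neg_smul, neg_smul, sub_neg_eq_add, ← sub_eq_add_neg]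
  exact h2

/-- Restriction to w = -az, where (1 - w/z)/(1 + w/z) takes the value (1 + a)/(1 - a). -/
theorem locSum_fermiQuad_of_ne_one (i : Fin ν) (a : ℂˣ) (ha : a ≠ 1) (n : ℤ) (v : SymPoly ν) :
    LocSum (fun q => (-(a : ℂ)) ^ (-q) • fermiQuad i (n - q) q v)
      (((1 + (a : ℂ)) / (1 - (a : ℂ))) •
        (symMode i i a n v - (if n = 0 then (1 : ℂ) else 0) • v)) :=
  LocSum.of_recursion (a := (a : ℂ)) (fun h => ha (Units.ext h))
    (locSum_fermiQuad i _ n v)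
    (locSum_fermiNormal₀ i _ n v _ (locSum_symMode i i a n v))
    fun q => fermiQuad_weighted_recursion i a.ne_zero n q v

/-! ### The diagonal case a = 1: the Heisenberg field as a derivative at w = -z. -/

theorem lowers_expoPlus (i : Fin ν) : Lowers (expoPlus i) := by
  intro k d p hp
  rw [coeff_expoPlus, LinearMap.smul_apply]
  exact Submodule.smul_mem _ _ (heis_mem_weightLE i k d p hp)

theorem Lowers.euler {R : PowerSeries (Module.End ℂ (SymPoly ν))} (h : Lowers R) :
    Lowers (euler R) := by
  intro k d p hp
  rw [coeff_euler, LinearMap.smul_apply]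
  exact Submodule.smul_mem _ _ (h k d p hp)

theorem Lowers.resc {R : PowerSeries (Module.End ℂ (SymPoly ν))} (h : Lowers R) (c : ℂ) :
    Lowers (resc c R) := by
  intro k d p hp
  rw [coeff_resc, LinearMap.smul_apply]
  exact Submodule.smul_mem _ _ (h k d p hp)

/-- The weight q on w^{-q} is -w d/dw. The signs differ because R₂ is a series in w⁻¹ and P₂ a
series in w. -/
theorem smul_normalMode (P₁ P₂ : PowerSeries (Module.End ℂ (SymPoly ν)))
    {R₁ R₂ : PowerSeries (Module.End ℂ (SymPoly ν))} (h₁ : Lowers R₁) (h₂ : Lowers R₂) (p q : ℤ)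
    (v : SymPoly ν) :
    (q : ℂ) • normalMode P₁ P₂ R₁ R₂ p q v = normalMode P₁ P₂ R₁ (euler R₂) p q v -
      normalMode P₁ (euler P₂) R₁ R₂ p q v := by
  refine ((locSum_normalMode P₁ P₂ h₁ h₂ p q v).smul (q : ℂ)).unique
    (((locSum_normalMode P₁ P₂ h₁ h₂.euler p q v).sub
      (locSum_normalMode P₁ (euler P₂) h₁ h₂ p q v)).congr (fun x => ?_) rfl)
  simp only [modeZ_euler, LinearMap.smul_apply, map_smul]
  rw [← sub_smul]
  congr 1
  push_cast
  ring

/-- When P(cz) inverts P(z), only the logarithmic derivative of P at cz remains. -/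
theorem mul_resc_euler {A : Type*} [Ring A] [Algebra ℂ A] {P g : PowerSeries A} {c : ℂ}
    (hP : P * resc c P = 1) (hg : euler P = g * P)
    (hc : ∀ m n, Commute (PowerSeries.coeff m P) (PowerSeries.coeff n g)) :
    P * resc c (euler P) = resc c g := by
  have h : Commute P (resc c g) := commute_of_coeff fun m n => by
    rw [coeff_resc]
    exact (hc m n).smul_right _
  rw [hg, resc_mul, ← mul_assoc, h.eq, mul_assoc, hP, mul_one]

theorem productMode_one_left {R : PowerSeries (Module.End ℂ (SymPoly ν))} (h : Lowers R) (n : ℤ)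
    (v : SymPoly ν) : productMode 1 R h n v = modeZ R n v := by
  refine (locSum_productMode 1 R h n v).unique
    ((LocSum.single n fun r hr => ?_).congr (fun r => rfl) ?_)
  · rw [modeZ_one, if_neg (by omega), LinearMap.zero_apply]
  · rw [modeZ_one, if_pos (by omega), Module.End.one_apply]

theorem productMode_one_right (P : PowerSeries (Module.End ℂ (SymPoly ν))) (n : ℤ)
    (v : SymPoly ν) : productMode P 1 Lowers.one n v = modeZ P (-n) v := by
  refine (locSum_productMode P 1 Lowers.one n v).unique
    ((LocSum.single 0 fun r hr => ?_).congr (fun r => rfl) ?_)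
  · rw [modeZ_one r, if_neg hr, LinearMap.zero_apply, map_zero]
  · rw [modeZ_one, if_pos rfl, Module.End.one_apply, zero_sub]

theorem modeZ_expo (i : Fin ν) (n : ℤ) (v : SymPoly ν) :
    modeZ (resc (-1) (euler (expoPlus i))) n v - modeZ (resc (-1) (euler (expoMinus i))) (-n) v =
      (2 : ℂ) • heis i n v := by
  have key (m : ℕ) (s : ℤ) (hs : s.natAbs = m) (hm : m ≠ 0) (c : ℂ) :
      (-1 : ℂ) ^ m • (m : ℂ) • (c / (m : ℂ)) • heis i s = (-c) • heis i s := by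
    have h1 : (m : ℂ) ≠ 0 := by exact_mod_cast hm
    have h2 := neg_pow_smul_heis i 1 m hs
    rw [one_pow, one_smul] at h2
    rw [smul_smul (m : ℂ), mul_div_cancel₀ _ h1, smul_comm, h2, smul_neg]
    exact (neg_smul c (heis i s)).symm
  rcases lt_trichotomy n 0 with h | rfl | h
  · obtain ⟨m, rfl⟩ : ∃ m : ℕ, n = -(m : ℤ) := ⟨n.natAbs, by omega⟩
    rw [modeZ_neg (resc (-1) (euler (expoPlus i))) h, neg_neg, modeZ_natCast, coeff_resc,
      coeff_euler, coeff_expoMinus, key m _ (by simp) (by omega) 2, LinearMap.zero_apply, zero_sub,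
      LinearMap.smul_apply, neg_smul, neg_neg]
  · rw [neg_zero, show (0 : ℤ) = ((0 : ℕ) : ℤ) from rfl, modeZ_natCast, modeZ_natCast, coeff_resc,
      coeff_resc, coeff_euler, coeff_euler, Nat.cast_zero, zero_smul, zero_smul, smul_zero,
      heis_even i (by simp)]
    simp
  · lift n to ℕ using h.le
    rw [modeZ_neg (resc (-1) (euler (expoMinus i))) (by omega), modeZ_natCast, coeff_resc,
      coeff_euler, coeff_expoPlus, key n _ (by simp) (by omega) (-2), LinearMap.zero_apply, sub_zero,
      LinearMap.smul_apply, neg_neg]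

/-- The w-derivative of :φ_i(z)φ_i(w): at w = -z. Since the product itself is 1 there, the result is
the difference of the logarithmic derivatives of E_+ and E_-, that is, the full Heisenberg field. -/
theorem locSum_weighted_fermiNormal (i : Fin ν) (n : ℤ) (v : SymPoly ν) :
    LocSum (fun q : ℤ => (-1 : ℂ) ^ (-q) • (q : ℂ) • fermiNormal i i (n - q) q v)
      ((2 : ℂ) • heis i n v) := by
  have hP : creat i * resc (-1) (euler (creat i)) = resc (-1) (euler (expoMinus i)) :=
    mul_resc_euler (creat_mul_resc i) (euler_creat i) fun m n => by
      rw [coeff_euler]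
      exact (commute_coeff_formalExp (fun k => commute_expoMinus i i n k) m).symm.smul_right _
  have hR : annih i * resc (-1) (euler (annih i)) = resc (-1) (euler (expoPlus i)) :=
    mul_resc_euler (annih_mul_resc i) (euler_annih i) fun m n => by
      rw [coeff_euler]
      exact (commute_coeff_formalExp (fun k => commute_expoPlus i i n k) m).symm.smul_right _
  have hL := lowers_annih i
  have h0 : (-1 : ℂ) ≠ 0 := by norm_num
  have hi : (-1 : ℂ)⁻¹ = -1 := by norm_num
  have h1 := locSum_normalMode_specialize hL hL.euler h0 (creat_mul_resc i) (by rw [hi, hR])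
    ((lowers_expoPlus i).euler.resc (-1)) n v
  have h2 := locSum_normalMode_specialize hL hL h0 hP (by rw [hi, annih_mul_resc]) Lowers.one n v
  refine (h1.sub h2).congr (fun q => ?_) ?_
  · rw [← smul_sub, ← smul_normalMode _ _ hL hL]
    rfl
  · rw [productMode_one_left, productMode_one_right, modeZ_expo]

theorem locSum_fermiQuad_one (i : Fin ν) (n : ℤ) (v : SymPoly ν) :
    LocSum (fun q => (-1 : ℂ) ^ (-q) • fermiQuad i (n - q) q v) ((4 : ℂ) • heis i n v) := by
  have h0 : LocSum (fun q => (-1 : ℂ) ^ (-q) • fermiNormal₀ i (n - q) q v) 0 := by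
    refine (locSum_fermiNormal₀ i (-1) n v _ (locSum_fermiNormal_one i n v)).congr (fun q => rfl) ?_
    split_ifs
    · rw [one_smul, sub_self]
    · rw [zero_smul, sub_self]
  have h1 : LocSum (fun q : ℤ => (q : ℂ) • (-1 : ℂ) ^ (-q) • fermiNormal₀ i (n - q) q v)
      ((2 : ℂ) • heis i n v) := by
    refine (locSum_weighted_fermiNormal i n v).congr (fun q => ?_) rfl
    rw [smul_comm, fermiNormal₀]
    -- The vacuum term sits at q = 0, where the weight q removes it.
    by_cases hq : q = 0
    · subst hq
      rw [Int.cast_zero, zero_smul, zero_smul]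
    · rw [if_neg (fun h => hq h.2), zero_smul, sub_zero]
  refine ((locSum_fermiQuad i (-1) n v).of_recursion_one h0 h1 fun q => ?_).congr
    (fun q => rfl) ?_
  · have h2 := fermiQuad_weighted_recursion i one_ne_zero n q v
    rwa [one_smul, one_smul] at h2
  · rw [smul_smul]
    norm_num

end Fermi

/-! ### Commutators of normally ordered quadratic expressions in fermions -/

section Quadratic

variable {V : Type*} [AddCommGroup V] [Module ℂ V] {ν : ℕ}

/-- The coefficient of `x^n` in `(1 + x) / (1 - x)`. -/
def kap (n : ℤ) : ℂ := if n = 0 then 1 else if 0 < n then 2 else 0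

theorem contr_self (i : Fin ν) (n : ℤ) : contr i i n = (-1) ^ n * kap n := by
  unfold contr kap
  split_ifs <;> simp_all [mul_comm]

theorem kap_sub_kap (n s : ℤ) : kap (n - s) - kap (n + 1 - s) =
    -((if s = n then 1 else 0) + if s = n + 1 then 1 else 0) := by
  unfold kap
  rcases lt_trichotomy s n with h | rfl | h
  · rw [if_neg (by omega), if_pos (by omega), if_neg (by omega), if_pos (by omega),
      if_neg (by omega), if_neg (by omega)]
    norm_num
  · simp
    norm_num
  · by_cases h1 : s = n + 1
    · subst h1
      simp
    · rw [if_neg (by omega), if_neg (by omega), if_neg (by omega), if_neg (by omega),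
        if_neg (by omega), if_neg (by omega)]
      norm_num

/-- The value of `∑ₛ c^{-s} (kap (-s) - kap (n - s))`. -/
def anomaly (c : ℂ) (n : ℤ) : ℂ :=
  if c = 1 then -2 * n else (1 + c) / (1 - c) * (1 - c ^ (-n))

theorem anomaly_succ {c : ℂ} (hc : c ≠ 0) (n : ℤ) :
    anomaly c (n + 1) = anomaly c n - (c ^ (-n) + c ^ (-(n + 1))) := by
  unfold anomaly
  split_ifs with h
  · subst h
    push_cast
    simp only [one_zpow]
    ring
  · have h1 : 1 - c ≠ 0 := sub_ne_zero.2 (Ne.symm h)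
    have h2 : c ^ (-n) = c * c ^ (-(n + 1)) := by
      rw [← zpow_one_add₀ hc]
      congr 1
      ring
    rw [h2]
    field_simp
    ring

/-- The difference of the two step functions has finite support, so the sum exists even though
neither half does in general. Raising n by one changes it by two terms, and the closed form obeys
the same recursion. -/
theorem locSum_anomaly {c : ℂ} (hc : c ≠ 0) (n : ℤ) (v : V) :
    LocSum (fun s => (c ^ (-s) * (kap (-s) - kap (n - s))) • v) (anomaly c n • v) := by
  have hs (n t : ℤ) : LocSum (fun s => (c ^ (-s) * if s = t then 1 else 0) • v) (c ^ (-t) • v) := by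
    refine (LocSum.single t fun s hs => ?_).congr (fun s => rfl) ?_
    · rw [if_neg hs, mul_zero, zero_smul]
    · rw [if_pos rfl, mul_one]
  induction n using Int.induction_on with
  | zero =>
    refine LocSum.zero.congr (fun s => ?_) ?_
    · rw [zero_sub, sub_self, mul_zero, zero_smul]
    · simp [anomaly]
  | succ n ih =>
    refine (ih.sub ((hs n n).add (hs n (n + 1)))).congr (fun s => ?_) ?_
    · rw [← add_smul, ← sub_smul]
      congr 1
      linear_combination -c ^ (-s) * kap_sub_kap n s
    · rw [← add_smul, ← sub_smul, anomaly_succ hc]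
  | pred n ih =>
    have h1 := kap_sub_kap (-n - 1)
    have h2 := anomaly_succ hc (-n - 1)
    rw [sub_add_cancel] at h1 h2
    refine (ih.add ((hs n (-n - 1)).add (hs n (-n)))).congr (fun s => ?_) ?_
    · rw [← add_smul, ← add_smul]
      congr 1
      linear_combination c ^ (-s) * h1 s
    · rw [← add_smul, ← add_smul, h2, sub_add_cancel]

/-- The normally ordered product of two modes of fermionic fields. -/
def quad (ψ : Fin ν → ℤ → Module.End ℂ V) (i j : Fin ν) (p q : ℤ) (v : V) : V :=
  ψ i p (ψ j q v) - (if i = j ∧ p + q = 0 then contr i i p else 0) • v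

theorem neg_zpow_neg (b : ℂ) (s : ℤ) : (-b) ^ (-s) = (-1) ^ s * (b ^ s)⁻¹ := by
  rw [neg_eq_neg_one_mul, mul_zpow, neg_one_zpow_neg, zpow_neg]

theorem neg_one_zpow_mul_self (s : ℤ) : (-1 : ℂ) ^ s * (-1) ^ s = 1 := by
  rw [← mul_zpow]
  norm_num

variable {ψ : Fin ν → ℤ → Module.End ℂ V} {X : Fin ν → Fin ν → ℂˣ → ℤ → Module.End ℂ V}

/-- A quadratic expression acts on the fermion modes linearly; the subtracted scalar drops out of
the commutator. -/
theorem quad_mode_comm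
    (hψ : ∀ i j p q v, ψ i p (ψ j q v) + ψ j q (ψ i p v) =
      (if i = j ∧ p + q = 0 then 2 * (-1 : ℂ) ^ q else 0) • v)
    (hX : ∀ i j (a : ℂˣ) n v, LocSum (fun q => (-(a : ℂ)) ^ (-q) • quad ψ i j (n - q) q v) (X i j a n v))
    (i j k : Fin ν) (a : ℂˣ) (m r : ℤ) (v : V) :
    X i j a m (ψ k r v) - ψ k r (X i j a m v) =
      (if j = k then 2 * (a : ℂ) ^ r else 0) • ψ i (m + r) v -
        (if i = k then 2 * (-1 : ℂ) ^ m * (a : ℂ) ^ (-m - r) else 0) • ψ j (m + r) v := by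
  have ha := a.ne_zero
  have h1 : LocSum (fun q => (-(a : ℂ)) ^ (-q) •
      (if j = k ∧ q + r = 0 then 2 * (-1 : ℂ) ^ r else 0) • ψ i (m - q) v)
      ((if j = k then 2 * (a : ℂ) ^ r else 0) • ψ i (m + r) v) := by
    refine (LocSum.single (-r) fun q hq => ?_).congr (fun q => rfl) ?_
    · rw [if_neg (fun h => hq (by omega)), zero_smul, smul_zero]
    · rw [smul_smul, sub_neg_eq_add]
      congr 1
      by_cases h : j = k
      · rw [if_pos h, if_pos ⟨h, by ring⟩, neg_zpow_neg]
        have := neg_one_zpow_mul_self r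
        rw [neg_one_zpow_neg, zpow_neg, inv_inv]
        linear_combination 2 * (a : ℂ) ^ r * this
      · simp [h]
  have h2 : LocSum (fun q => (-(a : ℂ)) ^ (-q) •
      (if i = k ∧ m - q + r = 0 then 2 * (-1 : ℂ) ^ r else 0) • ψ j q v)
      ((if i = k then 2 * (-1 : ℂ) ^ m * (a : ℂ) ^ (-m - r) else 0) • ψ j (m + r) v) := by
    refine (LocSum.single (m + r) fun q hq => ?_).congr (fun q => rfl) ?_
    · rw [if_neg (fun h => hq (by omega)), zero_smul, smul_zero]
    · rw [smul_smul]
      congr 1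
      by_cases h : i = k
      · rw [if_pos h, if_pos ⟨h, by ring⟩, neg_zpow_neg, ← zpow_neg,
          zpow_add₀ (by norm_num : (-1 : ℂ) ≠ 0), show -(m + r) = -m - r by ring]
        have := neg_one_zpow_mul_self r
        linear_combination 2 * (-1 : ℂ) ^ m * (a : ℂ) ^ (-m - r) * this
      · simp [h]
  refine ((hX i j a m (ψ k r v)).sub ((hX i j a m v).map (ψ k r))).unique
    ((h1.sub h2).congr (fun q => ?_) rfl)
  rw [map_smul, ← smul_sub, ← smul_sub]
  congr 1
  -- The identity [AB,C] = A{B,C} - {A,C}B.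
  have e1 := congrArg (ψ i (m - q)) (hψ j k q r v)
  have e2 := hψ i k (m - q) r (ψ j q v)
  rw [map_add, map_smul] at e1
  rw [quad, quad, map_sub, map_smul]
  linear_combination (norm := module) e2 - e1

/-- Commutation with X_ij is a derivation that sends each mode in X_kl to modes in directions i and
j, which gives four quadratic terms. Each must be put back into normal order to be summable on its
own; the scalars lost in doing so pair up into two anomalies. -/
theorem quad_comm
    (hψ : ∀ i j p q v, ψ i p (ψ j q v) + ψ j q (ψ i p v) =
      (if i = j ∧ p + q = 0 then 2 * (-1 : ℂ) ^ q else 0) • v)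
    (hX : ∀ i j (a : ℂˣ) n v, LocSum (fun q => (-(a : ℂ)) ^ (-q) • quad ψ i j (n - q) q v) (X i j a n v))
    (i j k l : Fin ν) (a b : ℂˣ) (m n : ℤ) (v : V) :
    X i j a m (X k l b n v) - X k l b n (X i j a m v) =
      (if j = k then 2 * (a : ℂ) ^ n else 0) • X i l (a * b) (m + n) v -
      (if i = k then 2 * (-1) ^ m * (a : ℂ) ^ (-m - n) else 0) • X j l (b * a⁻¹) (m + n) v +
      (if j = l then 2 * (-1) ^ m * (a : ℂ) ^ (-m) * (b : ℂ) ^ m else 0) •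
        X k i (b * a⁻¹) (m + n) v -
      (if i = l then 2 * (b : ℂ) ^ m else 0) • X k j (a * b) (m + n) v +
      (if m + n = 0 then
        (if j = k ∧ i = l then 2 * (a : ℂ) ^ n * anomaly (a * b) n else 0) -
        (if i = k ∧ j = l then 2 * (-1) ^ m * anomaly (b * (a : ℂ)⁻¹) n else 0) else 0) • v := by
  have ha := a.ne_zero
  have hb := b.ne_zero
  have hn1 : (-1 : ℂ) ≠ 0 := by norm_num
  have hcomm := quad_mode_comm hψ hX i j
  have t0 := ((hX k l b n v).map (X i j a m)).sub (hX k l b n (X i j a m v))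
  have t1 := (hX i l (a * b) (m + n) v).smul (if j = k then 2 * (a : ℂ) ^ n else 0)
  have t2 := (hX j l (b * a⁻¹) (m + n) v).smul
    (if i = k then 2 * (-1) ^ m * (a : ℂ) ^ (-m - n) else 0)
  -- In the last two sums it is the right-hand mode s that becomes m + s, hence the shift by m.
  have t3 := ((hX k i (b * a⁻¹) (m + n) v).shift m).smul
    (if j = l then 2 * (-1) ^ m * (a : ℂ) ^ (-m) * (b : ℂ) ^ m else 0)
  have t4 := ((hX k j (a * b) (m + n) v).shift m).smul (if i = l then 2 * (b : ℂ) ^ m else 0)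
  have t5 := (locSum_anomaly (mul_ne_zero ha hb) n v).smul
    (if m + n = 0 ∧ j = k ∧ i = l then 2 * (a : ℂ) ^ n else 0)
  have t6 := (locSum_anomaly (mul_ne_zero hb (inv_ne_zero ha)) n v).smul
    (if m + n = 0 ∧ i = k ∧ j = l then 2 * (-1 : ℂ) ^ m else 0)
  refine t0.unique (((((t1.sub t2).add t3).sub t4).add (t5.sub t6)).congr (fun s => ?_) ?_)
  · have e1 := hcomm k a m (n - s) (ψ l s v)
    have e2 := congrArg (ψ k (n - s)) (hcomm l a m s v)
    rw [map_sub, map_sub, map_smul, map_smul] at e2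
    have c1 : (-(b : ℂ)) ^ (-s) * (if j = k then 2 * (a : ℂ) ^ (n - s) else 0) =
        (if j = k then 2 * (a : ℂ) ^ n else 0) * (-((a * b : ℂˣ) : ℂ)) ^ (-s) := by
      split_ifs
      · rw [neg_zpow_neg, neg_zpow_neg, Units.val_mul, mul_zpow, zpow_sub₀ ha]
        field_simp
      · ring
    have c2 : (-(b : ℂ)) ^ (-s) *
        (if i = k then 2 * (-1 : ℂ) ^ m * (a : ℂ) ^ (-m - (n - s)) else 0) =
        (if i = k then 2 * (-1 : ℂ) ^ m * (a : ℂ) ^ (-m - n) else 0) *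
          (-((b * a⁻¹ : ℂˣ) : ℂ)) ^ (-s) := by
      split_ifs
      · rw [neg_zpow_neg, neg_zpow_neg, Units.val_mul, Units.val_inv_eq_inv_val, mul_zpow,
          inv_zpow, show -m - (n - s) = -m - n + s by ring, zpow_add₀ ha]
        field_simp
      · ring
    have c3 : (-(b : ℂ)) ^ (-s) * (if j = l then 2 * (a : ℂ) ^ s else 0) =
        (if j = l then 2 * (-1 : ℂ) ^ m * (a : ℂ) ^ (-m) * (b : ℂ) ^ m else 0) *
          (-((b * a⁻¹ : ℂˣ) : ℂ)) ^ (-(m + s)) := by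
      split_ifs
      · rw [neg_zpow_neg, neg_zpow_neg, Units.val_mul, Units.val_inv_eq_inv_val, mul_zpow,
          inv_zpow, zpow_add₀ ha, zpow_add₀ hb, zpow_add₀ hn1, zpow_neg]
        have := neg_one_zpow_mul_self m
        field_simp
        linear_combination -this
      · ring
    have c4 : (-(b : ℂ)) ^ (-s) * (if i = l then 2 * (-1 : ℂ) ^ m * (a : ℂ) ^ (-m - s) else 0) =
        (if i = l then 2 * (b : ℂ) ^ m else 0) * (-((a * b : ℂˣ) : ℂ)) ^ (-(m + s)) := by
      split_ifs
      · rw [neg_zpow_neg, neg_zpow_neg, Units.val_mul, mul_zpow, zpow_add₀ ha, zpow_add₀ hb,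
          zpow_add₀ hn1, show -m - s = -(m + s) by ring, zpow_neg, zpow_add₀ ha]
        field_simp
      · ring
    -- Vacuum expectations of the first and fourth sums, with parameter ab. They enter at indices
    -- differing by n, so the difference is a term of `locSum_anomaly`. The second and third sums
    -- behave the same way, with parameter b/a.
    have k1 : (if j = k then 2 * (a : ℂ) ^ n else 0) * (-((a * b : ℂˣ) : ℂ)) ^ (-s) *
          (if i = l ∧ m + n - s + s = 0 then contr i i (m + n - s) else 0) -
        (if i = l then 2 * (b : ℂ) ^ m else 0) * (-((a * b : ℂˣ) : ℂ)) ^ (-(m + s)) *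
          (if k = j ∧ n - s + (m + s) = 0 then contr k k (n - s) else 0) =
        (if m + n = 0 ∧ j = k ∧ i = l then 2 * (a : ℂ) ^ n else 0) *
          (((a : ℂ) * b) ^ (-s) * (kap (-s) - kap (n - s))) := by
      rw [← c1, ← c4, show m + n - s + s = m + n by ring, show n - s + (m + s) = m + n by ring]
      by_cases h : m + n = 0
      · obtain rfl : m = -n := by omega
        by_cases h1 : j = k
        · by_cases h2 : i = l
          · rw [if_pos h1, if_pos h2, if_pos ⟨h2, h⟩, if_pos ⟨h1.symm, h⟩, if_pos ⟨h, h1, h2⟩, h,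
              zero_sub, contr_self, contr_self, neg_zpow_neg, neg_one_zpow_neg, neg_one_zpow_neg,
              zpow_neg ((a : ℂ) * b), mul_zpow, neg_neg, zpow_sub₀ hn1, zpow_sub₀ ha]
            have e1 := neg_one_zpow_mul_self s
            have e2 := neg_one_zpow_mul_self n
            have e3 : (-1 : ℂ) ^ s ≠ 0 := zpow_ne_zero _ hn1
            field_simp
            linear_combination kap (-s) * e1 - kap (n - s) * e2
          · simp [h2]
        · simp [h1, Ne.symm h1]
      · simp [h]
    have k2 : (if i = k then 2 * (-1 : ℂ) ^ m * (a : ℂ) ^ (-m - n) else 0) *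
          (-((b * a⁻¹ : ℂˣ) : ℂ)) ^ (-s) *
          (if j = l ∧ m + n - s + s = 0 then contr j j (m + n - s) else 0) -
        (if j = l then 2 * (-1 : ℂ) ^ m * (a : ℂ) ^ (-m) * (b : ℂ) ^ m else 0) *
          (-((b * a⁻¹ : ℂˣ) : ℂ)) ^ (-(m + s)) *
          (if k = i ∧ n - s + (m + s) = 0 then contr k k (n - s) else 0) =
        (if m + n = 0 ∧ i = k ∧ j = l then 2 * (-1 : ℂ) ^ m else 0) *
          (((b : ℂ) * (a : ℂ)⁻¹) ^ (-s) * (kap (-s) - kap (n - s))) := by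
      rw [← c2, ← c3, show m + n - s + s = m + n by ring, show n - s + (m + s) = m + n by ring]
      by_cases h : m + n = 0
      · obtain rfl : m = -n := by omega
        by_cases h1 : i = k
        · by_cases h2 : j = l
          · rw [if_pos h1, if_pos h2, if_pos ⟨h2, h⟩, if_pos ⟨h1.symm, h⟩, if_pos ⟨h, h1, h2⟩, h,
              zero_sub, contr_self, contr_self, neg_zpow_neg, neg_one_zpow_neg, neg_one_zpow_neg,
              zpow_neg ((b : ℂ) * _), mul_zpow, inv_zpow, show - -n - (n - s) = s by ring,
              zpow_sub₀ hn1]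
            have e1 := neg_one_zpow_mul_self s
            have e3 : (-1 : ℂ) ^ s ≠ 0 := zpow_ne_zero _ hn1
            field_simp
            linear_combination kap (-s) * e1
          · simp [h2]
        · simp [h1, Ne.symm h1]
      · simp [h]
    simp only [quad, map_smul, map_sub]
    rw [show m + (n - s) = m + n - s by ring] at e1
    rw [show m + n - (s + m) = n - s by ring, add_comm s m]
    linear_combination (norm := module) -(-(b : ℂ)) ^ (-s) • e1 - (-(b : ℂ)) ^ (-s) • e2 -
      c1 • ψ i (m + n - s) (ψ l s v) + c2 • ψ j (m + n - s) (ψ l s v) -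
      c3 • ψ k (n - s) (ψ i (m + s) v) + c4 • ψ k (n - s) (ψ j (m + s) v) - k1 • v + k2 • v
  · congr 1
    rw [smul_smul, smul_smul, ← sub_smul]
    congr 1
    by_cases h : m + n = 0
    · simp only [h, true_and, if_true, ite_mul, zero_mul]
    · simp [h]

end Quadratic

/-! ### The Clifford generators in the twisted group algebra -/

section Clifford

variable {ν : ℕ}

theorem TwistedAlg.hom_ext {N : Type*} [AddCommMonoid N] [Module ℂ N] {f g : TwistedAlg ν →ₗ[ℂ] N}
    (h : ∀ a, f (TwistedAlg.exp a) = g (TwistedAlg.exp a)) : f = g :=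
  Finsupp.lhom_ext' fun a => LinearMap.ext_ring (h a)

theorem signCocycle_add_left (a b c : Fin ν → ZMod 2) :
    signCocycle (a + b) c = signCocycle a c * signCocycle b c := by
  simp only [signCocycle, Pi.add_apply, add_mul, uzpow_add, Finset.prod_mul_distrib]

theorem signCocycle_add_right (a b c : Fin ν → ZMod 2) :
    signCocycle a (b + c) = signCocycle a b * signCocycle a c := by
  simp only [signCocycle, Pi.add_apply, mul_add, uzpow_add, Finset.prod_mul_distrib]

theorem reduce_add (α β : Fin ν → ℤ) : reduce (α + β) = reduce α + reduce β := by
  ext i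
  simp [reduce]

theorem reduce_neg (α : Fin ν → ℤ) : reduce (-α) = reduce α := by
  ext1 i
  simp only [reduce, Pi.neg_apply, Int.cast_neg]
  exact ZMod.neg_eq_self_mod_two _

theorem expOp_exp (α : Fin ν → ℤ) (b : Fin ν → ZMod 2) : expOp α (TwistedAlg.exp b) =
    ((signCocycle (reduce α) b : ℤ) : ℂ) • TwistedAlg.exp (reduce α + b) :=
  TwistedAlg.twistedMul_exp _ _

theorem expOp_mul (α β : Fin ν → ℤ) :
    expOp α * expOp β = ((latticeCocycle α β : ℤ) : ℂ) • expOp (α + β) := by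
  refine TwistedAlg.hom_ext fun c => ?_
  rw [Module.End.mul_apply, LinearMap.smul_apply, expOp_exp, map_smul, expOp_exp, expOp_exp,
    smul_smul, smul_smul, reduce_add, add_assoc, ← signCocycle_reduce, signCocycle_add_left,
    signCocycle_add_right]
  congr 1
  push_cast
  ring

theorem expOp_zero : expOp (0 : Fin ν → ℤ) = 1 := by
  refine TwistedAlg.hom_ext fun c => ?_
  have h : reduce (0 : Fin ν → ℤ) = 0 := by
    ext i
    simp [reduce]
  rw [expOp_exp, h, zero_add, Module.End.one_apply]
  simp [signCocycle]

theorem expOp_congr {α β : Fin ν → ℤ} (h : reduce α = reduce β) : expOp α = expOp β := by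
  rw [expOp, expOp, h]

theorem latticeCocycle_basisVec (i j : Fin ν) :
    latticeCocycle (basisVec i) (basisVec j) = sign₀ i j := by
  rw [latticeCocycle, Finset.prod_eq_single i, Finset.prod_eq_single j]
  · simp [basisVec]
  · intro k _ hk
    simp [basisVec, hk]
  · simp
  · intro k _ hk
    simp [basisVec, hk]
  · simp

/-- The operator of left multiplication by `e^{ε_i}`. -/
def cliff (i : Fin ν) : Module.End ℂ (TwistedAlg ν) := expOp (basisVec i)

/-- Modulo 2 the lattice vectors ε_i + ε_j and ε_i - ε_j coincide, so the group algebra factor of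
X_ij, with its sign, is a product of Clifford generators. -/
theorem cliff_mul_cliff (i j : Fin ν) : cliff i * cliff j =
    ((latticeCocycle (basisVec i) (basisVec j) : ℤ) : ℂ) • expOp (basisVec i - basisVec j) := by
  rw [cliff, cliff, expOp_mul, sub_eq_add_neg]
  congr 1
  exact expOp_congr (by rw [reduce_add, reduce_add, reduce_neg])

theorem cliff_mul_self (i : Fin ν) : cliff i * cliff i = 1 := by
  rw [cliff_mul_cliff, sub_self, expOp_zero, latticeCocycle_basisVec]
  simp [sign₀]

theorem cliff_anticomm {i j : Fin ν} (h : i ≠ j) : cliff i * cliff j = -(cliff j * cliff i) := by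
  have h1 : expOp (basisVec i - basisVec j) = expOp (basisVec j - basisVec i) :=
    expOp_congr (by rw [← neg_sub, reduce_neg])
  have h2 : sign₀ i j = -sign₀ j i := by
    unfold sign₀
    rcases lt_or_gt_of_ne h with h | h
    · rw [if_pos h.le, if_neg (not_le.2 h), neg_neg]
    · rw [if_neg (not_le.2 h), if_pos h.le]
  rw [cliff_mul_cliff, cliff_mul_cliff, h1, latticeCocycle_basisVec, latticeCocycle_basisVec, h2,
    ← neg_smul]
  simp

end Clifford

/-! ### The fermions on the Fock space -/

section FockFermions

variable {ν : ℕ}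

/-- The modes of the fermionic field `e^{ε_i} E_-(ε_i, z) E_+(ε_i, z)` on the Fock space. -/
def fockFermi (i : Fin ν) (p : ℤ) : Module.End ℂ (Fock ν) :=
  TensorProduct.map (cliff i) (fermi i p)

theorem fockFermi_tmul (i : Fin ν) (p : ℤ) (t : TwistedAlg ν) (w : SymPoly ν) :
    fockFermi i p (t ⊗ₜ w) = cliff i t ⊗ₜ fermi i p w := rfl

/-- For i = j the Clifford factor squares to 1 and the anticommutator is that of the polynomial
part; for i ≠ j the polynomial parts commute and the Clifford factors supply the sign. -/
theorem fockFermi_anticomm (i j : Fin ν) (p q : ℤ) (v : Fock ν) :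
    fockFermi i p (fockFermi j q v) + fockFermi j q (fockFermi i p v) =
      (if i = j ∧ p + q = 0 then 2 * (-1 : ℂ) ^ q else 0) • v := by
  induction v using TensorProduct.induction_on with
  | zero => simp only [map_zero, add_zero, smul_zero]
  | add x y hx hy =>
    simp only [map_add, smul_add]
    rw [← hx, ← hy]
    abel
  | tmul t w =>
    simp only [fockFermi_tmul]
    by_cases h : i = j
    · subst h
      have h1 := LinearMap.congr_fun (cliff_mul_self i) t
      rw [Module.End.mul_apply, Module.End.one_apply] at h1
      rw [h1, ← TensorProduct.tmul_add, fermi_anticomm, TensorProduct.tmul_smul]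
      simp only [true_and]
    · have h1 := LinearMap.congr_fun (cliff_anticomm h) t
      rw [LinearMap.neg_apply, Module.End.mul_apply, Module.End.mul_apply] at h1
      rw [h1, fermi_comm_of_ne h, TensorProduct.neg_tmul, neg_add_cancel,
        if_neg (fun h' => h h'.1), zero_smul]

theorem quad_add (i j : Fin ν) (p q : ℤ) (x y : Fock ν) :
    quad fockFermi i j p q (x + y) = quad fockFermi i j p q x + quad fockFermi i j p q y := by
  simp only [quad, map_add, smul_add]
  abel

theorem quad_tmul_self (i : Fin ν) (p q : ℤ) (t : TwistedAlg ν) (w : SymPoly ν) :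
    quad fockFermi i i p q (t ⊗ₜ w) = t ⊗ₜ fermiQuad i p q w := by
  have h1 := LinearMap.congr_fun (cliff_mul_self i) t
  rw [Module.End.mul_apply, Module.End.one_apply] at h1
  rw [quad, fockFermi_tmul, fockFermi_tmul, h1, fermiQuad, TensorProduct.tmul_sub,
    TensorProduct.tmul_smul]
  simp only [true_and]

theorem quad_tmul_of_ne {i j : Fin ν} (h : i ≠ j) (p q : ℤ) (t : TwistedAlg ν) (w : SymPoly ν) :
    quad fockFermi i j p q (t ⊗ₜ w) = cliff i (cliff j t) ⊗ₜ fermiNormal i j p q w := by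
  rw [quad, fockFermi_tmul, fockFermi_tmul, if_neg (fun h' => h h'.1), zero_smul, sub_zero,
    fermi_fermi_of_ne h]

theorem LocSum.tmul {ι : Type*} {f : ι → SymPoly ν} {a : SymPoly ν} (h : LocSum f a)
    (t : TwistedAlg ν) : LocSum (fun x => (t ⊗ₜ[ℂ] f x : Fock ν)) (t ⊗ₜ a) :=
  h.map (TensorProduct.mk ℂ (TwistedAlg ν) (SymPoly ν) t)

theorem vertexMode_tmul_of_ne {i j : Fin ν} (h : i ≠ j) (a : ℂˣ) (n : ℤ) (t : TwistedAlg ν)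
    (w : SymPoly ν) :
    vertexMode i j a n (t ⊗ₜ w) = cliff i (cliff j t) ⊗ₜ symMode i j a n w := by
  have h1 := LinearMap.congr_fun (cliff_mul_cliff i j) t
  rw [Module.End.mul_apply, LinearMap.smul_apply] at h1
  rw [vertexMode, if_neg h, LinearMap.smul_apply, TensorProduct.map_tmul, h1,
    TensorProduct.smul_tmul']

theorem vertexMode_tmul_one (i : Fin ν) (n : ℤ) (t : TwistedAlg ν) (w : SymPoly ν) :
    vertexMode i i 1 n (t ⊗ₜ w) = t ⊗ₜ ((4 : ℂ) • heis i n w) := by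
  rw [vertexMode, if_pos rfl, if_pos rfl, LinearMap.smul_apply, LinearMap.lTensor_tmul,
    TensorProduct.tmul_smul]

theorem vertexMode_tmul_self (i : Fin ν) {a : ℂˣ} (ha : a ≠ 1) (n : ℤ) (t : TwistedAlg ν)
    (w : SymPoly ν) :
    vertexMode i i a n (t ⊗ₜ w) = t ⊗ₜ (((1 + (a : ℂ)) / (1 - (a : ℂ))) •
      (symMode i i a n w - (if n = 0 then (1 : ℂ) else 0) • w)) := by
  rw [vertexMode, if_pos rfl, if_neg ha, LinearMap.smul_apply, LinearMap.sub_apply,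
    LinearMap.lTensor_tmul, TensorProduct.tmul_smul, TensorProduct.tmul_sub]
  congr 2
  split_ifs
  · rw [one_smul, Module.End.one_apply]
  · rw [zero_smul, LinearMap.zero_apply, TensorProduct.tmul_zero]

/-- The three cases of the vertex operators meet in one quadratic formula; from here on their
definition is used only through it. -/
theorem locSum_vertexMode (i j : Fin ν) (a : ℂˣ) (n : ℤ) (v : Fock ν) :
    LocSum (fun q => (-(a : ℂ)) ^ (-q) • quad fockFermi i j (n - q) q v)
      (vertexMode i j a n v) := by
  induction v using TensorProduct.induction_on with
  | zero => exact LocSum.zero.congr (fun q => by simp [quad]) (map_zero _).symm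
  | add x y hx hy =>
    refine (hx.add hy).congr (fun q => ?_) (map_add _ _ _).symm
    rw [quad_add, smul_add]
  | tmul t w =>
    by_cases h : i = j
    · subst h
      by_cases ha : a = 1
      · subst ha
        refine ((locSum_fermiQuad_one i n w).tmul t).congr (fun q => ?_)
          (vertexMode_tmul_one i n t w).symm
        rw [quad_tmul_self, TensorProduct.tmul_smul, Units.val_one]
      · refine ((locSum_fermiQuad_of_ne_one i a ha n w).tmul t).congr (fun q => ?_)
          (vertexMode_tmul_self i ha n t w).symm
        rw [quad_tmul_self, TensorProduct.tmul_smul]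
    · refine ((locSum_symMode i j a n w).tmul _).congr (fun q => ?_)
        (vertexMode_tmul_of_ne h a n t w).symm
      rw [quad_tmul_of_ne h, TensorProduct.tmul_smul]

end FockFermions

/-! ### Commutators of the vertex operators -/

section Vertex

variable {ν : ℕ}

theorem quad_fockFermi_swap (i j : Fin ν) (p q : ℤ) (v : Fock ν) :
    quad fockFermi i j p q v = -quad fockFermi j i q p v := by
  have h1 := fockFermi_anticomm i j p q v
  have h2 : (if i = j ∧ p + q = 0 then 2 * (-1 : ℂ) ^ q else 0) =
      (if i = j ∧ p + q = 0 then contr i i p else 0) +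
        (if j = i ∧ q + p = 0 then contr j j q else 0) := by
    by_cases h : i = j ∧ p + q = 0
    · obtain ⟨rfl, hpq⟩ := h
      obtain rfl : p = -q := by omega
      simp only [neg_add_cancel, add_neg_cancel, and_self, if_true]
      rw [add_comm, contr_add_contr_neg]
    · rw [if_neg h, if_neg h, if_neg (fun h' => h ⟨h'.1.symm, by omega⟩), add_zero]
  rw [h2] at h1
  rw [quad, quad]
  linear_combination (norm := module) h1

/-- Antisymmetry of the fermionic normal product, after exchanging q and m - q. The factor is the
one by which the anti-involution acts on t^m e^α. -/
theorem vertexMode_symm (i j : Fin ν) (a : ℂˣ) (m : ℤ) :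
    vertexMode i j a m = -((-(a : ℂ)) ^ (-m) • vertexMode j i a⁻¹ m) := by
  refine LinearMap.ext fun v => ?_
  rw [LinearMap.neg_apply, LinearMap.smul_apply, ← neg_smul]
  have ha : -(a : ℂ) ≠ 0 := neg_ne_zero.2 a.ne_zero
  refine (locSum_vertexMode i j a m v).unique
    ((((locSum_vertexMode j i a⁻¹ m v).reindex (Equiv.subLeft m)).smul
      (-(-(a : ℂ)) ^ (-m))).congr (fun q => ?_) rfl)
  rw [Equiv.subLeft_apply, quad_fockFermi_swap j i, sub_sub_cancel, Units.val_inv_eq_inv_val,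
    ← inv_neg, inv_zpow', neg_neg, smul_neg, smul_neg, neg_smul, neg_neg, smul_smul,
    ← zpow_add₀ ha]
  congr 2
  ring

/-- The constant by which the image of `2 e_{ij}(m, α)` differs from the vertex operator. -/
def modeConst (i j : Fin ν) (a : ℂˣ) (m : ℤ) : ℂ :=
  open Classical in if i = j ∧ a ≠ 1 ∧ m = 0 then (1 + (a : ℂ)) / (1 - (a : ℂ)) else 0

/-- The image of `2 e_{ij}(m, α)`, with `a = σ(α)`. -/
def fullMode (i j : Fin ν) (a : ℂˣ) (m : ℤ) : Module.End ℂ (Fock ν) :=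
  vertexMode i j a m + modeConst i j a m • (1 : Module.End ℂ (Fock ν))

theorem fullMode_apply (i j : Fin ν) (a : ℂˣ) (m : ℤ) (v : Fock ν) :
    fullMode i j a m v = vertexMode i j a m v + modeConst i j a m • v := rfl

theorem modeConst_symm (i j : Fin ν) (a : ℂˣ) (m : ℤ) :
    modeConst i j a m = -((-(a : ℂ)) ^ (-m) * modeConst j i a⁻¹ m) := by
  unfold modeConst
  by_cases h : i = j ∧ a ≠ 1 ∧ m = 0
  · have ha := a.ne_zero
    have h1 : 1 - (a : ℂ) ≠ 0 := fun h0 => h.2.1 (Units.ext (sub_eq_zero.1 h0).symm)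
    have h2 : (a : ℂ) - 1 ≠ 0 := fun h0 => h1 (by linear_combination -h0)
    rw [if_pos h, if_pos ⟨h.1.symm, inv_ne_one.2 h.2.1, h.2.2⟩, h.2.2, neg_zero, zpow_zero, one_mul,
      Units.val_inv_eq_inv_val]
    have h3 : 1 - (a : ℂ)⁻¹ = ((a : ℂ) - 1) / a := by field_simp
    have h4 : 1 + (a : ℂ)⁻¹ = ((a : ℂ) + 1) / a := by field_simp
    rw [h3, h4]
    field_simp
    ring
  · rw [if_neg h, if_neg (fun h' => h ⟨h'.1.symm, inv_ne_one.1 h'.2.1, h'.2.2⟩)]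
    ring

theorem fullMode_symm (i j : Fin ν) (a : ℂˣ) (m : ℤ) :
    fullMode i j a m = -((-(a : ℂ)) ^ (-m) • fullMode j i a⁻¹ m) := by
  rw [fullMode, fullMode, vertexMode_symm, modeConst_symm, smul_add, smul_smul, neg_add]
  module

-- The constants in `fullMode` are chosen to absorb the anomaly away from parameter 1, where it has
-- the form (1+c)/(1-c)(1 - c^{-n}); at parameter 1 its value -2n is left over and is the central
-- term.
open Classical in
theorem fullMode_comm (i j k l : Fin ν) (a b : ℂˣ) (m n : ℤ) :
    fullMode i j a m * fullMode k l b n - fullMode k l b n * fullMode i j a m =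
      (if j = k then 2 * (a : ℂ) ^ n else 0) • fullMode i l (a * b) (m + n) -
      (if i = k then 2 * (-1 : ℂ) ^ m * (a : ℂ) ^ (-m - n) else 0) • fullMode j l (b * a⁻¹) (m + n) +
      (if j = l then 2 * (-1 : ℂ) ^ m * (a : ℂ) ^ (-m) * (b : ℂ) ^ m else 0) •
        fullMode k i (b * a⁻¹) (m + n) -
      (if i = l then 2 * (b : ℂ) ^ m else 0) • fullMode k j (a * b) (m + n) +
      ((if i = l ∧ j = k ∧ m + n = 0 ∧ a * b = 1 then 4 * (m : ℂ) * (a : ℂ) ^ n else 0) -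
        (if i = k ∧ j = l ∧ m + n = 0 ∧ b * a⁻¹ = 1 then 4 * (m : ℂ) * (-1 : ℂ) ^ m else 0)) •
          (1 : Module.End ℂ (Fock ν)) := by
  have ha := a.ne_zero
  have hb := b.ne_zero
  -- For m = -n the two coefficients are 2a^n and 2b^{-n} = 2a^n(ab)^{-n}, so their difference
  -- reproduces the factor 1 - c^{-n} with c = ab.
  have h1 : (if j = k then 2 * (a : ℂ) ^ n else 0) * modeConst i l (a * b) (m + n) -
      (if i = l then 2 * (b : ℂ) ^ m else 0) * modeConst k j (a * b) (m + n) +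
      (if i = l ∧ j = k ∧ m + n = 0 ∧ a * b = 1 then 4 * (m : ℂ) * (a : ℂ) ^ n else 0) =
      if m + n = 0 then
        (if j = k ∧ i = l then 2 * (a : ℂ) ^ n * anomaly (a * b) n else 0) else 0 := by
    unfold modeConst anomaly
    by_cases h : m + n = 0
    · obtain rfl : m = -n := by omega
      by_cases hjk : j = k
      · by_cases hil : i = l
        · subst hjk hil
          have e : ((a : ℂ) * b = 1) ↔ a * b = 1 := by
            rw [← Units.val_mul, Units.val_eq_one]
          by_cases hab : a * b = 1
          · simp only [e, hab, neg_add_cancel, and_self, if_true, ne_eq, not_true, false_and,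
              and_false, if_false]
            push_cast
            ring
          · simp only [e, hab, neg_add_cancel, and_self, if_true, ne_eq, not_false_eq_true,
              and_false, if_false]
            rw [zpow_neg, zpow_neg, Units.val_mul, mul_zpow]
            field_simp
            ring
        · simp [hil]
      · simp [hjk, Ne.symm hjk]
    · simp [h]
  have h2 : (if i = k then 2 * (-1 : ℂ) ^ m * (a : ℂ) ^ (-m - n) else 0) *
        modeConst j l (b * a⁻¹) (m + n) -
      (if j = l then 2 * (-1 : ℂ) ^ m * (a : ℂ) ^ (-m) * (b : ℂ) ^ m else 0) *
        modeConst k i (b * a⁻¹) (m + n) +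
      (if i = k ∧ j = l ∧ m + n = 0 ∧ b * a⁻¹ = 1 then 4 * (m : ℂ) * (-1 : ℂ) ^ m else 0) =
      if m + n = 0 then
        (if i = k ∧ j = l then 2 * (-1 : ℂ) ^ m * anomaly (b * (a : ℂ)⁻¹) n else 0) else 0 := by
    unfold modeConst anomaly
    by_cases h : m + n = 0
    · obtain rfl : m = -n := by omega
      by_cases hik : i = k
      · by_cases hjl : j = l
        · subst hik hjl
          have e : ((b : ℂ) * (a : ℂ)⁻¹ = 1) ↔ b * a⁻¹ = 1 := by
            rw [← Units.val_inv_eq_inv_val, ← Units.val_mul, Units.val_eq_one]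
          by_cases hab : b * a⁻¹ = 1
          · simp only [e, hab, neg_add_cancel, and_self, if_true, ne_eq, not_true, false_and,
              and_false, if_false]
            push_cast
            ring
          · simp only [e, hab, neg_add_cancel, and_self, if_true, ne_eq, not_false_eq_true,
              and_false, if_false]
            rw [neg_neg, sub_self, zpow_zero, zpow_neg (b : ℂ), zpow_neg ((b : ℂ) * _), Units.val_mul,
              Units.val_inv_eq_inv_val, mul_zpow, inv_zpow]
            field_simp
            ring
        · simp [hjl]
      · simp [hik, Ne.symm hik]
    · simp [h]
  refine LinearMap.ext fun v => ?_
  have h3 := quad_comm fockFermi_anticomm locSum_vertexMode i j k l a b m n v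
  have h4 : (if m + n = 0 then
        (if j = k ∧ i = l then 2 * (a : ℂ) ^ n * anomaly (a * b) n else 0) -
        (if i = k ∧ j = l then 2 * (-1 : ℂ) ^ m * anomaly (b * (a : ℂ)⁻¹) n else 0) else 0) =
      (if m + n = 0 then
        (if j = k ∧ i = l then 2 * (a : ℂ) ^ n * anomaly (a * b) n else 0) else 0) -
      if m + n = 0 then
        (if i = k ∧ j = l then 2 * (-1 : ℂ) ^ m * anomaly (b * (a : ℂ)⁻¹) n else 0) else 0 := by
    split_ifs <;> simp
  rw [h4, ← h1, ← h2] at h3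
  simp only [LinearMap.sub_apply, LinearMap.add_apply, LinearMap.smul_apply, Module.End.mul_apply,
    Module.End.one_apply, fullMode_apply, map_add, map_smul]
  linear_combination (norm := module) h3

end Vertex

/-! ### The representation -/

section Representation

variable {ν : ℕ} {G : Type*} [AddCommGroup G] {σ : AddChar G ℂˣ}

open SkewLaurent

theorem matAlg_induction {P : MatAlg ν σ → Prop} (X : MatAlg ν σ) (h0 : P 0)
    (hs : ∀ i j m α, P (Matrix.single i j (mono σ m α)))
    (hadd : ∀ X Y, P X → P Y → P (X + Y)) (hsmul : ∀ (c : ℂ) X, P X → P (c • X)) : P X := by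
  refine Matrix.induction_on' X h0 hadd fun i j x => ?_
  induction x using mono_induction with
  | h0 => rwa [Matrix.single_zero]
  | hm m α => exact hs i j m α
  | hadd x y hx hy => rw [Matrix.single_add]; exact hadd _ _ hx hy
  | hsmul c x hx => rw [← Matrix.smul_single]; exact hsmul c _ hx

variable (ν σ)

/-- The operator attached to `x` in the matrix position `(i, j)`. -/
def entryOp (i j : Fin ν) : SkewLaurent σ →ₗ[ℂ] Module.End ℂ (Fock ν) :=
  lift σ fun m α => fullMode i j (σ α) m

/-- The linear map `E_{ij} t^m e^α ↦ (x_{ij}(σ(α), m) + const) / 4`. -/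
def matOp : MatAlg ν σ →ₗ[ℂ] Module.End ℂ (Fock ν) :=
  (1 / 4 : ℂ) • ∑ i, ∑ j, entryOp ν σ i j ∘ₗ Matrix.entryLinearMap ℂ (SkewLaurent σ) i j

/-- The map `X ↦ X - X^*`. -/
def skewPart : MatAlg ν σ →ₗ[ℂ] MatAlg ν σ where
  toFun X := X - conj X
  map_add' X Y := by rw [conj_add]; abel
  map_smul' c X := by rw [conj_smul, RingHom.id_apply, smul_sub]

variable {ν σ}

theorem entryOp_mono (i j : Fin ν) (m : ℤ) (α : G) :
    entryOp ν σ i j (mono σ m α) = fullMode i j (σ α) m := by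
  simp [entryOp]

/-- Hence `matOp` changes sign under X ↦ X^*, so on X - X^* it takes twice its value on X. -/
theorem entryOp_bar (i j : Fin ν) (x : SkewLaurent σ) :
    entryOp ν σ i j (bar σ x) = -entryOp ν σ j i x := by
  induction x using mono_induction with
  | h0 => simp
  | hadd x y hx hy => rw [map_add, map_add, map_add, hx, hy, neg_add]
  | hsmul c x hx => rw [map_smul, map_smul, map_smul, hx, smul_neg]
  | hm m α =>
    rw [bar_mono, map_smul, entryOp_mono, entryOp_mono, fullMode_symm j i, neg_neg,
      AddChar.map_neg_eq_inv]
    push_cast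
    rfl

theorem matOp_single (i j : Fin ν) (x : SkewLaurent σ) :
    matOp ν σ (Matrix.single i j x) = (1 / 4 : ℂ) • entryOp ν σ i j x := by
  rw [matOp, LinearMap.smul_apply, LinearMap.sum_apply, Finset.sum_eq_single i,
    LinearMap.sum_apply, Finset.sum_eq_single j]
  · simp
  · intro k _ hk
    simp [hk.symm]
  · simp
  · intro k _ hk
    simp [hk.symm]
  · simp

theorem matOp_single_mul_single (i j k l : Fin ν) (x y : SkewLaurent σ) :
    matOp ν σ (Matrix.single i j x * Matrix.single k l y) =
      (if j = k then (1 / 4 : ℂ) else 0) • entryOp ν σ i l (x * y) := by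
  split_ifs with h
  · subst h
    rw [Matrix.single_mul_single_same, matOp_single]
  · rw [Matrix.single_mul_single_of_ne (h := h), map_zero, zero_smul]

theorem cocycle_single (i j k l : Fin ν) (x y : SkewLaurent σ) :
    cocycle ν σ (Matrix.single i j x) (Matrix.single k l y) =
      if i = l ∧ j = k then form σ x y else 0 := by
  rw [cocycle_apply]
  simp only [Matrix.single_apply]
  rw [Finset.sum_eq_single i, Finset.sum_eq_single j]
  · by_cases h1 : i = l <;> by_cases h2 : j = k <;> simp [h1, h2, eq_comm]
  · intro b _ hb
    simp [hb.symm]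
  · simp
  · intro b _ hb
    simp [hb.symm]
  · simp

theorem skewPart_apply (X : MatAlg ν σ) : skewPart ν σ X = X - conj X := rfl

theorem conj_single (i j : Fin ν) (x : SkewLaurent σ) :
    conj (Matrix.single i j x) = Matrix.single j i (bar σ x) := by
  rw [conj, Matrix.map_single, Matrix.transpose_single]

theorem conj_conj (X : MatAlg ν σ) : conj (conj X) = X := by
  ext1 i j
  rw [conj_apply, conj_apply, bar_bar]

theorem skewPart_single (i j : Fin ν) (m : ℤ) (α : G) :
    skewPart ν σ (Matrix.single i j (mono σ m α)) = eMat σ i j m α := by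
  rw [skewPart_apply, conj_single, eMat]

theorem skewPart_mem (X : MatAlg ν σ) : skewPart ν σ X ∈ unitary ν σ := by
  change conj _ = -_
  rw [skewPart_apply, conj_sub, conj_conj, neg_sub]

theorem skewPart_of_mem {X : MatAlg ν σ} (h : X ∈ unitary ν σ) :
    (1 / 2 : ℂ) • skewPart ν σ X = X := by
  change conj X = -X at h
  rw [skewPart_apply, h]
  module

theorem matOp_eMat (i j : Fin ν) (m : ℤ) (α : G) :
    matOp ν σ (eMat σ i j m α) = (1 / 2 : ℂ) • fullMode i j (σ α) m := by
  rw [eMat, map_sub, matOp_single, matOp_single, entryOp_bar, entryOp_mono]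
  module

/-- The commutator has eight matrix terms, in four pairs exchanged up to sign by the
anti-involution; each pair doubles the coefficient 1/4. -/
theorem matOp_lie_eMat (i j k l : Fin ν) (m n : ℤ) (α β : G) :
    matOp ν σ ⁅eMat σ i j m α, eMat σ k l n β⁆ =
      (if j = k then (1 / 2 : ℂ) else 0) • entryOp ν σ i l (mono σ m α * mono σ n β) -
      (if i = k then (1 / 2 : ℂ) else 0) • entryOp ν σ j l (bar σ (mono σ m α) * mono σ n β) +
      (if j = l then (1 / 2 : ℂ) else 0) • entryOp ν σ k i (mono σ n β * bar σ (mono σ m α)) -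
      (if i = l then (1 / 2 : ℂ) else 0) • entryOp ν σ k j (mono σ n β * mono σ m α) := by
  have e1 := entryOp_bar (ν := ν) l i (mono σ m α * mono σ n β)
  have e2 := entryOp_bar (ν := ν) j k (mono σ n β * mono σ m α)
  have e3 := entryOp_bar (ν := ν) i k (mono σ n β * bar σ (mono σ m α))
  have e4 := entryOp_bar (ν := ν) l j (bar σ (mono σ m α) * mono σ n β)
  rw [bar_mul] at e1 e2 e3 e4
  rw [bar_bar] at e3 e4
  rw [Ring.lie_def, eMat, eMat]
  simp only [sub_mul, mul_sub, map_sub, matOp_single_mul_single, e1, e2, e3, e4]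
  have s1 : (if l = i then (1 / 4 : ℂ) else 0) = if i = l then (1 / 4 : ℂ) else 0 := by
    simp only [eq_comm]
  have s2 : (if k = i then (1 / 4 : ℂ) else 0) = if i = k then (1 / 4 : ℂ) else 0 := by
    simp only [eq_comm]
  have s3 : (if l = j then (1 / 4 : ℂ) else 0) = if j = l then (1 / 4 : ℂ) else 0 := by
    simp only [eq_comm]
  have s4 : (if k = j then (1 / 4 : ℂ) else 0) = if j = k then (1 / 4 : ℂ) else 0 := by
    simp only [eq_comm]
  have t (p : Prop) [Decidable p] : (if p then (1 / 2 : ℂ) else 0) =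
      2 * if p then (1 / 4 : ℂ) else 0 := by
    split_ifs <;> norm_num
  rw [s1, s2, s3, s4, t, t, t, t]
  module

theorem form_bar_bar (x y : SkewLaurent σ) : form σ (bar σ x) (bar σ y) = form σ x y := by
  induction x using mono_induction with
  | h0 => simp
  | hadd x x' h h' => simp only [map_add, LinearMap.add_apply, h, h']
  | hsmul c x h => simp only [map_smul, LinearMap.smul_apply, h]
  | hm m α =>
  induction y using mono_induction with
  | h0 => simp
  | hadd x x' h h' => simp only [map_add, h, h']
  | hsmul c x h => simp only [map_smul, h]
  | hm n β =>
  have ha := (σ α).ne_zero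
  rw [bar_mono, bar_mono, map_smul, map_smul, LinearMap.smul_apply, form_mono, form_mono,
    AddChar.map_neg_eq_inv, AddChar.map_neg_eq_inv]
  have e : (σ α)⁻¹ * (σ β)⁻¹ = 1 ↔ σ α * σ β = 1 := by rw [← mul_inv, inv_eq_one]
  by_cases h : m + n = 0 ∧ σ α * σ β = 1
  · rw [if_pos h, if_pos ⟨h.1, e.2 h.2⟩]
    obtain ⟨h1, h2⟩ := h
    obtain rfl : m = -n := by omega
    rw [← inv_eq_iff_mul_eq_one] at h2
    rw [← h2]
    have h3 : -((σ α : ℂ)) ≠ 0 := neg_ne_zero.2 ha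
    push_cast
    rw [neg_neg, ← inv_neg, inv_zpow', neg_neg, inv_zpow', smul_eq_mul, smul_eq_mul, ← mul_assoc,
      ← mul_zpow, neg_mul_neg, zpow_neg, mul_zpow]
    field_simp
  · rw [if_neg h, if_neg (fun h' => h ⟨h'.1, e.1 h'.2⟩), smul_zero, smul_zero]

open Classical in
theorem form_bar_mono_left (m n : ℤ) (α β : G) :
    form σ (bar σ (mono σ m α)) (mono σ n β) =
      if m + n = 0 ∧ σ β * (σ α)⁻¹ = 1 then (m : ℂ) * (-1 : ℂ) ^ m else 0 := by
  have ha := (σ α).ne_zero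
  rw [bar_mono, map_smul, LinearMap.smul_apply, form_mono, AddChar.map_neg_eq_inv,
    mul_comm _ (σ β)]
  by_cases h : m + n = 0 ∧ σ β * (σ α)⁻¹ = 1
  · rw [if_pos h, if_pos h]
    obtain rfl : n = -m := by omega
    push_cast
    rw [inv_zpow', neg_neg, neg_zpow_neg, smul_eq_mul]
    field_simp
  · rw [if_neg h, if_neg h, smul_zero]

theorem form_bar_right (x y : SkewLaurent σ) : form σ x (bar σ y) = form σ (bar σ x) y := by
  rw [← form_bar_bar, bar_bar]

-- Of the four cross terms, those related by the anti-involution agree because the form is invariant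
-- under it (`form_bar_bar`); this is the source of the factor 2.
open Classical in
theorem cocycle_eMat (i j k l : Fin ν) (m n : ℤ) (α β : G) :
    cocycle ν σ (eMat σ i j m α) (eMat σ k l n β) =
      (if i = l ∧ j = k ∧ m + n = 0 ∧ σ α * σ β = 1 then 2 * (m : ℂ) * (σ α : ℂ) ^ n else 0) -
      if i = k ∧ j = l ∧ m + n = 0 ∧ σ β * (σ α)⁻¹ = 1 then 2 * (m : ℂ) * (-1 : ℂ) ^ m else 0 := by
  rw [eMat, eMat]
  simp only [map_sub, LinearMap.sub_apply, cocycle_single, form_bar_right, bar_bar,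
    form_bar_mono_left, form_mono, and_comm (a := j = l), and_comm (a := j = k), ite_and]
  split_ifs <;> push_cast <;> ring

/-- Precomposing with X ↦ X - X^* makes the identity bilinear on the whole matrix algebra, so it can
be checked on matrix units, where it is a quarter of `fullMode_comm`. -/
theorem matOp_lie_skewPart (X Y : MatAlg ν σ) :
    matOp ν σ ⁅skewPart ν σ X, skewPart ν σ Y⁆ +
        (cocycle ν σ (skewPart ν σ X) (skewPart ν σ Y) / 2) • (1 : Module.End ℂ (Fock ν)) =
      ⁅matOp ν σ (skewPart ν σ X), matOp ν σ (skewPart ν σ Y)⁆ := by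
  classical
  induction X using matAlg_induction with
  | h0 => simp
  | hadd X X' h h' =>
    simp only [map_add, add_lie, LinearMap.add_apply, ← h, ← h']
    module
  | hsmul c X h =>
    rw [Ring.lie_def (matOp ν σ _)] at h ⊢
    rw [map_smul, map_smul, smul_lie, map_smul, map_smul, LinearMap.smul_apply, smul_mul_assoc,
      mul_smul_comm, smul_eq_mul]
    linear_combination (norm := module) c • h
  | hs i j m α =>
  induction Y using matAlg_induction with
  | h0 => simp
  | hadd X X' h h' =>
    simp only [map_add, lie_add, ← h, ← h']
    module
  | hsmul c X h =>
    rw [Ring.lie_def (matOp ν σ _)] at h ⊢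
    rw [map_smul, map_smul, lie_smul, map_smul, map_smul, smul_mul_assoc, mul_smul_comm,
      smul_eq_mul]
    linear_combination (norm := module) c • h
  | hs k l n β =>
  have ha := (σ α).ne_zero
  have e0 : (-(σ α : ℂ)) ^ (-m) = (-1 : ℂ) ^ m * (σ α : ℂ) ^ (-m) := by
    rw [neg_zpow_neg, zpow_neg]
  have e1 : entryOp ν σ i l (mono σ m α * mono σ n β) =
      ((σ α : ℂ) ^ n) • fullMode i l (σ α * σ β) (m + n) := by
    rw [mono_mul_mono, map_smul, entryOp_mono, AddChar.map_add_eq_mul, Units.val_zpow_eq_zpow_val]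
  have e2 : entryOp ν σ j l (bar σ (mono σ m α) * mono σ n β) =
      ((-1 : ℂ) ^ m * (σ α : ℂ) ^ (-m - n)) • fullMode j l (σ β * (σ α)⁻¹) (m + n) := by
    rw [bar_mono, smul_mul_assoc, mono_mul_mono, map_smul, map_smul, entryOp_mono,
      AddChar.map_add_eq_mul, AddChar.map_neg_eq_inv, smul_smul, mul_comm (σ α)⁻¹]
    push_cast
    rw [e0, inv_zpow', mul_assoc, ← zpow_add₀ ha, sub_eq_add_neg]
  have e3 : entryOp ν σ k i (mono σ n β * bar σ (mono σ m α)) =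
      ((-1 : ℂ) ^ m * (σ α : ℂ) ^ (-m) * (σ β : ℂ) ^ m) •
        fullMode k i (σ β * (σ α)⁻¹) (m + n) := by
    rw [bar_mono, mul_smul_comm, mono_mul_mono, map_smul, map_smul, entryOp_mono,
      AddChar.map_add_eq_mul, AddChar.map_neg_eq_inv, smul_smul, add_comm n]
    push_cast
    rw [e0]
  have e4 : entryOp ν σ k j (mono σ n β * mono σ m α) =
      ((σ β : ℂ) ^ m) • fullMode k j (σ α * σ β) (m + n) := by
    rw [mono_mul_mono, map_smul, entryOp_mono, AddChar.map_add_eq_mul, Units.val_zpow_eq_zpow_val,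
      add_comm n, mul_comm (σ β)]
  have h := fullMode_comm i j k l (σ α) (σ β) m n
  rw [← mul_boole (j = k), ← mul_boole (i = k), ← mul_boole (j = l), ← mul_boole (i = l),
    ← mul_boole (i = l ∧ _), ← mul_boole (i = k ∧ _)] at h
  rw [skewPart_single, skewPart_single, matOp_lie_eMat, matOp_eMat, matOp_eMat, cocycle_eMat,
    Ring.lie_def, smul_mul_smul_comm, smul_mul_smul_comm, e1, e2, e3, e4,
    ← mul_boole (j = k), ← mul_boole (i = k), ← mul_boole (j = l), ← mul_boole (i = l),
    ← mul_boole (i = l ∧ _), ← mul_boole (i = k ∧ _)]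
  linear_combination (norm := module) (-1 / 4 : ℂ) • h

variable (ν σ) in
/-- The representation of the central extension on the Fock space. -/
def fockRep : unitaryHat ν σ →ₗ⁅ℂ⁆ Module.End ℂ (Fock ν) where
  toFun x := matOp ν σ x.1.mat + (x.1.cent / 2) • (1 : Module.End ℂ (Fock ν))
  map_add' x y := by
    change matOp ν σ (x.1.mat + y.1.mat) + ((x.1.cent + y.1.cent) / 2) • _ = _
    rw [map_add]
    module
  map_smul' c x := by
    change matOp ν σ (c • x.1.mat) + ((c * x.1.cent) / 2) • _ = _
    rw [map_smul, RingHom.id_apply]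
    module
  map_lie' {x y} := by
    change matOp ν σ ⁅x.1.mat, y.1.mat⁆ + (cocycle ν σ x.1.mat y.1.mat / 2) • _ = _
    -- On the unitary algebra X - X^* = 2X, so halving the arguments returns x and y themselves.
    have h := matOp_lie_skewPart ((1 / 2 : ℂ) • x.1.mat) ((1 / 2 : ℂ) • y.1.mat)
    rw [map_smul, map_smul, skewPart_of_mem (X := x.1.mat) x.2,
      skewPart_of_mem (X := y.1.mat) y.2] at h
    rw [h, Ring.lie_def, Ring.lie_def]
    refine LinearMap.ext fun v => ?_
    simp only [LinearMap.sub_apply, LinearMap.add_apply, LinearMap.smul_apply,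
      Module.End.mul_apply, Module.End.one_apply, map_add, map_smul]
    module

theorem fockRep_eHat (i j : Fin ν) (m : ℤ) (α : G) :
    fockRep ν σ ((2 : ℂ) • eHat σ i j m α) = fullMode i j (σ α) m := by
  have h : fockRep ν σ (eHat σ i j m α) = (1 / 2 : ℂ) • fullMode i j (σ α) m := by
    change matOp ν σ (eMat σ i j m α) + ((0 : ℂ) / 2) • _ = _
    rw [matOp_eMat, zero_div, zero_smul, add_zero]
  rw [map_smul, h]
  module

theorem fockRep_cHat :
    fockRep ν σ (cHat ν σ) = (1 / 2 : ℂ) • (1 : Module.End ℂ (Fock ν)) := by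
  change matOp ν σ 0 + ((1 : ℂ) / 2) • _ = _
  rw [map_zero, zero_add]

variable (ν σ) in
/-- The map `X ↦ X - X^*` into the central extension. -/
def skewPartHat : MatAlg ν σ →ₗ[ℂ] unitaryHat ν σ where
  toFun X := ⟨⟨skewPart ν σ X, 0⟩, skewPart_mem X⟩
  map_add' X Y := by
    refine Subtype.ext (GLHat.ext (map_add _ _ _) ?_)
    exact (add_zero (0 : ℂ)).symm
  map_smul' c X := by
    refine Subtype.ext (GLHat.ext (map_smul _ _ _) ?_)
    exact (mul_zero c).symm

theorem eq_skewPartHat_add (x : unitaryHat ν σ) :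
    x = (1 / 2 : ℂ) • skewPartHat ν σ x.1.mat + x.1.cent • cHat ν σ := by
  refine Subtype.ext (GLHat.ext ?_ ?_)
  · change x.1.mat = (1 / 2 : ℂ) • skewPart ν σ x.1.mat + x.1.cent • (0 : MatAlg ν σ)
    rw [smul_zero, add_zero, skewPart_of_mem (X := x.1.mat) x.2]
  · change x.1.cent = (1 / 2 : ℂ) * 0 + x.1.cent * 1
    ring

/-- Every element is half the skew part of its matrix plus a multiple of c, and skew parts of the
matrix units with monomial entries are the e_ij(m,α); so these and c span. -/
theorem unitaryHat_hom_ext {L : Type*} [LieRing L] [LieAlgebra ℂ L]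
    {f g : unitaryHat ν σ →ₗ⁅ℂ⁆ L} (hc : f (cHat ν σ) = g (cHat ν σ))
    (he : ∀ i j m α, f ((2 : ℂ) • eHat σ i j m α) = g ((2 : ℂ) • eHat σ i j m α)) : f = g := by
  have h (X : MatAlg ν σ) : f (skewPartHat ν σ X) = g (skewPartHat ν σ X) := by
    induction X using matAlg_induction with
    | h0 => simp
    | hadd X Y hX hY => rw [map_add, map_add, map_add, hX, hY]
    | hsmul c X hX => rw [map_smul, map_smul, map_smul, hX]
    | hs i j m α =>
      have e : skewPartHat ν σ (Matrix.single i j (mono σ m α)) =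
          (1 / 2 : ℂ) • (2 : ℂ) • eHat σ i j m α := by
        rw [smul_smul]
        norm_num
        exact Subtype.ext (GLHat.ext (skewPart_single i j m α) rfl)
      rw [e, map_smul f, map_smul g, he]
  ext x
  rw [eq_skewPartHat_add x, map_add, map_add, map_smul, map_smul, map_smul, map_smul, h, hc]

end Representation

end UnitaryVertex

end

open Classical in
theorem theorem3p2 {G : Type*} [AddCommGroup G] (σ : AddChar G ℂˣ) (ν : ℕ) (hν : 2 ≤ ν) :
    ∃! ρ : UnitaryVertex.unitaryHat ν σ →ₗ⁅ℂ⁆ Module.End ℂ (UnitaryVertex.Fock ν),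
      (∀ (i j : Fin ν) (m : ℤ) (α : G),
        ρ ((2 : ℂ) • UnitaryVertex.eHat σ i j m α) =
          UnitaryVertex.vertexMode i j (σ α) m +
            (if i = j ∧ σ α ≠ 1 ∧ m = 0 then (1 + (σ α : ℂ)) / (1 - (σ α : ℂ)) else 0) •
              (1 : Module.End ℂ (UnitaryVertex.Fock ν))) ∧
      ρ (UnitaryVertex.cHat ν σ) = (1 / 2 : ℂ) • (1 : Module.End ℂ (UnitaryVertex.Fock ν)) := by
  refine ⟨UnitaryVertex.fockRep ν σ, ⟨fun i j m α => ?_, UnitaryVertex.fockRep_cHat⟩, ?_⟩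
  · rw [UnitaryVertex.fockRep_eHat, UnitaryVertex.fullMode, UnitaryVertex.modeConst]
  · rintro ρ ⟨h1, h2⟩
    refine UnitaryVertex.unitaryHat_hom_ext ?_ fun i j m α => ?_
    · rw [h2, UnitaryVertex.fockRep_cHat]
    · rw [h1, UnitaryVertex.fockRep_eHat, UnitaryVertex.fullMode, UnitaryVertex.modeConst]
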